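/- Let $L$ be a nonempty finite list with $N=|L|$ items, let $R:L\to\mathbb R$, and for $i\in L$ let $f_i(j)=1$ if $R(j)>R(i)$ and $f_i(j)=0$ otherwise. Let $c_q\in\mathbb N$ be the number of queries to $f_i$ that one use of the quantum oracle of $f_i$ costs, and let $1\le k\le c_q$ be the number of queries charged for checking a measured item (the check itself needs one query, $k=1$; charging it like an oracle call, $k=c_q$, is an upper bound). $\mathrm{QMax}_\infty$ chooses a current item $y\in L$ uniformly at random and then repeats forever: with the items $j$ such that $f_y(j)=1$ as marked items, run the following search, and replace $y$ by the item it returns. The search starts with $m=6/5$; in each Grover cycle it chooses $j$ uniformly among the non-negative integers smaller than $m$, applies $j$ Grover iterations to the uniform superposition over $L$ (each uses the oracle of $f_y$ once), measures, and checks whether the observed item is marked; if so it returns that item, otherwise it replaces $m$ by $\min(\tfrac65 m,\sqrt N)$ and starts the next cycle. A cycle costs $c_qj+k$ queries. Let $E_{\mathrm{QMax}_\infty}$ be the expected number of queries until $y$ maximises $R$. Put $$B(N)=c_q\sum_{t=1}^{N-1}\frac{F(N,t)}{t+1},\qquad F(N,t)=\begin{cases}\frac94\frac{N}{\sqrt{(N-t)t}}+\Big\lceil\log_{6/5}\frac{N}{2\sqrt{(N-t)t}}\Big\rceil-3,&1\le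 t<\frac N4,\\ 2.0344,&\frac N4\le t\le N.\end{cases}$$ For $\varepsilon>0$ and a real timeout $T\ge0$, let $\mathrm{QMax}(T,\varepsilon)$ be the algorithm that makes $r=\max(0,\lceil\log_3(1/\varepsilon)\rceil)$ independent runs of $\mathrm{QMax}_\infty$, stops each run before the first Grover cycle that would bring its number of queries above $T$, and returns, among the final items $y$ of the runs, one with the largest value of $R$ (this final comparison is not charged). 1. If $T\ge 3E_{\mathrm{QMax}_\infty}$, in particular if $T=3E_{\mathrm{QMax}_\infty}$, then $\mathrm{QMax}(T,\varepsilon)$ returns an item that maximises $R$ with probability at least $1-\varepsilon$, and its expected number of queries is at most $rT$. For $T=3E_{\mathrm{QMax}_\infty}$ and $\varepsilon<1$ this is $\lceil\log_3(1/\varepsilon)\rceil\cdot 3E_{\mathrm{QMax}_\infty}$. 2. The same two conclusions hold whenever $T\ge 3B(N)$, in particular for $T=3B(N)$. 3. Explicit timeouts are sufficient in 1, because $$3E_{\mathrm{QMax}_\infty}\le c_q\big(19.0515\sqrt N+8.4609\big)$$ and $$3E_{\mathrm{QMax}_\infty}\le c_q\Big[\tfrac{9\sqrt3(1+\pi)}4\sqrt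 N+\tfrac{3\ln(N/4)}{2\ln(6/5)}\big(\ln(N/3)+\ln(N/4+1)\big)-6\ln(N/4)+16.0466+\tfrac{3\,\mathrm{Li}_2(-\lceil N/4\rceil+1)}{2\ln(6/5)}\Big],$$ where $\mathrm{Li}_2(x)=-\int_0^x\frac{\ln(1-u)}u\,du$ is the dilogarithm. -/

import Mathlib

open MeasureTheory ProbabilityTheory
open scoped ENNReal NNReal

namespace QMax

section Grover

variable {L : Type*} [Fintype L]

/-- The phase oracle of the set `S` of marked items, i.e. the reflection through the span of the
unmarked basis states. One application of it uses the oracle `O_g` of the marking function once. -/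
noncomputable def reflectUnmarked (S : Set L) (ψ : EuclideanSpace ℂ L) : EuclideanSpace ℂ L :=
  open scoped Classical in WithLp.toLp 2 fun x => if x ∈ S then -ψ x else ψ x

/-- The reflection `2 |s⟩⟨s| - 1` through the uniform superposition `|s⟩`. -/
noncomputable def reflectUniform (ψ : EuclideanSpace ℂ L) : EuclideanSpace ℂ L :=
  WithLp.toLp 2 fun x => 2 * ((∑ z, ψ z) / (Fintype.card L : ℂ)) - ψ x

/-- One Grover iteration. -/
noncomputable def groverIteration (S : Set L) (ψ : EuclideanSpace ℂ L) : EuclideanSpace ℂ L :=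
  reflectUniform (reflectUnmarked S ψ)

/-- The uniform superposition over all items of the list. -/
noncomputable def uniformState (L : Type*) [Fintype L] : EuclideanSpace ℂ L :=
  WithLp.toLp 2 fun _ => ((1 / √(Fintype.card L : ℝ) : ℝ) : ℂ)

/-- The state after `j` Grover iterations on the uniform superposition. -/
noncomputable def groverState (S : Set L) (j : ℕ) : EuclideanSpace ℂ L :=
  (groverIteration S)^[j] (uniformState L)

theorem norm_reflectUnmarked (S : Set L) (ψ : EuclideanSpace ℂ L) :
    ‖reflectUnmarked S ψ‖ = ‖ψ‖ := by
  classical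
  rw [EuclideanSpace.norm_eq, EuclideanSpace.norm_eq]
  congr 1
  refine Finset.sum_congr rfl fun x _ => ?_
  simp only [reflectUnmarked]
  split_ifs <;> simp

theorem norm_reflectUniform [Nonempty L] (ψ : EuclideanSpace ℂ L) :
    ‖reflectUniform ψ‖ = ‖ψ‖ := by
  have hN : (Fintype.card L : ℂ) ≠ 0 := by simp
  have key : ∑ x, ‖reflectUniform ψ x‖ ^ 2 = ∑ x, ‖ψ x‖ ^ 2 := by
    have h : ((∑ x, ‖reflectUniform ψ x‖ ^ 2 : ℝ) : ℂ) = ((∑ x, ‖ψ x‖ ^ 2 : ℝ) : ℂ) := by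
      push_cast
      simp only [← Complex.conj_mul', reflectUniform, map_sub, map_mul, map_div₀, map_sum,
        map_ofNat, map_natCast, mul_sub, sub_mul, Finset.sum_sub_distrib, ← Finset.mul_sum,
        ← Finset.sum_mul, Finset.sum_const, Finset.card_univ, nsmul_eq_mul]
      field_simp
      ring
    exact_mod_cast h
  rw [EuclideanSpace.norm_eq, EuclideanSpace.norm_eq, key]

theorem norm_groverState [Nonempty L] (S : Set L) (j : ℕ) : ‖groverState S j‖ = 1 := by
  induction j with
  | zero =>
    have hN : (Fintype.card L : ℝ) ≠ 0 := by simp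
    simp only [groverState, uniformState, Function.iterate_zero, id, EuclideanSpace.norm_eq,
      Complex.norm_real, Real.norm_eq_abs, sq_abs, div_pow, one_pow, Finset.sum_const,
      Finset.card_univ, nsmul_eq_mul]
    rw [Real.sq_sqrt (Nat.cast_nonneg _), mul_one_div_cancel hN, Real.sqrt_one]
  | succ j ih =>
    rw [groverState, Function.iterate_succ_apply', groverIteration, norm_reflectUniform,
      norm_reflectUnmarked]
    exact ih

/-- Born's rule: the law of the measurement of the list register in the computational basis,
after `j` Grover iterations on the uniform superposition. -/
noncomputable def groverCycle [Nonempty L] (S : Set L) (j : ℕ) : PMF L :=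
  PMF.ofFintype (fun x => ENNReal.ofReal (‖groverState S j x‖ ^ 2)) (by
    rw [← ENNReal.ofReal_sum_of_nonneg fun x _ => sq_nonneg _, ← EuclideanSpace.norm_sq_eq,
      norm_groverState, one_pow, ENNReal.ofReal_one])

end Grover

/-- The parameter `m` of the infinite-time search on a list of length `N` in its cycle number `u`
(starting from `0`): it starts at `6/5`, and an unsuccessful cycle replaces it by
`min (6/5 * m) √N`. -/
noncomputable def cycleBound (N : ℕ) : ℕ → ℝ
  | 0 => 6 / 5
  | u + 1 => min (6 / 5 * cycleBound N u) √N

theorem cycleBound_pos {N : ℕ} (hN : 0 < N) (u : ℕ) : 0 < cycleBound N u := by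
  induction u with
  | zero => norm_num [cycleBound]
  | succ u ih =>
    have : (0 : ℝ) < √N := Real.sqrt_pos.2 (by exact_mod_cast hN)
    exact lt_min (by positivity) this

/-- The state of maximum finding between two Grover cycles: the current item, the number of
unsuccessful cycles of the current search, and the number of queries made so far. -/
structure State (L : Type*) where
  item : L
  cycle : ℕ
  queries : ℕ

instance (L : Type*) : MeasurableSpace (State L) := ⊤

section Algorithm

variable {L : Type*} [Fintype L] [Nonempty L]

/-- The marked items `f_y⁻¹(1)`, where `f_y(j) = 1` if `R j > R y`, and `0` otherwise. -/
def marked (R : L → ℝ) (y : L) : Set L := {j | R y < R j}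

/-- One Grover cycle of the infinite-time maximum finding algorithm. With `m` the current bound,
choose `j` uniformly at random among the nonnegative integers smaller than `m`, do `j` Grover
iterations (`cq` queries each), measure, and check (`k` queries) whether the observed item is
marked. If so, it becomes the current item and a new search starts; if not, the search goes on. -/
noncomputable def step (R : L → ℝ) (cq k : ℕ) (s : State L) : PMF (State L) :=
  open scoped Classical in
  (PMF.uniformOfFinset (Finset.range ⌈cycleBound (Fintype.card L) s.cycle⌉₊)
    (Finset.nonempty_range_iff.2
      (Nat.ceil_pos.2 (cycleBound_pos Fintype.card_pos s.cycle)).ne')).bind fun j =>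
  (groverCycle (marked R s.item) j).map fun x =>
    if x ∈ marked R s.item then ⟨x, 0, s.queries + (cq * j + k)⟩
    else ⟨s.item, s.cycle + 1, s.queries + (cq * j + k)⟩

/-- The initial state: a uniformly random item, no queries. -/
noncomputable def initial (L : Type*) [Fintype L] [Nonempty L] : PMF (State L) :=
  (PMF.uniformOfFintype L).map fun i => ⟨i, 0, 0⟩

/-- The transition kernel of the Markov chain with transitions `step`. -/
noncomputable def stepKernel (R : L → ℝ) (cq k : ℕ) : Kernel (State L) (State L) where
  toFun s := (step R cq k s).toMeasure
  measurable' := measurable_from_top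

instance (R : L → ℝ) (cq k : ℕ) : IsMarkovKernel (stepKernel R cq k) :=
  ⟨fun s => inferInstanceAs (IsProbabilityMeasure (step R cq k s).toMeasure)⟩

/-- The law of the whole (infinite) run of the infinite-time algorithm, as a sequence of states;
the state number `n` is the one after `n` Grover cycles. -/
noncomputable def runLaw (R : L → ℝ) (cq k : ℕ) : Measure (ℕ → State L) :=
  Kernel.trajMeasure (X := fun _ => State L) (initial L).toMeasure fun n =>
    (stepKernel R cq k).comap (fun h => h ⟨n, Finset.mem_Iic.2 le_rfl⟩) (measurable_pi_apply _)

instance (R : L → ℝ) (cq k : ℕ) : IsProbabilityMeasure (runLaw R cq k) := by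
  unfold runLaw
  infer_instance

/-- The number of queries made by a run until its current item maximises `R`
(`∞` if this never happens). -/
noncomputable def queriesToMax (R : L → ℝ) (ω : ℕ → State L) : ℝ≥0∞ :=
  ⨅ (n : ℕ) (_ : ∀ i, R i ≤ R (ω n).item), ((ω n).queries : ℝ≥0∞)

/-- The expected number of queries of the infinite-time algorithm to find the maximum. -/
noncomputable def expectedQueries (R : L → ℝ) (cq k : ℕ) : ℝ≥0∞ :=
  ∫⁻ ω, queriesToMax R ω ∂(runLaw R cq k)

/-- The state in which a run with timeout `T` stops: the one before the first Grover cycle whose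
execution would bring the number of queries above `T`. -/
noncomputable def stopState (T : ℝ≥0) (ω : ℕ → State L) : State L :=
  ω (sInf {n : ℕ | T < ((ω (n + 1)).queries : ℝ≥0)})

/-- The law of `r` independent runs. -/
noncomputable def runsLaw (R : L → ℝ) (cq k r : ℕ) : Measure (Fin r → ℕ → State L) :=
  Measure.pi fun _ => runLaw R cq k

/-- The output of `r` runs with timeout `T`: the item with the largest value of `R` among the final
items of the runs (`none` if `r = 0`). -/
noncomputable def output (R : L → ℝ) (T : ℝ≥0) {r : ℕ} (ω : Fin r → ℕ → State L) : Option L :=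
  (List.ofFn fun a => (stopState T (ω a)).item).argmax R

/-- The total number of queries made by `r` runs with timeout `T`. -/
noncomputable def totalQueries (T : ℝ≥0) {r : ℕ} (ω : Fin r → ℕ → State L) : ℕ :=
  ∑ a, (stopState T (ω a)).queries

/-- The maximum is found with probability at least `1 - ε`, and the expected number of queries is
at most `⌈log₃ (1/ε)⌉ * T`, by `⌈log₃ (1/ε)⌉` independent runs with timeout `T`. -/
def TimeoutSuffices (R : L → ℝ) (cq k : ℕ) (ε : ℝ) (T : ℝ≥0) : Prop :=
  ENNReal.ofReal (1 - ε) ≤ runsLaw R cq k ⌈Real.logb 3 (1 / ε)⌉₊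
      {ω | ∃ x ∈ output R T ω, ∀ i, R i ≤ R x} ∧
    ∫⁻ ω, (totalQueries T ω : ℝ≥0∞) ∂(runsLaw R cq k ⌈Real.logb 3 (1 / ε)⌉₊) ≤
      (⌈Real.logb 3 (1 / ε)⌉₊ : ℝ≥0∞) * T

end Algorithm

/-- The function `F(N, t)`: for `t < N/4`, with `m = N / (2 √((N - t) t))`, it is
`9/2 * m + ⌈log_{6/5} m⌉ - 3`. -/
noncomputable def F (N t : ℕ) : ℝ :=
  if (t : ℝ) < N / 4 then
    9 / 4 * (N / √(((N : ℝ) - t) * t)) + ⌈Real.logb (6 / 5) (N / (2 * √(((N : ℝ) - t) * t)))⌉ - 3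
  else 2.0344

/-- The series `c_q * ∑_{t=1}^{N-1} F(N, t) / (t + 1)`. -/
noncomputable def seriesBound (N cq : ℕ) : ℝ :=
  cq * ∑ t ∈ Finset.Ico 1 N, F N t / (t + 1)

/-- The dilogarithm (Spence's function) at a real argument `x ≤ 1`. -/
noncomputable def dilog (x : ℝ) : ℝ := -∫ u in (0 : ℝ)..x, Real.log (1 - u) / u

/-- An explicit timeout, of a simple form. -/
noncomputable def looseTimeout (N cq : ℕ) : ℝ := cq * (19.0515 * √N + 8.4609)

/-- An explicit timeout, with a smaller coefficient of the leading term `√N`. -/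
noncomputable def tightTimeout (N cq : ℕ) : ℝ :=
  cq * (9 * √3 * (1 + Real.pi) / 4 * √N
    + 3 * Real.log (N / 4) / (2 * Real.log (6 / 5)) * (Real.log (N / 3) + Real.log (N / 4 + 1))
    - 6 * Real.log (N / 4) + 16.0466
    + 3 * dilog (-⌈(N : ℝ) / 4⌉ + 1) / (2 * Real.log (6 / 5)))

end QMax

/-!
Maximum finding is a Markov chain whose states are the current item, the number of unsuccessful
cycles of the current search, and the number of queries so far. Three facts carry the theorem.

* **Amplification.** By independent repetition, a timeout suffices if a single run misses the
  maximum with probability at most `1/3` (`timeoutSuffices_of_measure_le`). By Markov's inequality,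
  three times the expected number of queries is such a timeout
  (`timeoutSuffices_of_expectedQueries_le`).

* **Reduction to single searches.** Grover iterations rotate a plane, so that `j` of them on `t`
  marked items among `N` succeed with probability `sin² ((2 j + 1) θ)`, where `sin² θ = t / N`
  (`groverState_apply`), and produce a uniformly random marked item. If a search for `t` marked
  items costs at most `H t / t` oracle calls, with `H` monotone, then the whole algorithm costs at
  most `∑ H t / (t (t + 1))` oracle calls (`expectedQueries_le_of_searchCost`). This is proved with
  a potential function on the states, and ties between the values of `R` only help.

* **The cost of a search.** Let `a = N / (2 √((N - t) t)) = 1 / sin (2 θ)`. A cycle which chooses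
  among `M` numbers of iterations succeeds with probability at least `1/2 - a / (4 M)`, and also at
  least `(M / a)² / 4` as long as `M ≤ a` (`successProb_eq`, `sq_div_four_le_successProb`). Running
  these bounds backwards through the cycles shows that, for `N ≥ 64`, a search costs at most
  `9/2 a` for `t < N / 4` (`searchCostLE_of_lt_quarter`) and at most `26/5` otherwise
  (`searchCostLE_of_quarter_le`). Moderate values of `a` are covered by finitely many intervals of
  rational numbers, large ones by a quadratic certificate.

For `N ≥ 128`, elementary estimates of the sums give the bound `26/5 √N` for the expected number of
oracle calls, which is below a third of both explicit timeouts, and compare it with the series: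
there `t < N / 4` contributes the same multiple `9/2 a`, and the surplus of the ceilings
`⌈log_{6/5} a⌉` for small `t` makes up for the smaller constant `2.0344` for `t ≥ N / 4`
(`sum_potential_le_sum_F`). For `N < 128` the same two inequalities are evaluated in exact integer
arithmetic with rounding in the safe direction (`checkFewItems`).

The comparison with the series needs `N ≥ 5`. For `N = 2, 3, 4`, the expected number of queries may
be larger than the series; nevertheless three times the series is a sufficient timeout, because the
failure probability itself, computed by a recursion over the remaining budget, is at most `1/3`
(`timeoutSuffices_of_failureBound`).
-/

namespace QMax

/-! ### Expectations along the Markov chain -/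

section Trajectory

/-- The expectation of a nonnegative function under a probability mass function. -/
noncomputable def pmfExp {α : Type*} (p : PMF α) (f : α → ℝ≥0∞) : ℝ≥0∞ := ∑' a, p a * f a

theorem pmfExp_bind {α β : Type*} (p : PMF α) (g : α → PMF β) (f : β → ℝ≥0∞) :
    pmfExp (p.bind g) f = pmfExp p fun a => pmfExp (g a) f := by
  simp only [pmfExp, PMF.bind_apply, ← ENNReal.tsum_mul_right, ← ENNReal.tsum_mul_left]
  rw [ENNReal.tsum_comm]
  simp only [mul_assoc]

theorem pmfExp_map {α β : Type*} (p : PMF α) (g : α → β) (f : β → ℝ≥0∞) :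
    pmfExp (p.map g) f = pmfExp p fun a => f (g a) := by
  rw [PMF.map, pmfExp_bind]
  congr 1
  funext a
  rw [pmfExp, tsum_eq_single (g a)]
  · simp
  · intro b hb
    simp [hb]

theorem pmfExp_uniformOfFinset {α : Type*} (s : Finset α) (hs : s.Nonempty) (f : α → ℝ≥0∞) :
    pmfExp (PMF.uniformOfFinset s hs) f = (s.card : ℝ≥0∞)⁻¹ * ∑ a ∈ s, f a := by
  rw [pmfExp, tsum_eq_sum (s := s)]
  · rw [Finset.mul_sum]
    refine Finset.sum_congr rfl fun a ha => ?_
    rw [PMF.uniformOfFinset_apply_of_mem hs ha]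
  · intro a ha
    rw [PMF.uniformOfFinset_apply_of_notMem hs ha, zero_mul]

instance {L : Type*} [Finite L] : Countable (State L) := by
  refine Function.Injective.countable (f := fun s : State L => (s.item, s.cycle, s.queries)) ?_
  rintro ⟨a, b, c⟩ ⟨a', b', c'⟩ h
  simp_all

instance {L : Type*} : DiscreteMeasurableSpace (State L) := ⟨fun _ => trivial⟩

theorem lintegral_toMeasure {L : Type*} [Finite L] (p : PMF (State L)) (f : State L → ℝ≥0∞) :
    ∫⁻ s, f s ∂p.toMeasure = pmfExp p f := by
  rw [lintegral_countable', pmfExp]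
  refine tsum_congr fun a => ?_
  rw [PMF.toMeasure_apply_singleton _ _ (measurableSet_singleton a), mul_comm]

variable {L : Type*} [Fintype L] [Nonempty L] (R : L → ℝ) (cq k : ℕ)

theorem runLaw_map_zero : (runLaw R cq k).map (fun ω => ω 0) = (initial L).toMeasure := by
  have h0 : (fun ω : ℕ → State L => ω 0) =
      (fun h : (Finset.Iic 0 → State L) => h ⟨0, Finset.mem_Iic.2 le_rfl⟩) ∘
        Preorder.frestrictLe (π := fun _ => State L) 0 := rfl
  rw [h0, ← Measure.map_map (by fun_prop) (by fun_prop), runLaw, Kernel.trajMeasure,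
    Measure.map_comp _ _ (by fun_prop), Kernel.traj_map_frestrictLe, Kernel.partialTraj_self,
    Measure.id_comp, Measure.map_map (by fun_prop) (by fun_prop)]
  convert Measure.map_id
  rfl

theorem lintegral_runLaw_zero (f : State L → ℝ≥0∞) :
    ∫⁻ ω, f (ω 0) ∂(runLaw R cq k) = pmfExp (initial L) f := by
  rw [← lintegral_toMeasure, ← runLaw_map_zero R cq k,
    lintegral_map (by fun_prop) (by fun_prop)]

/-- The Markov property, for functions of two consecutive states. -/
theorem lintegral_runLaw_succ (f : State L → State L → ℝ≥0∞) (n : ℕ) :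
    ∫⁻ ω, f (ω n) (ω (n + 1)) ∂(runLaw R cq k) =
      ∫⁻ ω, pmfExp (step R cq k (ω n)) (f (ω n)) ∂(runLaw R cq k) := by
  have h := Kernel.map_frestrictLe_trajMeasure_compProd_eq_map_trajMeasure
    (X := fun _ => State L) (μ₀ := (initial L).toMeasure) (κ := fun n =>
    (stepKernel R cq k).comap (fun h : (Finset.Iic n → State L) => h ⟨n, Finset.mem_Iic.2 le_rfl⟩)
      (measurable_pi_apply _))
    (a := n)
  have hf : Measurable fun q : (Finset.Iic n → State L) × State L =>
      f (q.1 ⟨n, Finset.mem_Iic.2 le_rfl⟩) q.2 := by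
    have : Measurable (Function.uncurry f) := by fun_prop
    exact this.comp (f := fun q : (Finset.Iic n → State L) × State L =>
      (q.1 ⟨n, Finset.mem_Iic.2 le_rfl⟩, q.2)) (by fun_prop)
  have h1 := congrArg (fun μ => ∫⁻ q, f (q.1 ⟨n, Finset.mem_Iic.2 le_rfl⟩) q.2 ∂μ) h
  rw [lintegral_map hf (by fun_prop), Measure.lintegral_compProd hf,
    lintegral_map (by
      exact Measurable.lintegral_kernel_prod_right' hf) (by fun_prop)] at h1
  simp only [Kernel.comap_apply, stepKernel, Kernel.coe_mk, lintegral_toMeasure] at h1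
  exact h1.symm

/-- If the potential `Φ` pays, in expectation, for the charge `f` of each transition, then the
expected total charge of a run is at most the expected potential of the initial state. -/
theorem lintegral_tsum_le_of_potential (f : State L → State L → ℝ≥0∞) (Φ : State L → ℝ≥0∞)
    (h : ∀ s, pmfExp (step R cq k s) (fun s' => f s s' + Φ s') ≤ Φ s) :
    ∫⁻ ω, ∑' n, f (ω n) (ω (n + 1)) ∂(runLaw R cq k) ≤ pmfExp (initial L) Φ := by
  have hf : Measurable (Function.uncurry f) := by fun_prop
  have hm : ∀ n, Measurable fun ω : ℕ → State L => f (ω n) (ω (n + 1)) := fun n =>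
    hf.comp (f := fun ω : ℕ → State L => (ω n, ω (n + 1))) (by fun_prop)
  rw [lintegral_tsum fun n => (hm n).aemeasurable]
  have key : ∀ n, ∑ i ∈ Finset.range n, ∫⁻ ω, f (ω i) (ω (i + 1)) ∂(runLaw R cq k)
      + ∫⁻ ω, Φ (ω n) ∂(runLaw R cq k) ≤ pmfExp (initial L) Φ := by
    intro n
    induction n with
    | zero => simp [lintegral_runLaw_zero]
    | succ n ih =>
      refine le_trans ?_ ih
      rw [Finset.sum_range_succ, add_assoc, ← lintegral_add_left (hm n),
        lintegral_runLaw_succ R cq k (fun s s' => f s s' + Φ s') n]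
      gcongr
      exact h _
  refine ENNReal.tsum_le_of_sum_range_le fun n => le_trans le_self_add (key n)

theorem ae_runLaw_zero {P : State L → Prop} (h : ∀ i, P ⟨i, 0, 0⟩) :
    ∀ᵐ ω ∂(runLaw R cq k), P (ω 0) := by
  classical
  have h1 := lintegral_runLaw_zero R cq k (fun s => if P s then 0 else 1)
  rw [initial, pmfExp_map] at h1
  simp only [h, if_true, pmfExp, mul_zero, tsum_zero] at h1
  rw [lintegral_eq_zero_iff (by
    exact (measurable_of_countable (fun s : State L => if P s then (0 : ℝ≥0∞) else 1)).comp
      (measurable_pi_apply 0))] at h1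
  filter_upwards [h1] with ω hω
  by_contra hP
  simp [hP] at hω

theorem ae_runLaw_succ {P : State L → State L → Prop}
    (h : ∀ s, ∀ s' ∈ (step R cq k s).support, P s s') :
    ∀ᵐ ω ∂(runLaw R cq k), ∀ n, P (ω n) (ω (n + 1)) := by
  classical
  rw [ae_all_iff]
  intro n
  have h1 := lintegral_runLaw_succ R cq k (fun s s' => if P s s' then 0 else 1) n
  have h2 : ∀ s, pmfExp (step R cq k s) (fun s' => if P s s' then 0 else 1) = 0 := by
    intro s
    rw [pmfExp, ENNReal.tsum_eq_zero]
    intro s'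
    by_cases hs : s' ∈ (step R cq k s).support
    · simp [h s s' hs]
    · rw [PMF.apply_eq_zero_iff _ _ |>.2 hs, zero_mul]
  simp only [h2, lintegral_zero] at h1
  have hf : Measurable (Function.uncurry fun s s' : State L => if P s s' then (0 : ℝ≥0∞) else 1) :=
    by fun_prop
  replace h1 := (lintegral_eq_zero_iff (hf.comp (f := fun ω : ℕ → State L => (ω n, ω (n + 1)))
    (by fun_prop))).1 h1
  filter_upwards [h1] with ω hω
  by_contra hP
  simp [hP] at hω

end Trajectory

/-! ### Timeouts, independent runs and the Markov inequality -/

section Runs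

variable {L : Type*} {R : L → ℝ}

/-- The current item of the state maximises `R`. -/
def IsDone (R : L → ℝ) (s : State L) : Prop := ∀ i, R i ≤ R s.item

/-- The properties of almost every run: each cycle makes a query, and the maximum is not lost. -/
def IsRegularRun (R : L → ℝ) (ω : ℕ → State L) : Prop :=
  ∀ n, (ω n).queries + 1 ≤ (ω (n + 1)).queries ∧ (IsDone R (ω n) → IsDone R (ω (n + 1)))

theorem queries_strictMono {ω : ℕ → State L} (hω : IsRegularRun R ω) :
    StrictMono fun n => (ω n).queries :=
  strictMono_nat_of_lt_succ fun n => (hω n).1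

theorem isDone_mono {ω : ℕ → State L} (hω : IsRegularRun R ω) {m n : ℕ} (hmn : m ≤ n)
    (h : IsDone R (ω m)) : IsDone R (ω n) := by
  induction n, hmn using Nat.le_induction with
  | base => exact h
  | succ n _ ih => exact (hω n).2 ih

theorem exists_timeout {ω : ℕ → State L} (hω : IsRegularRun R ω) (T : ℝ≥0) :
    ∃ n, T < ((ω (n + 1)).queries : ℝ≥0) := by
  obtain ⟨n, hn⟩ := exists_nat_gt T
  refine ⟨n, hn.trans_le ?_⟩
  exact_mod_cast (Nat.le_succ n).trans ((queries_strictMono hω).le_apply (x := n + 1))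

theorem queries_stopState_le {ω : ℕ → State L} (h0 : (ω 0).queries = 0) (T : ℝ≥0) :
    ((stopState T ω).queries : ℝ≥0) ≤ T := by
  rw [stopState]
  set S := {n : ℕ | T < ((ω (n + 1)).queries : ℝ≥0)}
  rcases h : sInf S with _ | m
  · simp [h0]
  · have : m ∉ S := Nat.notMem_of_lt_sInf (by lia)
    simpa [S] using this

theorem le_stop_index {ω : ℕ → State L} (hω : IsRegularRun R ω) {T : ℝ≥0} {n : ℕ}
    (hn : ((ω n).queries : ℝ≥0) ≤ T) :
    n ≤ sInf {n : ℕ | T < ((ω (n + 1)).queries : ℝ≥0)} := by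
  by_contra! hlt
  have hmem := Nat.sInf_mem (exists_timeout hω T)
  have h1 : ((ω (sInf {n : ℕ | T < ((ω (n + 1)).queries : ℝ≥0)} + 1)).queries : ℝ≥0) ≤
      (ω n).queries := by
    exact_mod_cast (queries_strictMono hω).monotone hlt
  exact absurd (h1.trans hn) (not_le.2 hmem)

theorem isDone_stopState {ω : ℕ → State L} (hω : IsRegularRun R ω) {T : ℝ≥0} {n : ℕ}
    (hd : IsDone R (ω n)) (hn : ((ω n).queries : ℝ≥0) ≤ T) : IsDone R (stopState T ω) :=
  isDone_mono hω (le_stop_index hω hn) hd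

open scoped Classical in
/-- The number of queries to the maximum, charged to the transitions out of the states that are not
done. If no state is done, infinitely many transitions are charged and both sides are infinite. -/
theorem queriesToMax_le_tsum {ω : ℕ → State L} (hω : IsRegularRun R ω) (h0 : (ω 0).queries = 0) :
    queriesToMax R ω ≤ ∑' n, if IsDone R (ω n) then (0 : ℝ≥0∞)
      else (((ω (n + 1)).queries - (ω n).queries : ℕ) : ℝ≥0∞) := by
  -- The charges of the first `n` transitions add up to the queries made, as long as none of the
  -- first `n` states is done.
  have hsum : ∀ n, (∀ m < n, ¬ IsDone R (ω m)) → ((ω n).queries : ℝ≥0∞) ≤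
      ∑' n, if IsDone R (ω n) then (0 : ℝ≥0∞)
      else (((ω (n + 1)).queries - (ω n).queries : ℕ) : ℝ≥0∞) := by
    intro n hn
    refine le_trans (le_of_eq ?_) (ENNReal.sum_le_tsum (Finset.range n))
    rw [Finset.sum_congr rfl fun m hm => if_neg (hn m (Finset.mem_range.1 hm)), ← Nat.cast_sum,
      Finset.sum_range_tsub (queries_strictMono hω).monotone, h0, Nat.sub_zero]
  by_cases hd : ∃ n, IsDone R (ω n)
  · refine le_trans (iInf₂_le (Nat.find hd) (Nat.find_spec hd)) ?_
    exact hsum _ fun m hm => Nat.find_min hd hm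
  · push Not at hd
    refine le_of_le_of_eq le_top (ENNReal.eq_top_of_forall_nnreal_le fun r => ?_).symm
    obtain ⟨n, hn⟩ := exists_nat_ge r
    refine le_trans ?_ (hsum n fun m _ => hd m)
    have : (r : ℝ≥0∞) ≤ (n : ℝ≥0∞) := by exact_mod_cast hn
    exact this.trans (by exact_mod_cast (queries_strictMono hω).le_apply)

open scoped Classical in
/-- A run that is not done within `Q` queries makes a transition, from a state that is not done,
across the budget `Q`. -/
theorem one_le_tsum_crossing {ω : ℕ → State L} (hω : IsRegularRun R ω) (h0 : (ω 0).queries = 0)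
    {Q : ℕ} (hfail : ¬ ∃ n, IsDone R (ω n) ∧ (ω n).queries ≤ Q) :
    (1 : ℝ≥0∞) ≤ ∑' n, if ¬ IsDone R (ω n) ∧ (ω n).queries ≤ Q ∧ Q < (ω (n + 1)).queries
      then 1 else 0 := by
  have h1 := queries_stopState_le h0 (Q : ℝ≥0)
  have h2 := Nat.sInf_mem (exists_timeout hω (Q : ℝ≥0))
  rw [stopState] at h1
  set n := sInf {n : ℕ | (Q : ℝ≥0) < ((ω (n + 1)).queries : ℝ≥0)}
  have h1' : (ω n).queries ≤ Q := by exact_mod_cast h1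
  have h2' : Q < (ω (n + 1)).queries := by
    have h3 : (Q : ℝ≥0) < ((ω (n + 1)).queries : ℝ≥0) := h2
    exact_mod_cast h3
  refine le_trans ?_ (ENNReal.le_tsum n)
  rw [if_pos ⟨fun hd => hfail ⟨n, hd, h1'⟩, h1', h2'⟩]

theorem isDone_output {T : ℝ≥0} {r : ℕ} {ω : Fin r → ℕ → State L} {a : Fin r}
    (h : IsDone R (stopState T (ω a))) : ∃ x ∈ output R T ω, ∀ i, R i ≤ R x := by
  have hmem : (stopState T (ω a)).item ∈ List.ofFn fun a => (stopState T (ω a)).item :=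
    (List.mem_ofFn' _ _).2 ⟨a, rfl⟩
  rcases hx : (List.ofFn fun a => (stopState T (ω a)).item).argmax R with _ | x
  · rw [List.argmax_eq_none] at hx
    rw [hx] at hmem
    exact absurd hmem List.not_mem_nil
  · exact ⟨x, hx, fun i => (h i).trans (List.le_of_mem_argmax hmem hx)⟩

theorem measurable_queriesToMax : Measurable (queriesToMax R : (ℕ → State L) → ℝ≥0∞) := by
  classical
  refine Measurable.iInf fun n => ?_
  have hf : Measurable fun s : State L => ⨅ (_ : IsDone R s), (s.queries : ℝ≥0∞) := by fun_prop
  exact hf.comp (measurable_pi_apply n)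

variable [Fintype L] [Nonempty L] {cq k : ℕ}

theorem step_support {s s' : State L} (hs : s' ∈ (step R cq k s).support) :
    s.queries + k ≤ s'.queries ∧ (IsDone R s → IsDone R s') := by
  classical
  simp only [step, PMF.mem_support_bind_iff, PMF.mem_support_map_iff] at hs
  obtain ⟨j, -, x, -, rfl⟩ := hs
  refine ⟨by split_ifs <;> simp only [] <;> lia, fun h => ?_⟩
  have hx : x ∉ marked R s.item := fun hx => not_le.2 hx (h x)
  simpa [hx, IsDone] using h

theorem ae_run (hk : 1 ≤ k) : ∀ᵐ ω ∂(runLaw R cq k), (ω 0).queries = 0 ∧ IsRegularRun R ω := by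
  have h0 := ae_runLaw_zero R cq k (P := fun s => s.queries = 0) fun i => rfl
  have h1 := ae_runLaw_succ R cq k
    (P := fun s s' => s.queries + k ≤ s'.queries ∧ (IsDone R s → IsDone R s'))
    fun s s' hs => step_support hs
  filter_upwards [h0, h1] with ω h0 h1
  exact ⟨h0, fun n => ⟨by have := (h1 n).1; lia, (h1 n).2⟩⟩

/-- Independent repetition: a failure probability of at most `1/3` for a single run is enough. -/
theorem timeoutSuffices_of_measure_le (hk : 1 ≤ k) {ε : ℝ} (hε : 0 < ε) {T : ℝ≥0}
    (h : (runLaw R cq k) {ω | ¬ ∃ n, IsDone R (ω n) ∧ ((ω n).queries : ℝ≥0) ≤ T} ≤ 3⁻¹) :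
    TimeoutSuffices R cq k ε T := by
  set r := ⌈Real.logb 3 (1 / ε)⌉₊ with hr
  have hae : ∀ᵐ ω ∂(runsLaw R cq k r), ∀ a, (ω a 0).queries = 0 ∧ IsRegularRun R (ω a) :=
    Filter.eventually_all.2 fun a =>
      (Measure.tendsto_eval_ae_ae (μ := fun _ : Fin r => runLaw R cq k)).eventually
        (ae_run (R := R) (cq := cq) hk)
  constructor
  · set S := {ω : Fin r → ℕ → State L | ∃ x ∈ output R T ω, ∀ i, R i ≤ R x}
    have hfail : runsLaw R cq k r Sᶜ ≤ ENNReal.ofReal ε := by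
      calc runsLaw R cq k r Sᶜ
          ≤ runsLaw R cq k r (Set.univ.pi fun _ =>
              {ω | ¬ ∃ n, IsDone R (ω n) ∧ ((ω n).queries : ℝ≥0) ≤ T}) := by
            refine measure_mono_ae ?_
            filter_upwards [hae] with ω hω hS a _ hex
            obtain ⟨n, hd, hn⟩ := hex
            exact hS (isDone_output (isDone_stopState (hω a).2 hd hn))
        _ ≤ (3⁻¹ : ℝ≥0∞) ^ r := by
            rw [runsLaw, Measure.pi_pi, Finset.prod_const, Finset.card_univ, Fintype.card_fin]
            gcongr
        _ ≤ ENNReal.ofReal ε := by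
            have h3 : (3⁻¹ : ℝ≥0∞) = ENNReal.ofReal (3⁻¹ : ℝ) := by
              rw [ENNReal.ofReal_inv_of_pos (by norm_num)]
              norm_num
            rw [h3, ← ENNReal.ofReal_pow (by norm_num)]
            refine ENNReal.ofReal_le_ofReal ?_
            have h4 : 1 / ε ≤ (3 : ℝ) ^ (r : ℝ) :=
              (Real.logb_le_iff_le_rpow (by norm_num) (by positivity)).1 (Nat.le_ceil _)
            rw [Real.rpow_natCast] at h4
            rw [inv_pow]
            rw [one_div] at h4
            exact inv_le_of_inv_le₀ hε h4
    have hone : (1 : ℝ≥0∞) ≤ runsLaw R cq k r S + ENNReal.ofReal ε := by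
      have : IsProbabilityMeasure (runsLaw R cq k r) := by unfold runsLaw; infer_instance
      calc (1 : ℝ≥0∞) = runsLaw R cq k r (S ∪ Sᶜ) := by rw [Set.union_compl_self, measure_univ]
        _ ≤ _ := (measure_union_le _ _).trans (add_le_add le_rfl hfail)
    rw [ENNReal.ofReal_sub _ hε.le, ENNReal.ofReal_one]
    exact tsub_le_iff_right.2 hone
  · have : IsProbabilityMeasure (runsLaw R cq k r) := by unfold runsLaw; infer_instance
    calc ∫⁻ ω, (totalQueries T ω : ℝ≥0∞) ∂(runsLaw R cq k r)
        ≤ ∫⁻ _, (r : ℝ≥0∞) * T ∂(runsLaw R cq k r) := by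
          refine lintegral_mono_ae ?_
          filter_upwards [hae] with ω hω
          have h1 : ((totalQueries T ω : ℕ) : ℝ≥0) ≤ r * T := by
            rw [totalQueries, Nat.cast_sum]
            refine (Finset.sum_le_card_nsmul _ _ T fun a _ =>
              queries_stopState_le (hω a).1 T).trans ?_
            simp
          exact_mod_cast h1
      _ = _ := by rw [lintegral_const, measure_univ, mul_one]

/-- A potential that pays, in expectation, a unit charge when a run that is not done crosses the
budget `Q` bounds the failure probability of a run. -/
theorem timeoutSuffices_of_crossing (hk : 1 ≤ k) {ε : ℝ} (hε : 0 < ε) {T : ℝ≥0} {Q : ℕ}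
    (hQ : (Q : ℝ≥0) ≤ T) (Φ : State L → ℝ≥0∞)
    (h : ∀ s, pmfExp (step R cq k s) (fun s' => open scoped Classical in
      (if ¬ IsDone R s ∧ s.queries ≤ Q ∧ Q < s'.queries then 1 else 0) + Φ s') ≤ Φ s)
    (h0 : pmfExp (initial L) Φ ≤ 3⁻¹) : TimeoutSuffices R cq k ε T := by
  classical
  refine timeoutSuffices_of_measure_le hk hε (le_trans ?_ h0)
  refine le_trans ?_ (lintegral_tsum_le_of_potential R cq k _ Φ h)
  calc (runLaw R cq k) {ω | ¬ ∃ n, IsDone R (ω n) ∧ ((ω n).queries : ℝ≥0) ≤ T}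
      ≤ (runLaw R cq k) {ω | 1 ≤ ∑' n, if ¬ IsDone R (ω n) ∧ (ω n).queries ≤ Q ∧
          Q < (ω (n + 1)).queries then (1 : ℝ≥0∞) else 0} := by
        refine measure_mono_ae ?_
        filter_upwards [ae_run (R := R) (cq := cq) hk] with ω hω hfail
        refine one_le_tsum_crossing hω.2 hω.1 fun ⟨n, hd, hn⟩ => hfail ⟨n, hd, ?_⟩
        exact le_trans (by exact_mod_cast hn) hQ
    _ ≤ _ := by
        refine (le_of_eq (one_mul _).symm).trans (mul_meas_ge_le_lintegral ?_ 1)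
        refine Measurable.tsum fun n => ?_
        have hf : Measurable (Function.uncurry fun s s' : State L =>
          if ¬ IsDone R s ∧ s.queries ≤ Q ∧ Q < s'.queries then (1 : ℝ≥0∞) else 0) := by
          fun_prop
        exact hf.comp (f := fun ω : ℕ → State L => (ω n, ω (n + 1))) (by fun_prop)

/-- Markov's inequality for the number of queries to the maximum. -/
theorem timeoutSuffices_of_expectedQueries_le (hk : 1 ≤ k) {ε : ℝ} (hε : 0 < ε) {T : ℝ≥0}
    (hT : 3 * expectedQueries R cq k ≤ T) : TimeoutSuffices R cq k ε T := by
  refine timeoutSuffices_of_measure_le hk hε ?_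
  have hsub : {ω : ℕ → State L | ¬ ∃ n, IsDone R (ω n) ∧ ((ω n).queries : ℝ≥0) ≤ T} ⊆
      {ω | (T : ℝ≥0∞) < queriesToMax R ω} := by
    intro ω hω
    by_contra hle
    rw [Set.mem_ofPred_eq, not_lt] at hle
    -- The number of queries is an integer, so it is at most `T` once it is below `⌊T⌋ + 1`.
    have hlt : queriesToMax R ω < ((⌊T⌋₊ + 1 : ℕ) : ℝ≥0∞) :=
      hle.trans_lt (by exact_mod_cast Nat.lt_floor_add_one T)
    simp only [queriesToMax, iInf_lt_iff] at hlt
    obtain ⟨n, hd, hn⟩ := hlt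
    have hn' : (ω n).queries ≤ ⌊T⌋₊ := Nat.lt_succ_iff.1 (by exact_mod_cast hn)
    exact hω ⟨n, hd, (Nat.cast_le.2 hn').trans (Nat.floor_le T.2)⟩
  refine (measure_mono hsub).trans ?_
  rcases eq_or_ne T 0 with rfl | hT0
  · have hE : expectedQueries R cq k = 0 := by simpa using hT
    rw [expectedQueries, lintegral_eq_zero_iff measurable_queriesToMax] at hE
    have : (runLaw R cq k) {ω | ((0 : ℝ≥0) : ℝ≥0∞) < queriesToMax R ω} = 0 := by
      rw [← nonpos_iff_eq_zero, ← ae_iff.1 hE]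
      refine measure_mono fun ω hω => ?_
      simpa [pos_iff_ne_zero] using hω
    exact this.trans_le zero_le
  · have hM := mul_meas_ge_le_lintegral (μ := runLaw R cq k)
      (measurable_queriesToMax (R := R)) (T : ℝ≥0∞)
    have hT' : (T : ℝ≥0∞) ≠ 0 := by exact_mod_cast hT0
    have h3 : (T : ℝ≥0∞) * (3 * (runLaw R cq k) {ω | (T : ℝ≥0∞) < queriesToMax R ω}) ≤ T * 1 := by
      calc (T : ℝ≥0∞) * (3 * (runLaw R cq k) {ω | (T : ℝ≥0∞) < queriesToMax R ω})
          ≤ 3 * (T * (runLaw R cq k) {ω | (T : ℝ≥0∞) ≤ queriesToMax R ω}) := by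
            rw [mul_left_comm]
            gcongr
            intro hlt
            exact hlt.le
        _ ≤ 3 * expectedQueries R cq k := by gcongr; exact hM
        _ ≤ T * 1 := by rw [mul_one]; exact hT
    have h4 := (ENNReal.mul_le_mul_iff_right hT' ENNReal.coe_ne_top).1 h3
    rw [mul_comm] at h4
    rwa [← ENNReal.le_div_iff_mul_le (by simp) (by simp), one_div] at h4

/-- A potential that pays for the queries of each transition out of a state that is not done
bounds the expected number of queries to the maximum. -/
theorem expectedQueries_le_of_potential (hk : 1 ≤ k) (Φ : State L → ℝ≥0∞)
    (h : ∀ s, pmfExp (step R cq k s) (fun s' => open scoped Classical in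
      (if IsDone R s then (0 : ℝ≥0∞) else ((s'.queries - s.queries : ℕ) : ℝ≥0∞)) + Φ s') ≤ Φ s) :
    expectedQueries R cq k ≤ pmfExp (initial L) Φ := by
  classical
  refine le_trans (lintegral_mono_ae ?_) (lintegral_tsum_le_of_potential R cq k _ Φ h)
  filter_upwards [ae_run (R := R) (cq := cq) hk] with ω hω
  exact queriesToMax_le_tsum hω.2 hω.1

end Runs

/-! ### Amplitudes under Grover iterations -/

section Amplitudes

/-- The Grover angle `θ` with `sin² θ = t / N`, for `t` marked items among `N`. -/
noncomputable def groverAngle (N t : ℕ) : ℝ := Real.arcsin √((t : ℝ) / N)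

theorem sin_groverAngle {N t : ℕ} (ht : t ≤ N) :
    Real.sin (groverAngle N t) = √((t : ℝ) / N) := by
  refine Real.sin_arcsin (by linarith [Real.sqrt_nonneg ((t : ℝ) / N)]) ?_
  rw [Real.sqrt_le_one]
  exact div_le_one_of_le₀ (by exact_mod_cast ht) (Nat.cast_nonneg _)

theorem cos_groverAngle {N t : ℕ} (hN : 0 < N) :
    Real.cos (groverAngle N t) = √(((N : ℝ) - t) / N) := by
  have hN' : (N : ℝ) ≠ 0 := by positivity
  rw [groverAngle, Real.cos_arcsin, Real.sq_sqrt (by positivity), sub_div, div_self hN']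

/-- The probability that `j` Grover iterations on `t` marked items among `N`, followed by a
measurement, produce a marked item. -/
noncomputable def hitProb (N t j : ℕ) : ℝ := Real.sin ((2 * j + 1) * groverAngle N t) ^ 2

theorem hitProb_nonneg (N t j : ℕ) : 0 ≤ hitProb N t j := sq_nonneg _

theorem one_sub_hitProb (N t j : ℕ) :
    1 - hitProb N t j = Real.cos ((2 * j + 1) * groverAngle N t) ^ 2 := by
  rw [hitProb, Real.cos_sq']

theorem hitProb_le_one (N t j : ℕ) : hitProb N t j ≤ 1 := Real.sin_sq_le_one _

variable {L : Type*} [Fintype L]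

open scoped Classical in
/-- In the plane spanned by the uniform superpositions of the marked and of the unmarked items, each
Grover iteration is a rotation by `2 θ`, and the initial state has the angle `θ`. -/
theorem groverState_apply (S : Finset L) (hS : S.Nonempty) (hSL : S.card < Fintype.card L) (j : ℕ)
    (x : L) :
    groverState (S : Set L) j x = if x ∈ S then
      ((Real.sin ((2 * j + 1) * groverAngle (Fintype.card L) S.card) / √(S.card : ℝ) : ℝ) : ℂ)
    else ((Real.cos ((2 * j + 1) * groverAngle (Fintype.card L) S.card) /
      √((Fintype.card L : ℝ) - S.card) : ℝ) : ℂ) := by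
  set N := Fintype.card L with hNdef
  set t := S.card with htdef
  set θ := groverAngle N t with hθ
  have hN : 0 < N := by lia
  have ht : (0 : ℝ) < t := by exact_mod_cast hS.card_pos
  have hNt : (0 : ℝ) < (N : ℝ) - t := sub_pos.2 (by exact_mod_cast hSL)
  have hN' : (0 : ℝ) < N := by exact_mod_cast hN
  have hsin : Real.sin θ = √t / √N := by
    rw [hθ, sin_groverAngle hSL.le, Real.sqrt_div ht.le]
  have hcos : Real.cos θ = √((N : ℝ) - t) / √N := by
    rw [hθ, cos_groverAngle hN, Real.sqrt_div hNt.le]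
  have h1 : √(t : ℝ) ≠ 0 := (Real.sqrt_pos.2 ht).ne'
  have h2 : √((N : ℝ) - t) ≠ 0 := (Real.sqrt_pos.2 hNt).ne'
  have h3 : √(N : ℝ) ≠ 0 := (Real.sqrt_pos.2 hN').ne'
  induction j generalizing x with
  | zero =>
    simp only [groverState, uniformState, Function.iterate_zero, id, CharP.cast_eq_zero, mul_zero,
      zero_add, one_mul, hsin, hcos, ← hNdef]
    split_ifs <;> congr 1 <;> field_simp
  | succ j ih =>
    set α : ℝ := (2 * j + 1) * θ with hα
    have hα' : (2 * ((j + 1 : ℕ) : ℝ) + 1) * θ = α + 2 * θ := by push_cast; ring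
    -- The sum of the amplitudes after the reflection through the unmarked states.
    have hsum : ∑ z, reflectUnmarked (S : Set L) (groverState (S : Set L) j) z =
        ((√N * Real.cos (α + θ) : ℝ) : ℂ) := by
      have hz : ∀ z, reflectUnmarked (S : Set L) (groverState (S : Set L) j) z =
          ((if z ∈ S then -(Real.sin α / √t) else Real.cos α / √((N : ℝ) - t) : ℝ) : ℂ) := by
        intro z
        simp only [reflectUnmarked, Finset.mem_coe, ih z]
        split_ifs <;> simp
      simp only [hz]
      rw [← Complex.ofReal_sum, Finset.sum_ite]
      simp only [Finset.sum_const, Finset.filter_univ_mem, Finset.filter_not, nsmul_eq_mul]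
      rw [Finset.card_sdiff_of_subset (Finset.subset_univ _), Finset.card_univ,
        ← hNdef, ← htdef, Nat.cast_sub hSL.le, Real.cos_add, hsin, hcos]
      congr 1
      have e1 : (t : ℝ) = √t * √t := (Real.mul_self_sqrt ht.le).symm
      have e2 : (N : ℝ) - t = √((N : ℝ) - t) * √((N : ℝ) - t) := (Real.mul_self_sqrt hNt.le).symm
      have e3 : (t : ℝ) * -(Real.sin α / √t) = -(√t * Real.sin α) := by
        nth_rewrite 1 [e1]
        field_simp
      have e4 : ((N : ℝ) - t) * (Real.cos α / √((N : ℝ) - t)) = √((N : ℝ) - t) * Real.cos α := by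
        nth_rewrite 1 [e2]
        field_simp
      rw [e3, e4]
      field_simp
      ring
    have hstep : groverState (S : Set L) (j + 1) x =
        2 * ((∑ z, reflectUnmarked (S : Set L) (groverState (S : Set L) j) z) / (N : ℂ)) -
          reflectUnmarked (S : Set L) (groverState (S : Set L) j) x := by
      rw [groverState, Function.iterate_succ_apply', ← groverState, groverIteration]
      rfl
    have hN2 : (N : ℝ) = √N * √N := (Real.mul_self_sqrt hN'.le).symm
    rw [hstep, hsum, hα']
    simp only [reflectUnmarked, Finset.mem_coe, ih x]
    rw [← Complex.ofReal_natCast]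
    have hS1 : Real.sin (α + 2 * θ) = 2 * (√t / √N) * Real.cos (α + θ) + Real.sin α := by
      rw [← hsin, show α + 2 * θ = (α + θ) + θ by ring, Real.sin_add (α + θ)]
      have h := Real.sin_sub (α + θ) θ
      rw [add_sub_cancel_right] at h
      rw [h]
      ring
    have hC1 : Real.cos (α + 2 * θ) =
        2 * (√((N : ℝ) - t) / √N) * Real.cos (α + θ) - Real.cos α := by
      rw [← hcos, show α + 2 * θ = (α + θ) + θ by ring, Real.cos_add (α + θ)]
      have h := Real.cos_sub (α + θ) θ
      rw [add_sub_cancel_right] at h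
      rw [h]
      ring
    split_ifs
    · rw [hS1]
      simp only [← Complex.ofReal_neg, ← Complex.ofReal_sub, ← Complex.ofReal_div,
        ← Complex.ofReal_mul, ← Complex.ofReal_ofNat]
      congr 1
      nth_rewrite 2 [hN2]
      field_simp
      ring
    · rw [hC1]
      simp only [← Complex.ofReal_sub, ← Complex.ofReal_div, ← Complex.ofReal_mul,
        ← Complex.ofReal_ofNat]
      congr 1
      nth_rewrite 2 [hN2]
      field_simp

end Amplitudes

/-! ### One step of maximum finding -/

section Step

/-- Sums over the items of a list with possible ties, arranged by rank: if the `i`-th best item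
has at most `i - 1` better ones, a monotone function of the number of better items is
summed to at most its value for a list without ties. -/
theorem sum_rank_le {L : Type*} (R : L → ℝ) {V : ℕ → ℝ} (hV : Monotone V) (A : Finset L) :
    ∑ x ∈ A, V {z ∈ A | R x < R z}.card ≤ ∑ i ∈ Finset.range A.card, V i := by
  classical
  induction A using Finset.induction_on_min_value R with
  | empty => simp
  | insert a A ha hmin ih =>
    rw [Finset.sum_insert ha, Finset.card_insert_of_notMem ha, Finset.sum_range_succ, add_comm]
    refine add_le_add (le_trans (le_of_eq ?_) ih) (hV ?_)
    · refine Finset.sum_congr rfl fun x hx => ?_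
      rw [Finset.filter_insert, if_neg (not_lt.2 (hmin x hx))]
    · rw [Finset.filter_insert, if_neg (lt_irrefl _)]
      exact Finset.card_filter_le _ _

variable {L : Type*} [Fintype L]

/-- The items with a value of `R` above that of `y`. -/
noncomputable def betterItems (R : L → ℝ) (y : L) : Finset L := {x | R y < R x}

/-- The number `⌈m⌉` of choices for the number of Grover iterations in the cycle number `u`. -/
noncomputable def numChoices (N u : ℕ) : ℕ := ⌈cycleBound N u⌉₊

theorem numChoices_pos {N : ℕ} (hN : 0 < N) (u : ℕ) : 0 < numChoices N u :=
  Nat.ceil_pos.2 (cycleBound_pos hN u)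

variable (R : L → ℝ) (cq k : ℕ)

theorem coe_betterItems (y : L) : (betterItems R y : Set L) = marked R y := by
  ext x
  simp [betterItems, marked]

theorem card_betterItems_lt (y : L) : (betterItems R y).card < Fintype.card L := by
  refine Finset.card_lt_univ_of_notMem (x := y) ?_
  simp [betterItems]

theorem isDone_iff (s : State L) : IsDone R s ↔ betterItems R s.item = ∅ := by
  simp [IsDone, betterItems, Finset.filter_eq_empty_iff]

theorem sum_betterItems_le {V : ℕ → ℝ} (hV : Monotone V) (y : L) :
    ∑ x ∈ betterItems R y, V (betterItems R x).card ≤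
      ∑ i ∈ Finset.range (betterItems R y).card, V i := by
  refine le_trans (le_of_eq ?_) (sum_rank_le R hV (betterItems R y))
  refine Finset.sum_congr rfl fun x hx => ?_
  congr 2
  ext z
  simp only [betterItems, Finset.mem_filter, Finset.mem_univ, true_and] at hx ⊢
  exact ⟨fun h => ⟨hx.trans h, h⟩, fun h => h.2⟩

variable [Nonempty L]

theorem pmfExp_step (s : State L) (f : State L → ℝ≥0∞) : pmfExp (step R cq k s) f =
    (numChoices (Fintype.card L) s.cycle : ℝ≥0∞)⁻¹ *
      ∑ j ∈ Finset.range (numChoices (Fintype.card L) s.cycle),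
        ∑ x, ENNReal.ofReal (‖groverState (marked R s.item) j x‖ ^ 2) *
          f (open scoped Classical in
            if x ∈ marked R s.item then ⟨x, 0, s.queries + (cq * j + k)⟩
            else ⟨s.item, s.cycle + 1, s.queries + (cq * j + k)⟩) := by
  rw [step, pmfExp_bind, pmfExp_uniformOfFinset, Finset.card_range]
  refine congrArg _ (Finset.sum_congr rfl fun j _ => ?_)
  rw [pmfExp_map, pmfExp, tsum_fintype]
  rfl

/-- In a state that is not done, an expectation over the next state splits according to the number
of iterations and the outcome of the check. -/
theorem pmfExp_step_ofReal {s : State L} (hs : ¬ IsDone R s) (f : State L → ℝ)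
    (hf : ∀ s', 0 ≤ f s') : pmfExp (step R cq k s) (fun s' => ENNReal.ofReal (f s')) =
    ENNReal.ofReal ((numChoices (Fintype.card L) s.cycle : ℝ)⁻¹ *
      ∑ j ∈ Finset.range (numChoices (Fintype.card L) s.cycle),
        (hitProb (Fintype.card L) (betterItems R s.item).card j / (betterItems R s.item).card *
            ∑ x ∈ betterItems R s.item, f ⟨x, 0, s.queries + (cq * j + k)⟩ +
          (1 - hitProb (Fintype.card L) (betterItems R s.item).card j) *
            f ⟨s.item, s.cycle + 1, s.queries + (cq * j + k)⟩)) := by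
  classical
  set S := betterItems R s.item with hS
  set M := numChoices (Fintype.card L) s.cycle
  have hSne : S.Nonempty := by rwa [isDone_iff, ← ne_eq, ← Finset.nonempty_iff_ne_empty] at hs
  have hM : (0 : ℝ) < M := by exact_mod_cast numChoices_pos Fintype.card_pos _
  have hcard := card_betterItems_lt R s.item
  rw [← hS] at hcard
  rw [pmfExp_step, ← coe_betterItems, ← hS, ENNReal.ofReal_mul (by positivity),
    ENNReal.ofReal_inv_of_pos hM, ENNReal.ofReal_natCast]
  congr 1
  have ht : (0 : ℝ) < S.card := by exact_mod_cast hSne.card_pos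
  have hNt : (0 : ℝ) < (Fintype.card L : ℝ) - S.card := sub_pos.2 (by exact_mod_cast hcard)
  simp only [← ENNReal.ofReal_mul (sq_nonneg _)]
  rw [Finset.sum_congr rfl fun j _ => (ENNReal.ofReal_sum_of_nonneg fun x _ =>
      mul_nonneg (sq_nonneg _) (hf _)).symm,
    ← ENNReal.ofReal_sum_of_nonneg fun j _ => Finset.sum_nonneg fun x _ =>
      mul_nonneg (sq_nonneg _) (hf _)]
  congr 1
  refine Finset.sum_congr rfl fun j _ => ?_
  rw [← Finset.sum_add_sum_compl S]
  congr 1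
  · rw [Finset.mul_sum]
    refine Finset.sum_congr rfl fun x hx => ?_
    rw [groverState_apply S hSne hcard, if_pos hx, if_pos (Finset.mem_coe.2 hx), Complex.norm_real,
      Real.norm_eq_abs, sq_abs, div_pow, Real.sq_sqrt ht.le, hitProb]
  · rw [Finset.sum_congr rfl (g := fun _ =>
      (1 - hitProb (Fintype.card L) S.card j) / ((Fintype.card L : ℝ) - S.card) *
        f ⟨s.item, s.cycle + 1, s.queries + (cq * j + k)⟩) fun x hx => ?_]
    · rw [Finset.sum_const, Finset.card_compl, nsmul_eq_mul, Nat.cast_sub hcard.le]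
      field_simp
    · have hx' : x ∉ S := Finset.mem_compl.1 hx
      rw [groverState_apply S hSne hcard, if_neg hx', if_neg (by simpa using hx'),
        Complex.norm_real, Real.norm_eq_abs, sq_abs, div_pow, Real.sq_sqrt hNt.le, one_sub_hitProb]

theorem pmfExp_step_of_isDone {s : State L} (hs : IsDone R s) {f : State L → ℝ≥0∞}
    (hf : ∀ s', IsDone R s' → f s' = 0) : pmfExp (step R cq k s) f = 0 := by
  rw [pmfExp, ENNReal.tsum_eq_zero]
  intro s'
  by_cases h : s' ∈ (step R cq k s).support
  · rw [hf s' ((step_support h).2 hs), mul_zero]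
  · rw [(PMF.apply_eq_zero_iff _ _).2 h, zero_mul]

theorem pmfExp_initial (f : State L → ℝ) (hf : ∀ s', 0 ≤ f s') :
    pmfExp (initial L) (fun s => ENNReal.ofReal (f s)) =
      ENNReal.ofReal ((Fintype.card L : ℝ)⁻¹ * ∑ x : L, f ⟨x, 0, 0⟩) := by
  have hN : (0 : ℝ) < Fintype.card L := by exact_mod_cast Fintype.card_pos
  rw [initial, pmfExp_map, PMF.uniformOfFintype, pmfExp_uniformOfFinset,
    ENNReal.ofReal_mul (by positivity), ENNReal.ofReal_inv_of_pos hN, ENNReal.ofReal_natCast,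
    Finset.card_univ, ENNReal.ofReal_sum_of_nonneg fun x _ => hf _]

end Step

/-! ### Recursions for the cost and for the failure probability -/

section Search

/-- The probability that a Grover cycle which chooses the number of iterations uniformly among
`0, …, M - 1` finds one of `t` marked items among `N`. -/
noncomputable def successProb (N t M : ℕ) : ℝ := (∑ j ∈ Finset.range M, hitProb N t j) / M

theorem successProb_le_one (N t M : ℕ) : successProb N t M ≤ 1 := by
  refine div_le_one_of_le₀ ?_ (Nat.cast_nonneg _)
  refine (Finset.sum_le_card_nsmul _ _ 1 fun j _ => hitProb_le_one N t j).trans ?_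
  simp

/-- The search for `t` marked items among `N`, started in its cycle number `u`, makes at most `c`
oracle calls on average, if a check counts as one oracle call. It is certified by a sequence `S`
of bounds for the starts in the cycles `v ≥ u`. -/
def SearchCostLE (N t u : ℕ) (c : ℝ) : Prop :=
  ∃ S : ℕ → ℝ, (∀ v, 0 ≤ S v) ∧
    (∀ v, u ≤ v → ((numChoices N v : ℝ) + 1) / 2 +
      (1 - successProb N t (numChoices N v)) * S (v + 1) ≤ S v) ∧ S u ≤ c

theorem SearchCostLE.mono {N t u : ℕ} {c c' : ℝ} (h : SearchCostLE N t u c) (hc : c ≤ c') :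
    SearchCostLE N t u c' := by
  obtain ⟨S, h0, h1, h2⟩ := h
  exact ⟨S, h0, h1, h2.trans hc⟩

/-- The cost of a search started one cycle earlier. -/
theorem SearchCostLE.step {N t u : ℕ} {c c' : ℝ} (h : SearchCostLE N t (u + 1) c)
    (hc : ((numChoices N u : ℝ) + 1) / 2 + (1 - successProb N t (numChoices N u)) * c ≤ c') :
    SearchCostLE N t u c' := by
  obtain ⟨S, h0, h1, h2⟩ := h
  have hq : 0 ≤ 1 - successProb N t (numChoices N u) := sub_nonneg.2 (successProb_le_one _ _ _)
  refine ⟨fun v => if v = u then c' else S v, fun v => ?_, fun v hv => ?_, by simp⟩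
  · dsimp only
    split_ifs
    · have := mul_nonneg hq ((h0 _).trans h2)
      have : (0 : ℝ) ≤ (numChoices N u : ℝ) := Nat.cast_nonneg _
      linarith
    · exact h0 v
  · rcases hv.eq_or_lt with rfl | hv
    · simp only [Nat.succ_ne_self, if_false, if_true]
      refine le_trans ?_ hc
      gcongr
    · dsimp only
      rw [if_neg (show v + 1 ≠ u by lia), if_neg hv.ne']
      exact h1 v hv

variable {L : Type*} [Fintype L] [Nonempty L] {R : L → ℝ} {cq k : ℕ}

theorem sum_hitProb {N t M : ℕ} (hM : 0 < M) :
    ∑ j ∈ Finset.range M, hitProb N t j = M * successProb N t M := by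
  rw [successProb]
  field_simp

/-- The recursion for the cost of maximum finding, in terms of bounds `H t / t` for the cost of a
search for `t` marked items. The next current item is uniformly distributed over the `t` better
ones, which gives the rank `t + 1` a chance of `1 / (t + 1)` of being visited. Monotonicity of `H`
makes ties harmless. -/
theorem expectedQueries_le_of_searchCost (hk : 1 ≤ k) (hkcq : k ≤ cq) {H : ℕ → ℝ}
    (hH : Monotone H) (hH0 : H 0 = 0)
    (hC : ∀ t, 1 ≤ t → t < Fintype.card L → SearchCostLE (Fintype.card L) t 0 (H t / t)) :
    expectedQueries R cq k ≤ ENNReal.ofReal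
      (cq * ∑ t ∈ Finset.range (Fintype.card L), H t / t / (t + 1)) := by
  classical
  set N := Fintype.card L with hN
  choose! S hS0 hS1 hS2 using hC
  have hHnn : ∀ t, 0 ≤ H t := fun t => hH0 ▸ hH (Nat.zero_le t)
  -- `A t` is the cost from a random one of the `t` best items, `V t` the cost from the next one.
  set A : ℕ → ℝ := fun t => ∑ s ∈ Finset.range t, H s / s / (s + 1) with hA
  set V : ℕ → ℝ := fun t => H t / t + A t with hV
  have hAsucc : ∀ t, A (t + 1) = A t + H t / t / (t + 1) := fun t => Finset.sum_range_succ _ _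
  have hAnn : ∀ t, 0 ≤ A t := fun t => Finset.sum_nonneg fun s _ => by
    have := hHnn s
    positivity
  have hVmono : Monotone V := by
    refine monotone_nat_of_le_succ fun t => ?_
    simp only [hV, hAsucc]
    have h1 := hH (Nat.le_succ t)
    rcases Nat.eq_zero_or_pos t with rfl | ht
    · have := hHnn 1
      simpa [hH0] using this
    · have ht' : (0 : ℝ) < t := by exact_mod_cast ht
      have h2 : H t / t - H t / t / (t + 1) = H t / (t + 1) := by
        field_simp
        ring
      have h3 : H t / (t + 1) ≤ H (t + 1) / ((t + 1 : ℕ) : ℝ) := by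
        push_cast
        gcongr
      linarith
  have hVsum : ∀ t, ∑ s ∈ Finset.range t, V s = t * A t := by
    intro t
    induction t with
    | zero => simp
    | succ t ih =>
      rw [Finset.sum_range_succ, ih, hAsucc]
      simp only [hV]
      push_cast
      field_simp
      ring
  set φ : State L → ℝ := fun s => if IsDone R s then 0 else
    cq * (S (betterItems R s.item).card s.cycle + A (betterItems R s.item).card) with hφ
  have hpos : ∀ s : State L, ¬ IsDone R s → 1 ≤ (betterItems R s.item).card := fun s hs => by
    rw [isDone_iff, ← ne_eq, ← Finset.nonempty_iff_ne_empty] at hs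
    exact hs.card_pos
  have hφ0 : ∀ s, 0 ≤ φ s := fun s => by
    simp only [hφ]
    split_ifs with hs
    · exact le_rfl
    · have := hS0 _ (hpos s hs) (card_betterItems_lt R _) s.cycle
      have := hAnn (betterItems R s.item).card
      positivity
  have hφnew : ∀ x q, φ ⟨x, 0, q⟩ ≤ cq * V (betterItems R x).card := fun x q => by
    have hVnn : 0 ≤ V (betterItems R x).card := by
      simp only [hV]
      have := hAnn (betterItems R x).card
      have := hHnn (betterItems R x).card
      positivity
    simp only [hφ, hV]
    split_ifs with hs
    · exact mul_nonneg (Nat.cast_nonneg _) hVnn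
    · gcongr
      exact hS2 _ (hpos _ hs) (card_betterItems_lt R x)
  refine (expectedQueries_le_of_potential hk (fun s => ENNReal.ofReal (φ s)) fun s => ?_).trans ?_
  · by_cases hs : IsDone R s
    · rw [pmfExp_step_of_isDone R cq k hs]
      · exact zero_le
      · intro s' hs'
        simp [hs, hφ, hs']
    · have hconv : (fun s' : State L => (if IsDone R s then (0 : ℝ≥0∞) else
          ((s'.queries - s.queries : ℕ) : ℝ≥0∞)) + ENNReal.ofReal (φ s')) = fun s' =>
          ENNReal.ofReal (((s'.queries - s.queries : ℕ) : ℝ) + φ s') := by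
        funext s'
        rw [if_neg hs, ENNReal.ofReal_add (Nat.cast_nonneg _) (hφ0 _), ENNReal.ofReal_natCast]
      rw [hconv, pmfExp_step_ofReal R cq k hs _ fun s' => add_nonneg (Nat.cast_nonneg _) (hφ0 _)]
      refine ENNReal.ofReal_le_ofReal ?_
      set t := (betterItems R s.item).card with ht
      set M := numChoices (Fintype.card L) s.cycle with hM
      have ht1 : 1 ≤ t := hpos s hs
      have htN : t < N := card_betterItems_lt R _
      have htR : (0 : ℝ) < t := by exact_mod_cast ht1
      have hMpos : 0 < M := numChoices_pos Fintype.card_pos _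
      have hMR : (0 : ℝ) < M := by exact_mod_cast hMpos
      have hφs : φ s = cq * (S t s.cycle + A t) := by simp only [hφ, if_neg hs, ht]
      have hφn : ∀ q, φ ⟨s.item, s.cycle + 1, q⟩ = cq * (S t (s.cycle + 1) + A t) := by
        intro q
        have hs' : ¬ IsDone R (⟨s.item, s.cycle + 1, q⟩ : State L) := hs
        simp only [hφ, if_neg hs', ht]
      have hSs := hS1 t ht1 htN s.cycle (Nat.zero_le _)
      simp only [Nat.add_sub_cancel_left, hφn, hφs]
      have hkcq' : (k : ℝ) ≤ cq := by exact_mod_cast hkcq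
      calc (M : ℝ)⁻¹ * ∑ j ∈ Finset.range M, (hitProb N t j / t *
              ∑ x ∈ betterItems R s.item, (((cq * j + k : ℕ) : ℝ) +
                φ ⟨x, 0, s.queries + (cq * j + k)⟩) +
              (1 - hitProb N t j) * (((cq * j + k : ℕ) : ℝ) +
                cq * (S t (s.cycle + 1) + A t)))
          ≤ (M : ℝ)⁻¹ * ∑ j ∈ Finset.range M, (cq * ((j : ℝ) + 1) + cq * (S t (s.cycle + 1) + A t)
              - hitProb N t j * (cq * S t (s.cycle + 1))) := by
            gcongr with j hj
            have hc : ((cq * j + k : ℕ) : ℝ) ≤ cq * ((j : ℝ) + 1) := by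
              push_cast
              linarith
            have hh0 := hitProb_nonneg N t j
            have hh1 := sub_nonneg.2 (hitProb_le_one N t j)
            have hsum : ∑ x ∈ betterItems R s.item, (((cq * j + k : ℕ) : ℝ) +
                φ ⟨x, 0, s.queries + (cq * j + k)⟩) ≤ t * (cq * ((j : ℝ) + 1) + cq * A t) := by
              rw [Finset.sum_add_distrib, Finset.sum_const, nsmul_eq_mul, mul_add]
              refine add_le_add (by gcongr) ?_
              calc _ ≤ ∑ x ∈ betterItems R s.item, cq * V (betterItems R x).card :=
                    Finset.sum_le_sum fun x _ => hφnew x _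
                _ ≤ cq * ∑ i ∈ Finset.range t, V i := by
                    rw [← Finset.mul_sum]
                    gcongr
                    exact sum_betterItems_le R hVmono s.item
                _ = t * (cq * A t) := by rw [hVsum]; ring
            calc _ ≤ hitProb N t j / t * (t * (cq * ((j : ℝ) + 1) + cq * A t)) +
                  (1 - hitProb N t j) * (cq * ((j : ℝ) + 1) +
                    cq * (S t (s.cycle + 1) + A t)) := by gcongr
              _ = _ := by field_simp; ring
        _ = cq * (((M : ℝ) + 1) / 2 + (1 - successProb N t M) * S t (s.cycle + 1) + A t) := by
            have hgauss : ∑ j ∈ Finset.range M, ((j : ℝ) + 1) = M * (M + 1) / 2 := by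
              have : ∀ n : ℕ, ∑ j ∈ Finset.range n, ((j : ℝ) + 1) = n * (n + 1) / 2 := by
                intro n
                induction n with
                | zero => simp
                | succ n ih => rw [Finset.sum_range_succ, ih]; push_cast; ring
              exact this M
            rw [Finset.sum_sub_distrib, Finset.sum_add_distrib, ← Finset.mul_sum, hgauss,
              Finset.sum_const, Finset.card_range, nsmul_eq_mul, ← Finset.sum_mul,
              sum_hitProb hMpos]
            field_simp
            ring
        _ ≤ cq * (S t s.cycle + A t) := by gcongr
  · rw [pmfExp_initial _ hφ0]
    refine ENNReal.ofReal_le_ofReal ?_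
    have hNR : (0 : ℝ) < N := by exact_mod_cast Fintype.card_pos
    have hall : ∑ x : L, V (betterItems R x).card ≤ ∑ i ∈ Finset.range N, V i :=
      sum_rank_le R hVmono Finset.univ
    calc (N : ℝ)⁻¹ * ∑ x : L, φ ⟨x, 0, 0⟩
        ≤ (N : ℝ)⁻¹ * ∑ x : L, cq * V (betterItems R x).card := by
          gcongr with x
          exact hφnew x 0
      _ ≤ (N : ℝ)⁻¹ * (cq * ∑ i ∈ Finset.range N, V i) := by
          rw [← Finset.mul_sum]
          gcongr
      _ = cq * A N := by
          rw [hVsum]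
          field_simp

/-- A bound for the probability that a run exceeds a budget of `β` oracle calls, for lists whose
searches only choose between zero and one Grover iterations. Here `g n t` bounds the probability
from an item with `t` better ones, when `n - 1` oracle calls are left, and `n = 0` stands for an
exceeded budget. -/
theorem timeoutSuffices_of_failureBound (hk : 1 ≤ k) (hkcq : k ≤ cq) {ε : ℝ} (hε : 0 < ε)
    {T : ℝ≥0} {β : ℕ} (hT : ((cq * β : ℕ) : ℝ≥0) ≤ T)
    (hM : ∀ u, numChoices (Fintype.card L) u = 2) {g : ℕ → ℕ → ℝ}
    (hg0 : ∀ t, g 0 t = 1) (hgnn : ∀ n t, 0 ≤ g n t) (hgt : ∀ n, Monotone (g n))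
    (hgn : ∀ m n, m ≤ n → n ≤ β + 1 → ∀ t, g n t ≤ g m t)
    (hg : ∀ n t, n ≤ β → 1 ≤ t → t < Fintype.card L →
      (hitProb (Fintype.card L) t 0 / t * ∑ i ∈ Finset.range t, g n i +
        (1 - hitProb (Fintype.card L) t 0) * g n t +
      (hitProb (Fintype.card L) t 1 / t * ∑ i ∈ Finset.range t, g (n - 1) i +
        (1 - hitProb (Fintype.card L) t 1) * g (n - 1) t)) / 2 ≤ g (n + 1) t)
    (hinit : ∑ i ∈ Finset.range (Fintype.card L), g (β + 1) i ≤ Fintype.card L / 3) :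
    TimeoutSuffices R cq k ε T := by
  classical
  set N := Fintype.card L with hN
  have hcq : 0 < cq := hk.trans hkcq
  set Q := cq * β with hQ
  set left : ℕ → ℕ := fun q => (Q - q) / cq + 1 with hleft
  have hleft_le : ∀ q, left q ≤ β + 1 := fun q => by
    simp only [hleft, hQ]
    refine Nat.succ_le_succ ((Nat.div_le_div_right (Nat.sub_le _ _)).trans ?_)
    rw [Nat.mul_div_cancel_left _ hcq]
  set φ : State L → ℝ := fun s => if IsDone R s ∨ Q < s.queries then 0 else
    g (left s.queries) (betterItems R s.item).card with hφ
  have hφ0 : ∀ s, 0 ≤ φ s := fun s => by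
    simp only [hφ]
    split_ifs
    · exact le_rfl
    · exact hgnn _ _
  -- The value of a state reached by a cycle with `j` iterations, charge included.
  have harrive : ∀ (q j : ℕ) (s' : State L), q ≤ Q → s'.queries = q + (cq * j + k) →
      (if Q < s'.queries then (1 : ℝ) else 0) + φ s' ≤
        g (left q - (j + 1)) (betterItems R s'.item).card := by
    intro q j s' hq hs'
    have hc : cq * j + k ≤ cq * (j + 1) := by rw [mul_add, mul_one]; lia
    by_cases hlt : Q < s'.queries
    · have h1 : (Q - q) / cq < j + 1 := by
        rw [Nat.div_lt_iff_lt_mul hcq, mul_comm]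
        lia
      have h2 : left q - (j + 1) = 0 := by simp only [hleft]; lia
      rw [h2, hg0]
      simp [hφ, hlt]
    · rw [if_neg hlt, zero_add]
      simp only [hφ]
      split_ifs with hd
      · exact hgnn _ _
      · refine hgn _ _ ?_ (hleft_le _) _
        have h1 : (Q - q) / cq ≤ (Q - s'.queries) / cq + (j + 1) := by
          rw [← Nat.add_mul_div_left _ _ hcq]
          exact Nat.div_le_div_right (by lia)
        simp only [hleft]
        lia
  refine timeoutSuffices_of_crossing hk hε hT (fun s => ENNReal.ofReal (φ s)) (fun s => ?_) ?_
  · by_cases hs : IsDone R s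
    · rw [pmfExp_step_of_isDone R cq k hs]
      · exact zero_le
      · intro s' hs'
        simp [hs, hφ, hs']
    · have hconv : (fun s' : State L => (if ¬ IsDone R s ∧ s.queries ≤ Q ∧ Q < s'.queries
          then (1 : ℝ≥0∞) else 0) + ENNReal.ofReal (φ s')) = fun s' =>
          ENNReal.ofReal ((if s.queries ≤ Q ∧ Q < s'.queries then 1 else 0) + φ s') := by
        funext s'
        rw [ENNReal.ofReal_add (by split_ifs <;> norm_num) (hφ0 _)]
        congr 1
        by_cases h : s.queries ≤ Q ∧ Q < s'.queries <;> simp [hs, h]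
      rw [hconv, pmfExp_step_ofReal R cq k hs _ fun s' =>
        add_nonneg (by split_ifs <;> norm_num) (hφ0 _)]
      refine ENNReal.ofReal_le_ofReal ?_
      set t := (betterItems R s.item).card with ht
      have ht1 : 1 ≤ t := by
        rw [isDone_iff, ← ne_eq, ← Finset.nonempty_iff_ne_empty] at hs
        exact hs.card_pos
      have htN : t < N := card_betterItems_lt R _
      rw [hM]
      by_cases hq : s.queries ≤ Q
      · obtain ⟨n, hn⟩ : ∃ n, left s.queries = n + 1 := ⟨_, rfl⟩
        have hφs : φ s = g (n + 1) t := by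
          simp only [hφ, if_neg (not_or.2 ⟨hs, not_lt.2 hq⟩), hn, ht]
        have hterm : ∀ j, hitProb N t j / t * ∑ x ∈ betterItems R s.item,
              ((if s.queries ≤ Q ∧ Q < s.queries + (cq * j + k) then (1 : ℝ) else 0) +
                φ ⟨x, 0, s.queries + (cq * j + k)⟩) +
              (1 - hitProb N t j) *
              ((if s.queries ≤ Q ∧ Q < s.queries + (cq * j + k) then (1 : ℝ) else 0) +
                φ ⟨s.item, s.cycle + 1, s.queries + (cq * j + k)⟩) ≤
            hitProb N t j / t * ∑ i ∈ Finset.range t, g (n - j) i +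
              (1 - hitProb N t j) * g (n - j) t := by
          intro j
          have hidx : left s.queries - (j + 1) = n - j := by rw [hn]; lia
          simp only [hq, true_and]
          refine add_le_add ?_ ?_
          · refine mul_le_mul_of_nonneg_left ?_
              (div_nonneg (hitProb_nonneg _ _ _) (Nat.cast_nonneg _))
            refine le_trans (Finset.sum_le_sum fun x _ => ?_)
              (sum_betterItems_le R (hgt (n - j)) s.item)
            rw [← hidx]
            exact harrive _ j ⟨x, 0, s.queries + (cq * j + k)⟩ hq rfl
          · refine mul_le_mul_of_nonneg_left ?_ (sub_nonneg.2 (hitProb_le_one _ _ _))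
            rw [← hidx]
            exact harrive _ j ⟨s.item, s.cycle + 1, s.queries + (cq * j + k)⟩ hq rfl
        have h0 := hterm 0
        have h1 := hterm 1
        have hgn' := hg n t (by have := hleft_le s.queries; lia) ht1 htN
        rw [Finset.sum_range_succ, Finset.sum_range_one, hφs]
        rw [Nat.sub_zero] at h0
        push_cast
        linarith
      · have hlt : ∀ a, Q < s.queries + a := fun a => by lia
        simp [hq, hφ, hlt, not_le.1 hq]
  · rw [pmfExp_initial _ hφ0]
    have h3 : (3⁻¹ : ℝ≥0∞) = ENNReal.ofReal (3⁻¹ : ℝ) := by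
      rw [ENNReal.ofReal_inv_of_pos (by norm_num)]
      norm_num
    rw [h3]
    refine ENNReal.ofReal_le_ofReal ?_
    have hNR : (0 : ℝ) < N := by exact_mod_cast Fintype.card_pos
    have hl0 : left 0 = β + 1 := by
      simp only [hleft, hQ, Nat.sub_zero, Nat.mul_div_cancel_left _ hcq]
    have hall : ∑ x : L, φ ⟨x, 0, 0⟩ ≤ ∑ i ∈ Finset.range N, g (β + 1) i := by
      refine le_trans (Finset.sum_le_sum fun x _ => ?_) (sum_rank_le R (hgt (β + 1)) Finset.univ)
      simp only [hφ]
      split_ifs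
      · exact hgnn _ _
      · rw [hl0]; rfl
    rw [inv_mul_le_iff₀ hNR]
    linarith

end Search

/-! ### The success probability of a Grover cycle -/

section SuccessProbability

theorem sin_two_groverAngle {N t : ℕ} (hN : 0 < N) (ht : t ≤ N) :
    Real.sin (2 * groverAngle N t) = 2 * √((t : ℝ) * ((N : ℝ) - t)) / N := by
  have hN' : (0 : ℝ) < N := by exact_mod_cast hN
  have h2 : √(N : ℝ) * √(N : ℝ) = N := Real.mul_self_sqrt hN'.le
  have h3 : √(N : ℝ) ≠ 0 := (Real.sqrt_pos.2 hN').ne'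
  have h4 : (0 : ℝ) ≤ (N : ℝ) - t := sub_nonneg.2 (by exact_mod_cast ht)
  rw [Real.sin_two_mul, sin_groverAngle ht, cos_groverAngle hN, Real.sqrt_div (Nat.cast_nonneg _),
    Real.sqrt_div h4, Real.sqrt_mul (Nat.cast_nonneg _)]
  rw [mul_assoc, div_mul_div_comm, h2]
  ring

theorem sin_two_groverAngle_pos {N t : ℕ} (ht : 1 ≤ t) (htN : t < N) :
    0 < Real.sin (2 * groverAngle N t) := by
  have h1 : (0 : ℝ) < t := by exact_mod_cast ht
  have h2 : (0 : ℝ) < (N : ℝ) - t := sub_pos.2 (by exact_mod_cast htN)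
  have h3 : (0 : ℝ) < N := by linarith
  rw [sin_two_groverAngle (by lia) htN.le]
  have := Real.sqrt_pos.2 (mul_pos h1 h2)
  positivity

theorem sum_sin_sq (θ : ℝ) (M : ℕ) :
    4 * Real.sin (2 * θ) * ∑ j ∈ Finset.range M, Real.sin ((2 * j + 1) * θ) ^ 2 =
      2 * M * Real.sin (2 * θ) - Real.sin (4 * M * θ) := by
  induction M with
  | zero => simp
  | succ M ih =>
    rw [Finset.sum_range_succ, mul_add, ih, Real.sin_sq_eq_half_sub]
    have h1 : (4 * ((M + 1 : ℕ) : ℝ) * θ) = 2 * ((2 * M + 1) * θ) + 2 * θ := by push_cast; ring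
    have h2 : 4 * (M : ℝ) * θ = 2 * ((2 * M + 1) * θ) - 2 * θ := by ring
    rw [h1, h2, Real.sin_add, Real.sin_sub]
    push_cast
    ring

/-- The closed form of the success probability of a cycle. -/
theorem successProb_eq {N t M : ℕ} (ht : 1 ≤ t) (htN : t < N) (hM : 0 < M) :
    successProb N t M = 1 / 2 - Real.sin (4 * M * groverAngle N t) /
      (4 * (M * Real.sin (2 * groverAngle N t))) := by
  have h := sum_sin_sq (groverAngle N t) M
  have hs := sin_two_groverAngle_pos ht htN
  have hM' : (0 : ℝ) < M := by exact_mod_cast hM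
  have h2 : Real.sin (4 * M * groverAngle N t) = 2 * M * Real.sin (2 * groverAngle N t) -
      4 * Real.sin (2 * groverAngle N t) * ∑ j ∈ Finset.range M, hitProb N t j := by
    simp only [hitProb]
    linarith
  rw [h2, successProb]
  field_simp
  ring

theorem half_sub_le_successProb {N t M : ℕ} (ht : 1 ≤ t) (htN : t < N) (hM : 0 < M) :
    1 / 2 - 1 / (4 * (M * Real.sin (2 * groverAngle N t))) ≤ successProb N t M := by
  have hs := sin_two_groverAngle_pos ht htN
  have hM' : (0 : ℝ) < M := by exact_mod_cast hM
  rw [successProb_eq ht htN hM]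
  gcongr
  exact Real.sin_le_one _

/-- Concavity of the sine on `[0, π]`. -/
theorem mul_sin_le_sin_mul {c z : ℝ} (hc0 : 0 ≤ c) (hc1 : c ≤ 1) (hz0 : 0 ≤ z)
    (hz : z ≤ Real.pi) :
    c * Real.sin z ≤ Real.sin (c * z) := by
  have h := strictConcaveOn_sin_Icc.concaveOn.right (Set.left_mem_Icc.2 Real.pi_pos.le)
    (Set.mem_Icc.2 ⟨hz0, hz⟩) (sub_nonneg.2 hc1) hc0 (sub_add_cancel 1 c)
  simpa using h

theorem groverAngle_nonneg (N t : ℕ) : 0 ≤ groverAngle N t :=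
  Real.arcsin_nonneg.2 (Real.sqrt_nonneg _)

theorem groverAngle_le (N t : ℕ) : groverAngle N t ≤ Real.pi / 2 := Real.arcsin_le_pi_div_two _

/-- A quadratic lower bound for the success probability in the cycles before `M` reaches
`1 / sin (2 θ)`. -/
theorem sq_div_four_le_successProb {N t M : ℕ} (ht : 1 ≤ t) (htN : 2 * t ≤ N) (hM : 2 ≤ M)
    (hx : M * Real.sin (2 * groverAngle N t) ≤ 1) :
    (M * Real.sin (2 * groverAngle N t)) ^ 2 / 4 ≤ successProb N t M := by
  have hs := sin_two_groverAngle_pos ht (show t < N by lia)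
  have hM' : (2 : ℝ) ≤ M := by exact_mod_cast hM
  have hM0 : (0 : ℝ) < M := by linarith
  have hpi := Real.pi_pos
  set δ := 2 * groverAngle N t with hδ
  have hδ0 : 0 ≤ δ := by have := groverAngle_nonneg N t; linarith
  have hδ1 : δ ≤ Real.pi / 2 := by
    have h1 : groverAngle N t ≤ Real.pi / 4 := by
      rw [groverAngle, Real.arcsin_le_iff_le_sin' ⟨by linarith, by linarith⟩,
        Real.sin_pi_div_four]
      rw [Real.sqrt_le_left (by positivity), div_pow, Real.sq_sqrt (by norm_num)]
      rw [div_le_iff₀ (by exact_mod_cast (show 0 < N by lia))]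
      have : (2 : ℝ) * t ≤ N := by exact_mod_cast htN
      linarith
    linarith
  set x := M * Real.sin δ with hxdef
  have hx0 : 0 < x := by positivity
  set y := M * δ with hy
  have hyx : x ≤ y := by
    rw [hxdef, hy]
    gcongr
    exact Real.sin_le hδ0
  have hy0 : 0 ≤ y := hx0.le.trans hyx
  have hypi : y ≤ Real.pi / 2 := by
    have h1 := Real.mul_le_sin hδ0 hδ1
    have h2 : 2 / Real.pi * y ≤ 1 := by
      calc 2 / Real.pi * y = M * (2 / Real.pi * δ) := by rw [hy]; ring
        _ ≤ M * Real.sin δ := by gcongr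
        _ ≤ 1 := hx
    rw [div_mul_eq_mul_div, div_le_one hpi] at h2
    linarith
  have hcosy : 0 ≤ Real.cos y := Real.cos_nonneg_of_neg_pi_div_two_le_of_le (by linarith) hypi
  -- `v` is at most `x / 2`, by concavity of the sine between `0` and `y / 2`
  set v := Real.sin (y / 2) with hv
  have hv0 : 0 ≤ v := Real.sin_nonneg_of_nonneg_of_le_pi (by linarith) (by linarith)
  have hvx : v ≤ x / 2 := by
    have h1 := mul_sin_le_sin_mul (c := 2 / M) (z := y / 2) (by positivity)
      ((div_le_one hM0).2 hM') (by linarith) (by linarith)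
    have h2 : 2 / M * (y / 2) = δ := by rw [hy]; field_simp
    rw [h2, ← hv, div_mul_eq_mul_div, div_le_iff₀ hM0] at h1
    rw [hxdef]
    linarith
  have hsiny : Real.sin y ≤ x * (1 - x ^ 2 / 8) := by
    have hsq : Real.sin y ^ 2 ≤ (x * (1 - x ^ 2 / 8)) ^ 2 := by
      have h1 : Real.sin y ^ 2 = 4 * (v ^ 2 * (1 - v ^ 2)) := by
        have h2 : Real.sin y = 2 * v * Real.cos (y / 2) := by
          rw [hv, ← Real.sin_two_mul]
          congr 1
          ring
        rw [h2, mul_pow, Real.cos_sq', ← hv]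
        ring
      have h3 : v ^ 2 ≤ x ^ 2 / 4 := by nlinarith
      have h4 : v ^ 2 * (1 - v ^ 2) ≤ x ^ 2 / 4 * (1 - x ^ 2 / 4) := by
        have hx2 : x ^ 2 ≤ 1 := pow_le_one₀ hx0.le hx
        nlinarith
      have h5 : x ^ 2 * (1 - x ^ 2 / 4) ≤ (x * (1 - x ^ 2 / 8)) ^ 2 := by
        have : 0 ≤ x ^ 2 * x ^ 4 := by positivity
        nlinarith
      linarith
    have hnn : 0 ≤ x * (1 - x ^ 2 / 8) := by
      have : 0 ≤ 1 - x ^ 2 / 8 := by nlinarith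
      positivity
    exact abs_le_of_sq_le_sq hsq hnn |> (le_trans (le_abs_self _))
  have hcos : Real.cos y ≤ 1 - x ^ 2 / 2 + x ^ 4 * (5 / 96) := by
    have h1 : Real.cos y ≤ Real.cos x :=
      Real.cos_le_cos_of_nonneg_of_le_pi hx0.le (by linarith) hyx
    have h2 := (abs_le.1 (Real.cos_bound (x := x) (by rwa [abs_of_pos hx0]))).2
    rw [abs_of_pos hx0] at h2
    linarith
  have hprod : Real.sin (4 * M * groverAngle N t) ≤ 2 * x - x ^ 3 := by
    have h1 : 4 * M * groverAngle N t = 2 * y := by rw [hy, hδ]; ring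
    rw [h1, Real.sin_two_mul]
    have hA : 0 ≤ x * (1 - x ^ 2 / 8) := by
      have : 0 ≤ 1 - x ^ 2 / 8 := by nlinarith
      positivity
    have h2 : Real.sin y * Real.cos y ≤
        x * (1 - x ^ 2 / 8) * (1 - x ^ 2 / 2 + x ^ 4 * (5 / 96)) := by
      gcongr
    have h3 : (1 - x ^ 2 / 8) * (1 - x ^ 2 / 2 + x ^ 4 * (5 / 96)) ≤ 1 - x ^ 2 / 2 := by
      have hx2 : x ^ 2 ≤ 1 := pow_le_one₀ hx0.le hx
      have h4 : 0 ≤ x ^ 2 * (1 - x ^ 2) := mul_nonneg (sq_nonneg _) (by linarith)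
      have h5 : 0 ≤ x ^ 6 := by positivity
      nlinarith
    have h6 : x * ((1 - x ^ 2 / 8) * (1 - x ^ 2 / 2 + x ^ 4 * (5 / 96))) ≤
        x * (1 - x ^ 2 / 2) := by gcongr
    linarith
  rw [successProb_eq ht (by lia) (by lia), ← hδ, ← hxdef, le_sub_comm, div_le_iff₀ (by positivity)]
  nlinarith [hprod]

/-- A lower bound for the success probability when at least a quarter of the items is marked. For
more than three quarters, it rests on the angle `π / 2 - θ` between the target and the uniform
state. -/
theorem successProb_ge_of_quarter_le {N t M : ℕ} (ht : 1 ≤ t) (htN : t < N) (h4 : N ≤ 4 * t)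
    (hM : 2 ≤ M) : 7 / 20 ≤ successProb N t M := by
  have hs := sin_two_groverAngle_pos ht htN
  have hM' : (2 : ℝ) ≤ M := by exact_mod_cast hM
  have hM0 : (0 : ℝ) < M := by linarith
  have hN0 : (0 : ℝ) < N := by exact_mod_cast (show 0 < N by lia)
  have h4' : (N : ℝ) ≤ 4 * t := by exact_mod_cast h4
  have hpi0 := Real.pi_pos
  have hpi := Real.pi_lt_d4
  have h3 : (1.732 : ℝ) < √3 := Real.lt_sqrt_of_sq_lt (by norm_num)
  have h3' : √(3 : ℝ) ^ 2 = 3 := Real.sq_sqrt (by norm_num)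
  by_cases hcase : 4 * t ≤ 3 * N
  · have hcase' : (4 : ℝ) * t ≤ 3 * N := by exact_mod_cast hcase
    have hsge : √3 / 2 ≤ Real.sin (2 * groverAngle N t) := by
      rw [sin_two_groverAngle (by lia) htN.le, div_le_div_iff₀ (by norm_num) hN0]
      have : √3 / 4 * N ≤ √((t : ℝ) * ((N : ℝ) - t)) := by
        refine Real.le_sqrt_of_sq_le ?_
        rw [mul_pow, div_pow, h3']
        nlinarith
      linarith
    refine le_trans ?_ (half_sub_le_successProb ht htN (by lia))
    have h5 : (1.732 : ℝ) ≤ M * Real.sin (2 * groverAngle N t) := by nlinarith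
    have h6 : 1 / (4 * (M * Real.sin (2 * groverAngle N t))) ≤ 1 / (4 * 1.732) := by gcongr
    have h7 : (1 : ℝ) / (4 * 1.732) ≤ 3 / 20 := by norm_num
    linarith
  · have hcase' : (3 : ℝ) * N ≤ 4 * t := by exact_mod_cast (not_le.1 hcase).le
    set φ := Real.pi / 2 - groverAngle N t with hφ
    have hφ0 : 0 ≤ φ := by have := groverAngle_le N t; linarith
    have hφ1 : φ ≤ Real.pi / 6 := by
      have : Real.pi / 3 ≤ groverAngle N t := by
        rw [groverAngle, Real.le_arcsin_iff_sin_le' ⟨by linarith, by linarith⟩,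
          Real.sin_pi_div_three]
        refine Real.le_sqrt_of_sq_le ?_
        rw [div_pow, h3', le_div_iff₀ hN0]
        linarith
      linarith
    have hsφ : Real.sin (2 * groverAngle N t) = Real.sin (2 * φ) := by
      rw [← Real.sin_pi_sub, hφ]
      congr 1
      ring
    set y := 4 * M * φ with hy
    have hsin4 : Real.sin (4 * M * groverAngle N t) = -Real.sin y := by
      have h5 : 4 * M * groverAngle N t = (M : ℕ) * (2 * Real.pi) - y := by rw [hy, hφ]; ring
      rw [h5, Real.sin_nat_mul_two_pi_sub]
    have hy0 : 0 ≤ y := by positivity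
    -- Concavity on `[0, π / 3]`: the slope is at least `3 √3 / (2 π) > 0.826`.
    have hjordan : 0.413 * y ≤ M * Real.sin (2 * φ) := by
      have h5 := mul_sin_le_sin_mul (c := 6 * φ / Real.pi) (z := Real.pi / 3) (by positivity)
        ((div_le_one hpi0).2 (by linarith)) (by positivity) (by linarith)
      have h6 : 6 * φ / Real.pi * (Real.pi / 3) = 2 * φ := by field_simp; ring
      rw [h6, Real.sin_pi_div_three] at h5
      have h7 : 1.652 * φ ≤ 6 * φ / Real.pi * (√3 / 2) := by
        rw [div_mul_eq_mul_div, le_div_iff₀ hpi0]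
        nlinarith
      calc 0.413 * y = M * (1.652 * φ) := by rw [hy]; ring
        _ ≤ M * Real.sin (2 * φ) := by gcongr; linarith
    -- The minimum of `sin y / y` for `y > 0` is about `-0.217`; here `-0.247` is enough.
    have hkey : -Real.sin y ≤ 0.6 * (M * Real.sin (2 * φ)) := by
      have h5 : -Real.sin y = Real.sin (y - Real.pi) := (Real.sin_sub_pi y).symm
      rcases le_total y Real.pi with hyp | hyp
      · have := Real.sin_nonneg_of_nonneg_of_le_pi hy0 hyp
        linarith
      · rcases le_total y (4.05 : ℝ) with hy5 | hy5
        · have h6 := Real.sin_le (x := y - Real.pi) (by linarith)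
          have := Real.pi_gt_d2
          linarith
        · have := Real.sin_le_one (y - Real.pi)
          linarith
    rw [hsφ] at hs
    rw [successProb_eq ht htN (by lia), hsin4, hsφ, le_sub_comm, div_le_iff₀ (by positivity)]
    linarith

end SuccessProbability

/-! ### The number of choices in a cycle -/

section Cycles

theorem cycleBound_eq {N : ℕ} (hN : 2 ≤ N) (u : ℕ) :
    cycleBound N u = min ((6 / 5) ^ (u + 1)) √N := by
  have hN' : (2 : ℝ) ≤ N := by exact_mod_cast hN
  have h1 : (6 / 5 : ℝ) ≤ √N := Real.le_sqrt_of_sq_le (by norm_num; linarith)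
  induction u with
  | zero => simp [cycleBound, h1]
  | succ u ih =>
    rw [cycleBound, ih, pow_succ _ (u + 1)]
    rcases le_total ((6 / 5 : ℝ) ^ (u + 1)) √N with h | h
    · rw [min_eq_left h, mul_comm]
    · rw [min_eq_right h, min_eq_right, min_eq_right]
      · linarith
      · linarith

theorem two_le_numChoices {N : ℕ} (hN : 2 ≤ N) (u : ℕ) : 2 ≤ numChoices N u := by
  refine Nat.succ_le_of_lt (Nat.lt_ceil.2 ?_)
  rw [cycleBound_eq hN, Nat.cast_one]
  refine lt_min (one_lt_pow₀ (by norm_num) (Nat.succ_ne_zero u)) ?_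
  exact Real.lt_sqrt_of_sq_lt (by norm_num; lia)

theorem cycleBound_le_numChoices (N u : ℕ) : cycleBound N u ≤ numChoices N u := Nat.le_ceil _

theorem numChoices_le {N : ℕ} (hN : 0 < N) (u : ℕ) : (numChoices N u : ℝ) ≤ cycleBound N u + 1 :=
  (Nat.ceil_lt_add_one (cycleBound_pos hN u).le).le

end Cycles

/-! ### The cost of a search in a long list -/

section ManyItems

theorem cycleBound_succ_le (N u : ℕ) : cycleBound N (u + 1) ≤ 6 / 5 * cycleBound N u :=
  min_le_left _ _

/-- The cost of a search whose cycles all succeed with probability at least `p`, bounded by a linear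
function of the parameter `m`, which grows by a factor of at most `6/5` per cycle. -/
theorem SearchCostLE.of_linear {N t u : ℕ} (hN : 2 ≤ N) {p α β : ℝ} (hα : 0 ≤ α) (hβ : 0 ≤ β)
    (hp : ∀ v, u ≤ v → p ≤ successProb N t (numChoices N v)) (hp1 : p ≤ 1)
    (hαp : 1 / 2 + (1 - p) * (6 / 5) * α ≤ α) (hβp : 1 + (1 - p) * β ≤ β) :
    SearchCostLE N t u (α * cycleBound N u + β) := by
  refine ⟨fun v => α * cycleBound N v + β, fun v => ?_, fun v hv => ?_, le_rfl⟩
  · have := cycleBound_pos (N := N) (by lia) v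
    positivity
  · have h0 := cycleBound_pos (N := N) (by lia) v
    have h1 := cycleBound_pos (N := N) (by lia) (v + 1)
    have h2 := numChoices_le (N := N) (by lia) v
    have h3 := cycleBound_succ_le N v
    have h4 : (1 - successProb N t (numChoices N v)) * (α * cycleBound N (v + 1) + β) ≤
        (1 - p) * (α * (6 / 5 * cycleBound N v) + β) := by
      have h5 := hp v hv
      have h6 := sub_nonneg.2 hp1
      gcongr
    have h7 := mul_le_mul_of_nonneg_right hαp h0.le
    dsimp only
    linarith

/-- The reciprocal of `sin (2 θ)`, the scale of `m` at which the success probability of a cycle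
becomes bounded below. -/
noncomputable def critical (N t : ℕ) : ℝ := N / (2 * √(((N : ℝ) - t) * t))

theorem sin_two_groverAngle_eq_inv {N t : ℕ} (hN : 0 < N) (ht : t ≤ N) :
    Real.sin (2 * groverAngle N t) = (critical N t)⁻¹ := by
  rw [sin_two_groverAngle hN ht, critical, inv_div, mul_comm (t : ℝ)]

theorem critical_pos {N t : ℕ} (ht : 1 ≤ t) (htN : t < N) : 0 < critical N t := by
  rw [← inv_pos, ← sin_two_groverAngle_eq_inv (by lia) htN.le]
  exact sin_two_groverAngle_pos ht htN

theorem critical_sq {N t : ℕ} (htN : t ≤ N) :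
    critical N t ^ 2 = (N : ℝ) ^ 2 / (4 * (((N : ℝ) - t) * t)) := by
  have h2 : (0 : ℝ) ≤ (N : ℝ) - t := sub_nonneg.2 (by exact_mod_cast htN)
  rw [critical, div_pow, mul_pow, Real.sq_sqrt (by positivity)]
  norm_num

theorem critical_le_sqrt {N t : ℕ} (ht : 1 ≤ t) (htN : t < N) : critical N t ≤ √N := by
  have h1 : (1 : ℝ) ≤ t := by exact_mod_cast ht
  have h2 : (1 : ℝ) ≤ (N : ℝ) - t := by
    have : (t : ℝ) + 1 ≤ N := by exact_mod_cast htN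
    linarith
  refine Real.le_sqrt_of_sq_le ?_
  rw [critical_sq htN.le, div_le_iff₀ (by positivity)]
  have h3 : (N : ℝ) ≤ 4 * (((N : ℝ) - t) * t) := by nlinarith
  nlinarith

theorem three_mul_critical_sq_le {N t : ℕ} (ht : 1 ≤ t) (htN : 4 * t < N) :
    3 * critical N t ^ 2 ≤ N := by
  have h1 : (1 : ℝ) ≤ t := by exact_mod_cast ht
  have h2 : (4 : ℝ) * t ≤ N := by exact_mod_cast htN.le
  have h0 : (0 : ℝ) < (N : ℝ) - t := by linarith
  rw [critical_sq (by lia), ← mul_div_assoc, div_le_iff₀ (by positivity)]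
  have h3 : 3 * (N : ℝ) ≤ 4 * (((N : ℝ) - t) * t) := by nlinarith
  nlinarith

/-- A lower bound for the success probability of a cycle with `M` choices, when the critical scale
is at most `b`. -/
def probBound (M : ℕ) (b : ℚ) : ℚ :=
  if (M : ℚ) ≤ b then (M / b) ^ 2 / 4 else 1 / 2 - b / (4 * M)

theorem half_sub_critical_le {N t M : ℕ} (ht : 1 ≤ t) (htN : t < N) (hM : 0 < M) :
    1 / 2 - critical N t / (4 * M) ≤ successProb N t M := by
  refine le_trans (le_of_eq ?_) (half_sub_le_successProb ht htN hM)
  have := critical_pos ht htN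
  rw [sin_two_groverAngle_eq_inv (by lia) htN.le]
  have : (0 : ℝ) < M := by exact_mod_cast hM
  field_simp

theorem sq_le_successProb {N t M : ℕ} (ht : 1 ≤ t) (htN : 4 * t < N) (hM : 2 ≤ M) {x : ℝ}
    (hx0 : 0 ≤ x) (hx1 : x ≤ 1) (hx : x ≤ M / critical N t) :
    x ^ 2 / 4 ≤ successProb N t M := by
  have ha := critical_pos ht (show t < N by lia)
  have hs := sin_two_groverAngle_eq_inv (N := N) (t := t) (by lia) (by lia)
  have hMR : (0 : ℝ) < M := by exact_mod_cast (show 0 < M by lia)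
  rcases le_total ((M : ℝ) / critical N t) 1 with h | h
  · have h1 := sq_div_four_le_successProb (N := N) ht (by lia) hM
      (by rwa [hs, ← div_eq_mul_inv])
    rw [hs, ← div_eq_mul_inv] at h1
    refine le_trans ?_ h1
    gcongr
  · refine le_trans ?_ (half_sub_critical_le ht (by lia) (by lia))
    rw [le_div_iff₀ ha, one_mul] at h
    have h2 : critical N t / (4 * M) ≤ 1 / 4 := by
      rw [div_le_iff₀ (by positivity)]
      linarith
    have h3 : x ^ 2 ≤ 1 := pow_le_one₀ hx0 hx1
    linarith

theorem probBound_le {N t M : ℕ} (ht : 1 ≤ t) (htN : 4 * t < N) (hM : 2 ≤ M) {b : ℚ}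
    (hb : critical N t ≤ b) : (probBound M b : ℝ) ≤ successProb N t M := by
  have ha := critical_pos ht (show t < N by lia)
  have hMR : (0 : ℝ) < M := by exact_mod_cast (show 0 < M by lia)
  rw [probBound]
  split_ifs with h
  · have h' : (M : ℝ) ≤ b := by exact_mod_cast h
    push_cast
    have hb0 : (0 : ℝ) < b := ha.trans_le hb
    exact sq_le_successProb ht htN hM (by positivity) ((div_le_one hb0).2 h') (by gcongr)
  · refine le_trans ?_ (half_sub_critical_le ht (by lia) (by lia))
    push_cast
    gcongr

/-- `⌈(6/5) ^ (u + 1)⌉`, the number of choices in the cycle number `u` of a long list. -/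
def ceilPow (u : ℕ) : ℕ := (6 ^ (u + 1) + 5 ^ (u + 1) - 1) / 5 ^ (u + 1)

theorem ceil_pow (u : ℕ) : ⌈(6 / 5 : ℝ) ^ (u + 1)⌉₊ = ceilPow u := by
  have h5 : 0 < 5 ^ (u + 1) := by positivity
  have h5' : (0 : ℝ) < 5 ^ (u + 1) := by positivity
  refine eq_of_forall_ge_iff fun c => ?_
  rw [ceilPow, ← Nat.ceilDiv_eq_add_pred_div, ceilDiv_le_iff_le_mul h5, Nat.ceil_le, div_pow,
    div_le_iff₀ h5', mul_comm]
  norm_cast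

theorem numChoices_eq_ceilPow {N u : ℕ} (hN : 2 ≤ N) (hu : (6 / 5 : ℝ) ^ (u + 1) ≤ √N) :
    numChoices N u = ceilPow u := by
  rw [numChoices, cycleBound_eq hN, min_eq_left hu, ceil_pow]

theorem cycleBound_mono {N : ℕ} (hN : 2 ≤ N) : Monotone (cycleBound N) := by
  intro u v huv
  rw [cycleBound_eq hN, cycleBound_eq hN]
  exact min_le_min_right _ (pow_le_pow_right₀ (by norm_num) (by lia))

/-- The certificate for `searchCostLE_of_critical_le`: once `m` exceeds the critical scale `a`, a
cycle fails with probability at most `1/2 + a / (4 m)`, and then `m` grows by at most `6/5`. -/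
theorem certificate_of_critical_le {N t v : ℕ} (ht : 1 ≤ t) (htN : t < N)
    (h4 : critical N t ≤ cycleBound N v) :
    ((numChoices N v : ℝ) + 1) / 2 + (1 - successProb N t (numChoices N v)) *
      (5 / 4 * cycleBound N (v + 1) + 3 / 2 * critical N t + 4) ≤
    5 / 4 * cycleBound N v + 3 / 2 * critical N t + 4 := by
  have ha := critical_pos ht htN
  set a := critical N t
  have h0 := cycleBound_pos (N := N) (by lia) v
  have h1 := cycleBound_pos (N := N) (by lia) (v + 1)
  have h2 := numChoices_le (N := N) (by lia) v
  have h3 := cycleBound_succ_le N v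
  have h5 : 1 - successProb N t (numChoices N v) ≤ 1 / 2 + a / (4 * cycleBound N v) := by
    have h6 := half_sub_critical_le ht htN (numChoices_pos (N := N) (by lia) v)
    have h7 : a / (4 * (numChoices N v : ℝ)) ≤ a / (4 * cycleBound N v) := by
      gcongr
      exact cycleBound_le_numChoices N v
    linarith
  have h8 : (1 - successProb N t (numChoices N v)) *
        (5 / 4 * cycleBound N (v + 1) + 3 / 2 * a + 4) ≤
      (1 / 2 + a / (4 * cycleBound N v)) * (5 / 4 * (6 / 5 * cycleBound N v) + 3 / 2 * a + 4) := by
    gcongr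
  have h9 : (1 / 2 + a / (4 * cycleBound N v)) *
      (5 / 4 * (6 / 5 * cycleBound N v) + 3 / 2 * a + 4) =
      3 / 4 * cycleBound N v + 9 / 8 * a + 2 + (3 / 8 * a + 1) * (a / cycleBound N v) := by
    field_simp
    ring
  have h10 : (3 / 8 * a + 1) * (a / cycleBound N v) ≤ (3 / 8 * a + 1) * 1 := by
    gcongr
    exact (div_le_one h0).2 h4
  linarith

/-- The cost of a search once `m` has reached the critical scale `a`. -/
theorem searchCostLE_of_critical_le {N t u : ℕ} (ht : 1 ≤ t) (htN : t < N)
    (hu : critical N t ≤ cycleBound N u) :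
    SearchCostLE N t u (5 / 4 * cycleBound N u + 3 / 2 * critical N t + 4) := by
  have ha := critical_pos ht htN
  refine ⟨fun v => 5 / 4 * cycleBound N v + 3 / 2 * critical N t + 4, fun v => ?_, fun v hv =>
    certificate_of_critical_le ht htN (hu.trans (cycleBound_mono (by lia) hv)), le_rfl⟩
  have := cycleBound_pos (N := N) (by lia) v
  positivity

/-- The cost of a search from its start, given the bound `c` for its cost from the cycle number
`u` on, when the critical scale is at most `b`. -/
def backChain (b : ℚ) : ℕ → ℚ → ℚ
  | 0, c => c
  | u + 1, c => backChain b u (((ceilPow u : ℚ) + 1) / 2 + (1 - probBound (ceilPow u) b) * c)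

theorem SearchCostLE.backChain {N t : ℕ} (ht : 1 ≤ t) (htN : 4 * t < N) {b : ℚ}
    (hb : critical N t ≤ b) {u : ℕ} (hu : (6 / 5 : ℝ) ^ u ≤ √N) {c : ℚ} (hc : 0 ≤ c)
    (h : SearchCostLE N t u (c : ℝ)) : SearchCostLE N t 0 ((QMax.backChain b u c : ℚ) : ℝ) := by
  induction u generalizing c with
  | zero => exact h
  | succ u ih =>
    have hM := numChoices_eq_ceilPow (N := N) (by lia) hu
    have hM2 := two_le_numChoices (N := N) (by lia) u
    have hp := probBound_le ht htN hM2 hb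
    have hle : ((numChoices N u : ℝ) + 1) / 2 + (1 - successProb N t (numChoices N u)) * c ≤
        ((((ceilPow u : ℚ) + 1) / 2 + (1 - probBound (ceilPow u) b) * c : ℚ) : ℝ) := by
      rw [← hM]
      push_cast
      have hc' : (0 : ℝ) ≤ c := by exact_mod_cast hc
      gcongr
    have hnn : (0 : ℝ) ≤
        ((((ceilPow u : ℚ) + 1) / 2 + (1 - probBound (ceilPow u) b) * c : ℚ) : ℝ) := by
      refine le_trans ?_ hle
      have := sub_nonneg.2 (successProb_le_one N t (numChoices N u))
      have hc' : (0 : ℝ) ≤ c := by exact_mod_cast hc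
      positivity
    refine ih (le_trans ?_ hu) (by exact_mod_cast hnn) (h.step hle)
    exact pow_le_pow_right₀ (by norm_num) (Nat.le_succ u)

/-- The check that the search cost is at most `9/2` times the critical scale, for critical scales
that are at least `lo` and in the first of the intervals ending in the first components of the
list; the second components are numbers of cycles after which `searchCostLE_of_critical_le` is
used. -/
def checkScales : ℚ → List (ℚ × ℕ) → Bool
  | _, [] => true
  | lo, (hi, U) :: l => ((6 / 5) ^ U ≤ (8 : ℚ) || (6 / 5) ^ U ≤ 17 / 10 * lo) &&
      0 ≤ hi && hi ≤ (6 / 5) ^ (U + 1) &&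
      backChain hi U (5 / 4 * (6 / 5) ^ (U + 1) + 3 / 2 * hi + 4) ≤ 9 / 2 * lo && checkScales hi l

/-- The hypothesis `64 ≤ N` makes `√N` at least `8`, and `3 * a ^ 2 ≤ N` makes it at least
`1.7 * a`; either way the cycles in the chain are not yet affected by the cap `√N` on `m`. -/
theorem searchCostLE_of_checkScales {N t : ℕ} (hN : 64 ≤ N) (ht : 1 ≤ t) (htN : 4 * t < N)
    (l : List (ℚ × ℕ)) (lo : ℚ) (h : checkScales lo l) (hlo : lo ≤ critical N t) :
    SearchCostLE N t 0 (9 / 2 * critical N t) ∨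
      ((l.map Prod.fst).getLastD lo : ℝ) ≤ critical N t := by
  induction l generalizing lo with
  | nil => exact Or.inr (by simpa using hlo)
  | cons x l ih =>
    obtain ⟨hi, U⟩ := x
    simp only [checkScales, Bool.and_eq_true, Bool.or_eq_true, decide_eq_true_eq] at h
    obtain ⟨⟨⟨⟨hU, hhi0⟩, hhi⟩, hchain⟩, hl⟩ := h
    rcases le_total (hi : ℝ) (critical N t) with hle | hle
    · rcases ih hi hl hle with h1 | h1
      · exact Or.inl h1
      · refine Or.inr ?_
        rw [List.map_cons, List.getLastD_cons]
        exact h1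
    · refine Or.inl ?_
      have ha := critical_pos ht (show t < N by lia)
      have hU' : (6 / 5 : ℝ) ^ U ≤ √N := by
        rcases hU with hU | hU
        · have hU2 : (((6 / 5) ^ U : ℚ) : ℝ) ≤ ((8 : ℚ) : ℝ) := by exact_mod_cast hU
          push_cast at hU2
          refine hU2.trans ?_
          refine Real.le_sqrt_of_sq_le ?_
          have : (64 : ℝ) ≤ N := by exact_mod_cast hN
          norm_num
          linarith
        · have hU2 : (((6 / 5) ^ U : ℚ) : ℝ) ≤ ((17 / 10 * lo : ℚ) : ℝ) := by exact_mod_cast hU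
          push_cast at hU2
          refine hU2.trans ((mul_le_mul_of_nonneg_left hlo (by norm_num)).trans ?_)
          refine Real.le_sqrt_of_sq_le ?_
          have := three_mul_critical_sq_le ht htN
          nlinarith
      have hhi' : (hi : ℝ) ≤ (6 / 5) ^ (U + 1) := by
        have h1 : (hi : ℝ) ≤ (((6 / 5) ^ (U + 1) : ℚ) : ℝ) := by exact_mod_cast hhi
        push_cast at h1
        exact h1
      have hcb : cycleBound N U ≤ (6 / 5) ^ (U + 1) := by
        rw [cycleBound_eq (by lia)]
        exact min_le_left _ _
      have hterm : SearchCostLE N t U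
          ((5 / 4 * (6 / 5) ^ (U + 1) + 3 / 2 * hi + 4 : ℚ) : ℝ) := by
        refine (searchCostLE_of_critical_le ht (by lia) ?_).mono ?_
        · rw [cycleBound_eq (by lia)]
          exact le_min (hle.trans hhi') (critical_le_sqrt ht (by lia))
        · push_cast
          gcongr
      refine (hterm.backChain ht htN hle hU' (by positivity)).mono ?_
      have h1 : ((QMax.backChain hi U (5 / 4 * (6 / 5) ^ (U + 1) + 3 / 2 * hi + 4) : ℚ) : ℝ) ≤
          ((9 / 2 * lo : ℚ) : ℝ) := by exact_mod_cast hchain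
      refine h1.trans ?_
      push_cast
      gcongr

/-- The cost of a search with a large critical scale `a`. Before `m` reaches `a`, the certificate
is `a (19/5 - 5/2 x + 31/20 x²) + 5` for `x = m / a`, plus the number of cycles until then. -/
theorem searchCostLE_of_large_critical {N t : ℕ} (ht : 1 ≤ t) (htN : 4 * t < N)
    (ha : 27 ≤ critical N t) : SearchCostLE N t 0 (9 / 2 * critical N t) := by
  set a := critical N t with hadef
  have ha0 : 0 < a := by linarith
  have hN : 2 ≤ N := by lia
  have haN : a ≤ √N := critical_le_sqrt ht (by lia)
  set l : ℝ := Real.logb (6 / 5) a with hl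
  have hpl : ∀ n : ℕ, (6 / 5 : ℝ) ^ n ≤ a → (n : ℝ) ≤ l := fun n hn => by
    rw [hl, Real.le_logb_iff_rpow_le (by norm_num) ha0, Real.rpow_natCast]
    exact hn
  set f : ℕ → ℝ := fun v => a * 19 / 5 - 5 / 2 * (6 / 5) ^ (v + 1) +
    31 / 20 * ((6 / 5) ^ (v + 1)) ^ 2 / a + 5 + (l - (v + 1)) with hf
  have hmain : SearchCostLE N t 7 (f 7) := by
    refine ⟨fun v => if (6 / 5 : ℝ) ^ (v + 1) ≤ a then f v else
      5 / 4 * cycleBound N v + 3 / 2 * a + 4, fun v => ?_, fun v _ => ?_, ?_⟩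
    · dsimp only
      split_ifs with h
      · have h1 := hpl _ h
        push_cast at h1
        have h2 : 0 ≤ 31 / 20 * ((6 / 5 : ℝ) ^ (v + 1)) ^ 2 / a := by positivity
        simp only [hf]
        linarith
      · have := cycleBound_pos (N := N) (by lia) v
        positivity
    · dsimp only
      set m : ℝ := (6 / 5) ^ (v + 1) with hm
      have hm0 : 0 < m := by positivity
      by_cases h1 : m ≤ a
      swap
      · have h2 : ¬ (6 / 5 : ℝ) ^ (v + 1 + 1) ≤ a := fun h2 =>
          h1 ((pow_le_pow_right₀ (by norm_num) (Nat.le_succ _)).trans h2)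
        rw [if_neg h1, if_neg h2]
        have hcr : critical N t ≤ cycleBound N v := by
          rw [cycleBound_eq hN]
          exact le_min (not_le.1 h1).le haN
        exact certificate_of_critical_le ht (by lia) hcr
      · rw [if_pos h1]
        have hcb : cycleBound N v = m := by
          rw [cycleBound_eq hN, min_eq_left (h1.trans haN)]
        have hMle := numChoices_le (N := N) (by lia) v
        have hMge := cycleBound_le_numChoices N v
        rw [hcb] at hMle hMge
        set x := m / a with hx
        have hmx : m = a * x := by rw [hx]; field_simp
        have hx0 : 0 ≤ x := by positivity
        have hx1 : x ≤ 1 := (div_le_one ha0).2 h1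
        have hp : x ^ 2 / 4 ≤ successProb N t (numChoices N v) :=
          sq_le_successProb ht htN (two_le_numChoices hN v) hx0 hx1
            (div_le_div_of_nonneg_right hMge ha0.le)
        have hlam := hpl _ h1
        push_cast at hlam
        -- The bound for the next cycle, whether or not it reaches the critical scale.
        set g : ℝ := a * (19 / 5 - 3 * x + 279 / 125 * x ^ 2) + 4 + (l - (v + 1)) with hg
        have hg0 : 0 ≤ g := by
          have : 0 ≤ a * (19 / 5 - 3 * x + 279 / 125 * x ^ 2) :=
            mul_nonneg ha0.le (by nlinarith [sq_nonneg x])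
          linarith
        have hnext : (if (6 / 5 : ℝ) ^ (v + 1 + 1) ≤ a then f (v + 1) else
            5 / 4 * cycleBound N (v + 1) + 3 / 2 * a + 4) ≤ g := by
          split_ifs with h2
          · refine le_of_eq ?_
            simp only [hf, hg, pow_succ _ (v + 1), ← hm]
            rw [hmx]
            push_cast
            field_simp
            ring
          · have h3 := cycleBound_succ_le N v
            rw [hcb, hmx] at h3
            have h4 : 0 ≤ a * (23 / 10 - 9 / 2 * x + 279 / 125 * x ^ 2) :=
              mul_nonneg ha0.le (by nlinarith [sq_nonneg (x - 1)])
            rw [hg]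
            linarith
        have hq := sub_nonneg.2 (successProb_le_one N t (numChoices N v))
        have h5 : (1 - successProb N t (numChoices N v)) * (if (6 / 5 : ℝ) ^ (v + 1 + 1) ≤ a then
            f (v + 1) else 5 / 4 * cycleBound N (v + 1) + 3 / 2 * a + 4) ≤
            (1 - x ^ 2 / 4) * g :=
          (mul_le_mul_of_nonneg_left hnext hq).trans
            (mul_le_mul_of_nonneg_right (by linarith) hg0)
        have h6 : f v = a * (19 / 5 - 5 / 2 * x + 31 / 20 * x ^ 2) + 5 + (l - (v + 1)) := by
          simp only [hf, ← hm]
          rw [hmx]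
          field_simp
        have h7 : 0 ≤ a * x ^ 2 * (67 / 250 - 3 / 4 * x + 279 / 500 * x ^ 2) :=
          mul_nonneg (by positivity) (by nlinarith [sq_nonneg (x - 2 / 3)])
        have h8 : 0 ≤ x ^ 2 / 4 * (4 + (l - (v + 1))) := mul_nonneg (by positivity) (by linarith)
        have h9 : (1 - x ^ 2 / 4) * g = a * (19 / 5 - 3 * x + 31 / 20 * x ^ 2) + 4 + (l - (v + 1)) -
            a * x ^ 2 * (67 / 250 - 3 / 4 * x + 279 / 500 * x ^ 2) -
            x ^ 2 / 4 * (4 + (l - (v + 1))) := by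
          rw [hg]
          ring
        rw [h6]
        linarith
    · dsimp only
      rw [if_pos]
      norm_num
      linarith
  -- No success is counted in the first seven cycles, which use 13 oracle calls on average.
  have hstep : ∀ u c, u + 1 ≤ 7 → 0 ≤ c → SearchCostLE N t (u + 1) c →
      SearchCostLE N t u (((ceilPow u : ℝ) + 1) / 2 + c) := by
    intro u c hu hc h
    refine h.step ?_
    have h1 : (6 / 5 : ℝ) ^ (u + 1) ≤ √N := by
      refine (pow_le_pow_right₀ (by norm_num) hu).trans (le_trans ?_ haN)
      norm_num
      linarith
    rw [numChoices_eq_ceilPow hN h1]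
    have h2 : 0 ≤ successProb N t (ceilPow u) :=
      div_nonneg (Finset.sum_nonneg fun j _ => hitProb_nonneg _ _ _) (Nat.cast_nonneg _)
    nlinarith
  have hf0 : 0 ≤ f 7 := by
    obtain ⟨S, hS0, -, hS2⟩ := hmain
    exact (hS0 7).trans hS2
  have h0 : SearchCostLE N t 0 (f 7 + 13) := by
    refine (hstep 0 _ (by norm_num) ?_ (hstep 1 _ (by norm_num) ?_ (hstep 2 _ (by norm_num) ?_
      (hstep 3 _ (by norm_num) ?_ (hstep 4 _ (by norm_num) ?_ (hstep 5 _ (by norm_num) ?_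
      (hstep 6 _ (by norm_num) hf0 hmain))))))).mono ?_
    any_goals positivity
    norm_num [ceilPow]
    linarith
  refine h0.mono ?_
  -- The logarithm of `a` to the base `6/5` is bounded by its tangent at `(6/5) ^ 18`, which is
  -- below 27.
  have hlog : l ≤ 18 + 6 * (a / (6 / 5) ^ 18 - 1) := by
    have h1 : (0 : ℝ) < (6 / 5) ^ 18 := by positivity
    have h2 : l = 18 + Real.log (a / (6 / 5) ^ 18) / Real.log (6 / 5) := by
      have h3 : Real.log (6 / 5) ≠ 0 := (Real.log_pos (by norm_num)).ne'
      rw [hl, Real.logb, Real.log_div ha0.ne' h1.ne', Real.log_pow]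
      field_simp
      push_cast
      ring
    have h4 : (1 : ℝ) / 6 ≤ Real.log (6 / 5) := by
      have := Real.one_sub_inv_le_log_of_pos (x := 6 / 5) (by norm_num)
      norm_num at this ⊢
      linarith
    have h5 := Real.log_le_sub_one_of_pos (div_pos ha0 h1)
    have h6 : 0 ≤ a / (6 / 5) ^ 18 - 1 := by
      rw [sub_nonneg, le_div_iff₀ h1]
      norm_num
      linarith
    rw [h2]
    gcongr
    rw [div_le_iff₀ (by linarith)]
    nlinarith
  have hquad : 31 / 20 * ((6 / 5 : ℝ) ^ 8) ^ 2 / a ≤ 31 / 20 * ((6 / 5 : ℝ) ^ 8) ^ 2 / 27 := by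
    gcongr
  simp only [hf]
  norm_num at hlog hquad ⊢
  linarith

/-- For long lists with less than a quarter of the items marked, a search costs at most `9/2` times
the critical scale. -/
theorem searchCostLE_of_lt_quarter {N t : ℕ} (hN : 64 ≤ N) (ht : 1 ≤ t) (htN : 4 * t < N) :
    SearchCostLE N t 0 (9 / 2 * critical N t) := by
  -- The critical scale exceeds its value `2 / √3` at `t = N / 4`.
  have hlo : ((577 / 500 : ℚ) : ℝ) ≤ critical N t := by
    have h1 : (0 : ℝ) < t := by exact_mod_cast ht
    have h2 : (4 : ℝ) * t < N := by exact_mod_cast htN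
    have h3 : (0 : ℝ) < (N : ℝ) - t := by linarith
    refine (sq_le_sq₀ (by norm_num) (critical_pos ht (by lia)).le).1 ?_
    rw [critical_sq (by lia), le_div_iff₀ (by positivity)]
    have h4 : 0 ≤ ((N : ℝ) / 4 - t) * (3 * N / 4 - t) := by
      apply mul_nonneg <;> linarith
    push_cast
    nlinarith
  rcases searchCostLE_of_checkScales hN ht htN [(150 / 100, 11), (209 / 100, 11), (277 / 100, 11),
    (346 / 100, 11), (416 / 100, 11), (490 / 100, 11), (567 / 100, 11), (655 / 100, 12),
    (755 / 100, 13), (858 / 100, 13), (971 / 100, 14), (1103 / 100, 15), (125 / 10, 16),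
    (141 / 10, 16), (16, 17), (183 / 10, 18), (208 / 10, 18), (239 / 10, 19), (276 / 10, 20)]
    (577 / 500) (by decide +kernel) hlo with h | h
  · exact h
  · refine searchCostLE_of_large_critical ht htN (le_trans ?_ h)
    norm_num

/-- If at least a quarter of the items is marked, each cycle succeeds with probability at least
`7/20`; the first three cycles choose between zero and one Grover iterations. -/
theorem searchCostLE_of_quarter_le {N t : ℕ} (hN : 3 ≤ N) (htN : t < N) (h4 : N ≤ 4 * t) :
    SearchCostLE N t 0 (26 / 5) := by
  have hp : ∀ v, (7 / 20 : ℝ) ≤ successProb N t (numChoices N v) := fun v =>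
    successProb_ge_of_quarter_le (by lia) htN h4 (two_le_numChoices (by lia) v)
  have h3 : SearchCostLE N t 3 (7.57) := by
    refine (SearchCostLE.of_linear (u := 3) (p := 7 / 20) (α := 25 / 11) (β := 20 / 7) (by lia)
      (by norm_num) (by norm_num) (fun v _ => hp v) (by norm_num) (by norm_num)
      (by norm_num)).mono ?_
    have : cycleBound N 3 ≤ (6 / 5) ^ 4 := by
      rw [cycleBound_eq (by lia)]
      exact min_le_left _ _
    norm_num at this ⊢
    linarith
  have hstep : ∀ u c, u < 3 → 0 ≤ c → SearchCostLE N t (u + 1) c →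
      SearchCostLE N t u (3 / 2 + 13 / 20 * c) := by
    intro u c hu hc h
    refine h.step ?_
    have h1 : (6 / 5 : ℝ) ^ (u + 1) ≤ √N := by
      refine (pow_le_pow_right₀ (by norm_num) (show u + 1 ≤ 3 by lia)).trans ?_
      refine Real.le_sqrt_of_sq_le ?_
      have : (3 : ℝ) ≤ N := by exact_mod_cast hN
      norm_num
      linarith
    have h2 : ceilPow u = 2 := by interval_cases u <;> rfl
    have h3 := hp u
    rw [numChoices_eq_ceilPow (by lia) h1, h2] at h3 ⊢
    push_cast
    nlinarith
  refine (hstep 0 _ (by norm_num) ?_ (hstep 1 _ (by norm_num) ?_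
    (hstep 2 _ (by norm_num) (by norm_num) h3))).mono ?_ <;> norm_num

end ManyItems

/-! ### Lists of fewer than 128 items, by certified fixed-point arithmetic -/

section FewItems

theorem ceil_sqrt {N : ℕ} (hN : 1 ≤ N) : ⌈√(N : ℝ)⌉₊ = Nat.sqrt (N - 1) + 1 := by
  refine eq_of_forall_ge_iff fun c => ?_
  rw [Nat.ceil_le, Real.sqrt_le_left (Nat.cast_nonneg c), Nat.succ_le_iff, Nat.sqrt_lt']
  have : N - 1 < c ^ 2 ↔ N ≤ c ^ 2 := by lia
  rw [this]
  exact_mod_cast Iff.rfl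

theorem numChoices_eq_min {N : ℕ} (hN : 2 ≤ N) (u : ℕ) :
    numChoices N u = min (ceilPow u) (Nat.sqrt (N - 1) + 1) := by
  rw [numChoices, cycleBound_eq hN, Nat.ceil_mono.map_min, ceil_pow, ceil_sqrt (by lia)]

/-- Lower bounds, in units of `10⁻⁶`, for the sums of the first probabilities `hitProb N t j`,
starting from the bound `s` for those before the number `j`. The arguments are exact:
`e = N² cos (4 θ)`, `d = N ^ (2 j + 1)`, `c = d cos (2 (2 j + 1) θ)`,
`p = d cos (2 (2 j - 1) θ)`. -/
def hitSums (N e : ℤ) : ℕ → ℤ → ℤ → ℤ → ℕ → List ℕ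
  | 0, _, _, _, s => [s]
  | m + 1, d, c, p, s => s :: hitSums N e m (N ^ 2 * d) (2 * e * c - N ^ 2 * p) (N ^ 2 * c)
      (s + (1000000 * (d - c) / (2 * d)).toNat)

theorem cos_two_groverAngle {N t : ℕ} (hN : 0 < N) (ht : t ≤ N) :
    N * Real.cos (2 * groverAngle N t) = N - 2 * t := by
  have hN' : (0 : ℝ) < N := by exact_mod_cast hN
  rw [Real.cos_two_mul', cos_groverAngle hN, sin_groverAngle ht, Real.sq_sqrt, Real.sq_sqrt]
  · field_simp
    ring
  · positivity
  · exact div_nonneg (sub_nonneg.2 (by exact_mod_cast ht)) hN'.le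

theorem hitSums_le {N t : ℕ} (hN : 0 < N) {e : ℤ}
    (he : (e : ℝ) = N ^ 2 * Real.cos (4 * groverAngle N t)) (m j : ℕ) (d c p : ℤ) (s : ℕ)
    (hd : (d : ℝ) = (N : ℝ) ^ (2 * j + 1))
    (hc : (c : ℝ) = (N : ℝ) ^ (2 * j + 1) * Real.cos (2 * ((2 * j + 1) * groverAngle N t)))
    (hp : (p : ℝ) = (N : ℝ) ^ (2 * j + 1) * Real.cos (2 * ((2 * j - 1) * groverAngle N t)))
    (hs : (s : ℝ) ≤ 1000000 * ∑ l ∈ Finset.range j, hitProb N t l) (i : ℕ) :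
    (((hitSums N e m d c p s).getD i 0 : ℕ) : ℝ) ≤
      1000000 * ∑ l ∈ Finset.range (j + i), hitProb N t l := by
  have hN' : (0 : ℝ) < N := by exact_mod_cast hN
  have hnn : ∀ n, 0 ≤ 1000000 * ∑ l ∈ Finset.range n, hitProb N t l := fun n =>
    mul_nonneg (by norm_num) (Finset.sum_nonneg fun l _ => hitProb_nonneg _ _ _)
  induction m generalizing j d c p s i with
  | zero =>
    rcases i with _ | i
    · simpa [hitSums] using hs
    · simpa [hitSums] using hnn (j + (i + 1))
  | succ m ih =>
    rcases i with _ | i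
    · simpa [hitSums] using hs
    · rw [hitSums, List.getD_cons_succ, show j + (i + 1) = (j + 1) + i by lia]
      refine ih (j + 1) _ _ _ _ ?_ ?_ ?_ ?_ i
      · push_cast
        rw [hd]
        ring
      · have h1 : Real.cos (2 * ((2 * ((j + 1 : ℕ) : ℝ) + 1) * groverAngle N t)) =
            2 * Real.cos (4 * groverAngle N t) * Real.cos (2 * ((2 * j + 1) * groverAngle N t)) -
            Real.cos (2 * ((2 * j - 1) * groverAngle N t)) := by
          have h2 : 2 * ((2 * ((j + 1 : ℕ) : ℝ) + 1) * groverAngle N t) =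
            2 * ((2 * j + 1) * groverAngle N t) + 4 * groverAngle N t := by push_cast; ring
          have h3 : 2 * ((2 * (j : ℝ) - 1) * groverAngle N t) =
            2 * ((2 * j + 1) * groverAngle N t) - 4 * groverAngle N t := by ring
          rw [h2, h3, Real.cos_add, Real.cos_sub]
          ring
        rw [h1]
        push_cast
        rw [he, hc, hp]
        ring
      · push_cast
        rw [hc]
        have h3 : 2 * ((2 * ((j : ℝ) + 1) - 1) * groverAngle N t) =
          2 * ((2 * j + 1) * groverAngle N t) := by ring
        rw [h3]
        ring
      · rw [Finset.sum_range_succ, mul_add]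
        push_cast
        refine add_le_add hs ?_
        have hd0 : (0 : ℝ) < d := by rw [hd]; positivity
        have hd0' : 0 < d := by exact_mod_cast hd0
        have h1 : 1000000 * hitProb N t j = 1000000 * ((d : ℝ) - c) / (2 * d) := by
          rw [hitProb, Real.sin_sq_eq_half_sub, hc, ← hd]
          field_simp
        rcases le_total 0 (1000000 * (d - c) / (2 * d)) with h | h
        · have h2 : (((1000000 * (d - c) / (2 * d)).toNat : ℕ) : ℝ) =
              ((1000000 * (d - c) / (2 * d) : ℤ) : ℝ) := by
            exact_mod_cast Int.toNat_of_nonneg h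
          rw [h2, h1, le_div_iff₀ (by positivity)]
          have h3 := Int.ediv_mul_le (1000000 * (d - c)) (b := 2 * d) (by lia)
          exact_mod_cast h3
        · rw [Int.toNat_of_nonpos h, Nat.cast_zero]
          have := hitProb_nonneg N t j
          positivity

/-- The cost of a search in units of `10⁻⁶`, with rounding up, from the sums of the probabilities
`hitProb`, the numbers of choices in the next cycles, and the cost after these cycles. -/
def chainCost (sums : List ℕ) : List ℕ → ℕ → ℕ
  | [], c => c
  | M :: l, c =>
    (M + 1) * 500000 + ((1000000 - sums.getD M 0 / M) * chainCost sums l c) / 1000000 + 1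

theorem div_le_successProb {N t M x : ℕ} (hM : 0 < M)
    (hx : (x : ℝ) ≤ 1000000 * ∑ l ∈ Finset.range M, hitProb N t l) :
    ((x / M : ℕ) : ℝ) ≤ 1000000 * successProb N t M := by
  have hM' : (0 : ℝ) < M := by exact_mod_cast hM
  refine Nat.cast_div_le.trans ?_
  rw [successProb, div_le_iff₀ hM', mul_assoc, div_mul_cancel₀ _ hM'.ne']
  exact hx

theorem searchCostLE_chainCost {N t : ℕ} (hN : 2 ≤ N) {sums : List ℕ}
    (hsums : ∀ M, ((sums.getD M 0 : ℕ) : ℝ) ≤ 1000000 * ∑ l ∈ Finset.range M, hitProb N t l)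
    (n u : ℕ) (c : ℕ) (h : SearchCostLE N t (u + n) (c / 1000000)) :
    SearchCostLE N t u
      ((chainCost sums ((List.range' u n).map (numChoices N)) c : ℕ) / 1000000 : ℝ) := by
  induction n generalizing u with
  | zero => simpa [chainCost] using h
  | succ n ih =>
    rw [List.range'_succ, List.map_cons, chainCost]
    have h1 := ih (u + 1) (by rwa [show u + 1 + n = u + (n + 1) by lia])
    set C := chainCost sums ((List.range' (u + 1) n).map (numChoices N)) c
    set M := numChoices N u
    have hM : 0 < M := numChoices_pos (by lia) u
    refine h1.step ?_
    have hp := div_le_successProb hM (hsums M)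
    have hp1 := successProb_le_one N t M
    set q := sums.getD M 0 / M
    have hq : q ≤ 1000000 := by
      have : (q : ℝ) ≤ 1000000 := by linarith
      exact_mod_cast this
    have h2 : (((1000000 - q) * C : ℕ) : ℝ) ≤
        1000000 * (((1000000 - q) * C / 1000000 : ℕ) + 1 : ℝ) := by
      have h3 := Nat.lt_mul_div_succ ((1000000 - q) * C) (b := 1000000) (by norm_num)
      exact_mod_cast h3.le
    rw [Nat.cast_mul, Nat.cast_sub hq] at h2
    push_cast at h2 ⊢
    have hC : (0 : ℝ) ≤ C := Nat.cast_nonneg C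
    have h4 : (1 - successProb N t M) * C ≤ (1 - q / 1000000) * C := by
      gcongr
      rw [div_le_iff₀ (by norm_num)]
      linarith
    rw [le_div_iff₀ (by norm_num)]
    have h5 : (((M : ℝ) + 1) / 2 + (1 - successProb N t M) * (C / 1000000)) * 1000000 =
      (M + 1) * 500000 + (1 - successProb N t M) * C := by ring
    rw [h5]
    linarith

/-- An upper bound, in units of `10⁻⁶`, for the cost of a search for `t` marked items, where `r` is
the eventual number of choices and `Ms` lists the numbers of choices in the first cycles. The value
`none` means that no bound was found. -/
def searchCost (N r : ℕ) (Ms : List ℕ) (t : ℕ) : Option ℕ :=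
  if 16 ≤ N && N ≤ 4 * t then some 5200000 else
  let sums := hitSums N (2 * (N - 2 * t : ℤ) ^ 2 - N ^ 2) r N (N - 2 * t) (N - 2 * t) 0
  if 0 < sums.getD r 0 / r then
    some (chainCost sums Ms ((r + 1) * 500000 * 1000000 / (sums.getD r 0 / r) + 1))
  else none

theorem searchCostLE_searchCost {N t c : ℕ} (hN : 2 ≤ N) (hN2 : N ≤ 256) (htN : t < N)
    (h : searchCost N (Nat.sqrt (N - 1) + 1) ((List.range 14).map (numChoices N)) t = some c) :
    SearchCostLE N t 0 (c / 1000000) := by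
  rw [searchCost] at h
  split_ifs at h with h1
  · simp only [Bool.and_eq_true, decide_eq_true_eq] at h1
    obtain rfl : 5200000 = c := by simpa using h
    refine (searchCostLE_of_quarter_le (by lia) htN h1.2).mono ?_
    norm_num
  · dsimp only at h
    split_ifs at h with h2
    set r := Nat.sqrt (N - 1) + 1 with hr
    set sums := hitSums N (2 * (N - 2 * t : ℤ) ^ 2 - N ^ 2) r N (N - 2 * t) (N - 2 * t) 0
    have hN0 : 0 < N := by lia
    have hcos := cos_two_groverAngle hN0 htN.le
    have hsums : ∀ M, ((sums.getD M 0 : ℕ) : ℝ) ≤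
        1000000 * ∑ l ∈ Finset.range M, hitProb N t l := by
      intro M
      have h3 := hitSums_le (N := N) (t := t) (e := 2 * (N - 2 * t : ℤ) ^ 2 - N ^ 2) hN0 (by
        rw [show 4 * groverAngle N t = 2 * (2 * groverAngle N t) by ring, Real.cos_two_mul]
        push_cast
        rw [← hcos]
        ring) r 0 N (N - 2 * t) (N - 2 * t) 0 (by simp) (by simp [← hcos]) (by
          push_cast
          rw [← hcos, show 2 * ((2 * (0 : ℝ) - 1) * groverAngle N t) = -(2 * groverAngle N t) by
            ring, Real.cos_neg]
          ring) (by simp) M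
      rwa [Nat.zero_add] at h3
    obtain rfl := Option.some.inj h
    have hrange : List.range 14 = List.range' 0 14 := List.range_eq_range'
    rw [hrange]
    refine searchCostLE_chainCost hN hsums 14 0 _ ?_
    rw [Nat.zero_add]
    -- For `N ≤ 256`, the number of choices has reached `⌈√N⌉ ≤ 16` after 14 cycles.
    have hrM : ∀ v, 14 ≤ v → numChoices N v = r := by
      intro v hv
      rw [numChoices_eq_min hN, min_eq_right]
      have h4 : Nat.sqrt (N - 1) ≤ 15 := by
        rw [← Nat.lt_succ_iff, Nat.sqrt_lt']
        lia
      have h5 : (15 : ℝ) < (6 / 5) ^ (v + 1) := by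
        refine lt_of_lt_of_le ?_ (pow_le_pow_right₀ (by norm_num) (show 15 ≤ v + 1 by lia))
        norm_num
      have h6 : 15 < ceilPow v := by
        rw [← ceil_pow, Nat.lt_ceil]
        exact_mod_cast h5
      lia
    have hp := div_le_successProb (N := N) (t := t) (show 0 < r by lia) (hsums r)
    have h2' : (0 : ℝ) < (sums.getD r 0 / r : ℕ) := by exact_mod_cast h2
    set q := sums.getD r 0 / r
    set c := (r + 1) * 500000 * 1000000 / q + 1 with hc
    have hcq : ((r : ℝ) + 1) * 500000 * 1000000 ≤ q * c := by
      have h3 := Nat.lt_mul_div_succ ((r + 1) * 500000 * 1000000) (b := q) h2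
      exact_mod_cast h3.le
    refine ⟨fun _ => c / 1000000, fun _ => by positivity, fun v hv => ?_, le_rfl⟩
    rw [hrM v hv]
    have h3 : (q : ℝ) * c ≤ 1000000 * successProb N t r * c := by gcongr
    linarith

/-- A lower bound for `F N t` in units of `10⁻⁶`. The ceiling of the logarithm of the critical scale
to the base `6/5` is bounded by the number of `i < 14` with `(6/5) ^ i` below that scale. -/
def scaledF (N t : ℕ) : ℕ :=
  if 4 * t < N then
    9 * Nat.sqrt (250000000000 * N ^ 2 / ((N - t) * t)) / 2 +
      Nat.count (fun i => 36 ^ i * (4 * ((N - t) * t)) < 25 ^ i * N ^ 2) 14 * 1000000 - 3000000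
  else 2034400

theorem F_eq_of_lt {N t : ℕ} (htN : 4 * t < N) : F N t =
    9 / 2 * critical N t + ⌈Real.logb (6 / 5) (critical N t)⌉ - 3 := by
  have h : (t : ℝ) < N / 4 := by
    have : (4 : ℝ) * t < N := by exact_mod_cast htN
    linarith
  rw [F, if_pos h, critical]
  ring

theorem F_eq_of_le {N t : ℕ} (htN : N ≤ 4 * t) : F N t = 2.0344 := by
  have h : ¬ (t : ℝ) < N / 4 := by
    have : (N : ℝ) ≤ 4 * t := by exact_mod_cast htN
    linarith
  rw [F, if_neg h]

theorem one_le_critical {N t : ℕ} (ht : 1 ≤ t) (htN : t < N) : 1 ≤ critical N t := by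
  have h := Real.sin_le_one (2 * groverAngle N t)
  rw [sin_two_groverAngle_eq_inv (by lia) htN.le] at h
  exact (inv_le_one₀ (critical_pos ht htN)).1 h

theorem lt_ceil_logb_critical {N t i : ℕ} (ht : 1 ≤ t) (htN : t < N)
    (h : 36 ^ i * (4 * ((N - t) * t)) < 25 ^ i * N ^ 2) :
    (i : ℤ) < ⌈Real.logb (6 / 5) (critical N t)⌉ := by
  have h1 : (0 : ℝ) < t := by exact_mod_cast ht
  have h2 : (0 : ℝ) < (N : ℝ) - t := sub_pos.2 (by exact_mod_cast htN)
  rw [Int.lt_ceil, Int.cast_natCast, Real.lt_logb_iff_rpow_lt (by norm_num) (critical_pos ht htN),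
    Real.rpow_natCast]
  refine lt_of_pow_lt_pow_left₀ 2 (critical_pos ht htN).le ?_
  rw [critical_sq htN.le, lt_div_iff₀ (by positivity), ← pow_mul, mul_comm i, pow_mul]
  have h3 : (36 : ℝ) ^ i * (4 * (((N : ℝ) - t) * t)) < 25 ^ i * N ^ 2 := by
    rw [← Nat.cast_sub htN.le]
    exact_mod_cast h
  norm_num only [div_pow]
  rw [div_mul_eq_mul_div, div_lt_iff₀ (by positivity)]
  linarith

theorem count_le_ceil_logb_critical {N t : ℕ} (ht : 1 ≤ t) (htN : t < N) (n : ℕ) :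
    ((Nat.count (fun i => 36 ^ i * (4 * ((N - t) * t)) < 25 ^ i * N ^ 2) n : ℕ) : ℝ) ≤
      ⌈Real.logb (6 / 5) (critical N t)⌉ := by
  have h0 : 0 ≤ ⌈Real.logb (6 / 5) (critical N t)⌉ :=
    Int.ceil_nonneg (Real.logb_nonneg (by norm_num) (one_le_critical ht htN))
  have h1 : Nat.count (fun i => 36 ^ i * (4 * ((N - t) * t)) < 25 ^ i * N ^ 2) n ≤
      ⌈Real.logb (6 / 5) (critical N t)⌉.toNat := by
    rw [Nat.count_eq_card_filter_range,
      ← Finset.card_range ⌈Real.logb (6 / 5) (critical N t)⌉.toNat]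
    refine Finset.card_le_card fun i hi => ?_
    have := lt_ceil_logb_critical ht htN (Finset.mem_filter.1 hi).2
    rw [Finset.mem_range]
    lia
  have h2 : ((Nat.count (fun i => 36 ^ i * (4 * ((N - t) * t)) < 25 ^ i * N ^ 2) n : ℕ) : ℤ) ≤
      ⌈Real.logb (6 / 5) (critical N t)⌉ := by lia
  exact_mod_cast h2

theorem F_nonneg {N t : ℕ} (ht : 1 ≤ t) (htN : t < N) : 0 ≤ F N t := by
  by_cases h : 4 * t < N
  · have h1 := one_le_critical ht htN
    have h2 : (0 : ℝ) ≤ ⌈Real.logb (6 / 5) (critical N t)⌉ := by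
      exact_mod_cast Int.ceil_nonneg (Real.logb_nonneg (by norm_num) h1)
    rw [F_eq_of_lt h]
    linarith
  · rw [F_eq_of_le (not_lt.1 h)]
    norm_num

theorem scaledF_le {N t : ℕ} (ht : 1 ≤ t) (htN : t < N) : (scaledF N t : ℝ) ≤ 1000000 * F N t := by
  rw [scaledF]
  split_ifs with h
  · have hF := F_nonneg ht htN
    set x := 9 * Nat.sqrt (250000000000 * N ^ 2 / ((N - t) * t)) / 2 with hx
    set n := Nat.count (fun i => 36 ^ i * (4 * ((N - t) * t)) < 25 ^ i * N ^ 2) 14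
    have hn : (n : ℝ) ≤ ⌈Real.logb (6 / 5) (critical N t)⌉ := count_le_ceil_logb_critical ht htN 14
    have h1 : (x : ℝ) ≤ 1000000 * (9 / 2 * critical N t) := by
      have h2 : ((Nat.sqrt (250000000000 * N ^ 2 / ((N - t) * t)) : ℕ) : ℝ) ≤
          1000000 * critical N t := by
        have ha := critical_pos ht htN
        refine (pow_le_pow_iff_left₀ (by positivity) (by positivity) two_ne_zero).1 ?_
        have h5 : ((Nat.sqrt (250000000000 * N ^ 2 / ((N - t) * t)) : ℕ) : ℝ) ^ 2 ≤
            ((250000000000 * N ^ 2 / ((N - t) * t) : ℕ) : ℝ) := by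
          exact_mod_cast Nat.sqrt_le' _
        refine (h5.trans Nat.cast_div_le).trans (le_of_eq ?_)
        rw [mul_pow, critical_sq htN.le]
        have h6 : (0 : ℝ) < (N : ℝ) - t := sub_pos.2 (by exact_mod_cast htN)
        have h7 : (0 : ℝ) < t := by exact_mod_cast ht
        push_cast [htN.le]
        field_simp
        ring
      have h3 : (x : ℝ) ≤ ((9 * Nat.sqrt (250000000000 * N ^ 2 / ((N - t) * t)) : ℕ) : ℝ) / 2 :=
        Nat.cast_div_le
      push_cast at h3
      linarith
    rcases le_total (x + n * 1000000) 3000000 with h4 | h4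
    · rw [Nat.sub_eq_zero_of_le h4]
      simpa using hF
    · rw [Nat.cast_sub h4, F_eq_of_lt h]
      push_cast
      linarith
  · rw [F_eq_of_le (not_lt.1 h)]
    norm_num

/-- The loop over `t` of `checkFewItems`: the running maximum `H` of `t` times the cost of a search,
the bound `E` for the expected number of oracle calls, and the lower bound `B` for the series. For
fewer than five items, the expected number of oracle calls is not compared with the series, which
may be smaller. -/
def checkLoop (N r : ℕ) (Ms : List ℕ) : ℕ → ℕ → ℕ → ℕ → ℕ → Bool
  | 0, _, _, E, B => (N < 5 || E ≤ B) && E ^ 2 ≤ 25 * N * 1000000 ^ 2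
  | n + 1, t, H, E, B =>
    match searchCost N r Ms t with
    | none => false
    | some c =>
      checkLoop N r Ms n (t + 1) (max H (t * c)) (E + max H (t * c) / (t * (t + 1)) + 1)
        (B + scaledF N t / (t + 1))

/-- Soundness of `checkLoop`; `H` collects the running maxima for the indices below `t`. -/
theorem exists_of_checkLoop {N : ℕ} (hN : 2 ≤ N) (hN2 : N ≤ 256) {Ms : List ℕ}
    (hMs : Ms = (List.range 14).map (numChoices N)) (n t h e b : ℕ) (htn : t + n = N) (ht : 1 ≤ t)
    (hcheck : checkLoop N (Nat.sqrt (N - 1) + 1) Ms n t h e b = true) {H : ℕ → ℝ}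
    (hH : Monotone H) (hH0 : H 0 = 0) (hHt : ∀ s, t ≤ s + 1 → H s = h / 1000000)
    (hC : ∀ s, 1 ≤ s → s < t → SearchCostLE N s 0 (H s / s))
    (he : ∑ s ∈ Finset.range t, H s / s / (s + 1) ≤ e / 1000000)
    (hb : (b : ℝ) / 1000000 ≤ ∑ s ∈ Finset.Ico 1 t, F N s / (s + 1)) :
    ∃ H : ℕ → ℝ, Monotone H ∧ H 0 = 0 ∧
      (∀ t, 1 ≤ t → t < N → SearchCostLE N t 0 (H t / t)) ∧
      ∑ t ∈ Finset.range N, H t / t / (t + 1) ≤ 26 / 5 * √N ∧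
      (5 ≤ N → ∑ t ∈ Finset.range N, H t / t / (t + 1) ≤
        ∑ t ∈ Finset.Ico 1 N, F N t / (t + 1)) := by
  induction n generalizing t h e b H with
  | zero =>
    obtain rfl : t = N := by lia
    simp only [checkLoop, Bool.and_eq_true, Bool.or_eq_true, decide_eq_true_eq] at hcheck
    refine ⟨H, hH, hH0, hC, he.trans ?_, fun h5 => he.trans (le_trans ?_ hb)⟩
    · have h1 : (e : ℝ) ^ 2 ≤ 25 * t * 1000000 ^ 2 := by exact_mod_cast hcheck.2
      have h2 : (e : ℝ) / 1000000 ≤ 5 * √t := by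
        rw [div_le_iff₀ (by norm_num)]
        refine (pow_le_pow_iff_left₀ (by positivity) (by positivity) two_ne_zero).1 ?_
        rw [mul_pow, mul_pow, Real.sq_sqrt (Nat.cast_nonneg t)]
        linarith
      have h3 := Real.sqrt_nonneg (t : ℝ)
      linarith
    · have h1 : (e : ℝ) ≤ b := by exact_mod_cast hcheck.1.resolve_left (by lia)
      gcongr
  | succ n ih =>
    rw [checkLoop] at hcheck
    split at hcheck
    · exact absurd hcheck (by simp)
    · rename_i c hc
      rw [hMs] at hc
      have hcost := searchCostLE_searchCost hN hN2 (by lia) hc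
      have htR : (0 : ℝ) < t := by exact_mod_cast ht
      have hle : ∀ s, H s ≤ (max h (t * c) : ℕ) / 1000000 := by
        intro s
        calc H s ≤ H (max s t) := hH (le_max_left s t)
          _ = h / 1000000 := hHt _ (by lia)
          _ ≤ (max h (t * c) : ℕ) / 1000000 := by
            gcongr
            exact le_max_left _ _
      have hlt : ∀ s < t, (if s < t then H s else (max h (t * c) : ℕ) / 1000000) = H s :=
        fun s hs => if_pos hs
      refine ih (t + 1) _ _ _ (by lia) (by lia) hcheck
        (H := fun s => if s < t then H s else (max h (t * c) : ℕ) / 1000000) ?_ ?_ ?_ ?_ ?_ ?_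
      · intro s s' hs
        dsimp only
        split_ifs with h1 h2 h2
        · exact hH hs
        · exact hle s
        · lia
        · exact le_rfl
      · simpa only [if_pos (show 0 < t by lia)] using hH0
      · intro s hs
        exact if_neg (by lia)
      · intro s hs1 hs2
        split_ifs with h1
        · exact hC s hs1 h1
        · obtain rfl : s = t := by lia
          refine hcost.mono ?_
          rw [le_div_iff₀ htR, div_mul_eq_mul_div, mul_comm (c : ℝ)]
          gcongr
          exact_mod_cast le_max_right h (s * c)
      · rw [Finset.sum_range_succ, if_neg (lt_irrefl t), Finset.sum_congr rfl fun s hs => by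
          rw [hlt s (Finset.mem_range.1 hs)]]
        generalize max h (t * c) = m
        have h1 : (m : ℝ) ≤ t * (t + 1) * ((m / (t * (t + 1)) : ℕ) + 1 : ℝ) := by
          exact_mod_cast (Nat.lt_mul_div_succ m (show 0 < t * (t + 1) by positivity)).le
        have h2 : (m : ℝ) / 1000000 / t / (t + 1) ≤
            ((m / (t * (t + 1)) : ℕ) + 1 : ℝ) / 1000000 := by
          rw [div_div, div_div, div_le_div_iff₀ (by positivity) (by norm_num)]
          nlinarith
        push_cast at h2 ⊢
        linarith
      · rw [Finset.sum_Ico_succ_top ht]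
        have h1 := scaledF_le (N := N) (t := t) ht (by lia)
        have h2 : ((scaledF N t / (t + 1) : ℕ) : ℝ) ≤ 1000000 * (F N t / (t + 1)) := by
          refine Nat.cast_div_le.trans ?_
          rw [← mul_div_assoc]
          push_cast
          gcongr
        push_cast
        linarith

/-- A check, in fixed-point arithmetic, of the two upper bounds for the expected number of
queries in the case of `N` items. -/
def checkFewItems (N : ℕ) : Bool :=
  checkLoop N (Nat.sqrt (N - 1) + 1)
    ((List.range 14).map fun u => min (ceilPow u) (Nat.sqrt (N - 1) + 1)) (N - 1) 1 0 0 0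

theorem checkFewItems_of_lt : ∀ N ∈ List.range' 2 126, checkFewItems N = true := by
  decide +kernel

theorem exists_of_few_items {N : ℕ} (hN : 2 ≤ N) (hN2 : N < 128) :
    ∃ H : ℕ → ℝ, Monotone H ∧ H 0 = 0 ∧
      (∀ t, 1 ≤ t → t < N → SearchCostLE N t 0 (H t / t)) ∧
      ∑ t ∈ Finset.range N, H t / t / (t + 1) ≤ 26 / 5 * √N ∧
      (5 ≤ N → ∑ t ∈ Finset.range N, H t / t / (t + 1) ≤
        ∑ t ∈ Finset.Ico 1 N, F N t / (t + 1)) := by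
  have hcheck := checkFewItems_of_lt N (List.mem_range'_1.2 ⟨hN, by lia⟩)
  refine exists_of_checkLoop hN (by lia) ?_ (N - 1) 1 0 0 0 (by lia) le_rfl hcheck
    (H := fun _ => 0) (fun _ _ _ => le_rfl) rfl (fun _ _ => by simp) (fun s h1 h2 => by lia)
    (by simp) (by simp)
  exact List.map_congr_left fun u _ => (numChoices_eq_min hN u).symm

end FewItems

/-! ### The expected number of queries -/

section ManyItemsSums

theorem inv_succ_le_log_sub_log {t : ℕ} (ht : 1 ≤ t) :
    1 / ((t : ℝ) + 1) ≤ Real.log ((t + 1 : ℕ) : ℝ) - Real.log t := by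
  have h : (0 : ℝ) < t := by exact_mod_cast ht
  have h1 := Real.one_sub_inv_le_log_of_pos (show 0 < ((t : ℝ) + 1) / t by positivity)
  rw [Real.log_div (by positivity) (by positivity)] at h1
  push_cast
  refine le_trans (le_of_eq ?_) h1
  field_simp
  ring

theorem sum_inv_succ_le_log {a b : ℕ} (ha : 1 ≤ a) (hab : a ≤ b) :
    ∑ t ∈ Finset.Ico a b, 1 / ((t : ℝ) + 1) ≤ Real.log (b / a) := by
  have h : (0 : ℝ) < a := by exact_mod_cast ha
  have h' : (0 : ℝ) < b := by exact_mod_cast ha.trans hab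
  rw [Real.log_div h'.ne' h.ne']
  calc ∑ t ∈ Finset.Ico a b, 1 / ((t : ℝ) + 1)
      ≤ ∑ t ∈ Finset.Ico a b, (Real.log ((t + 1 : ℕ) : ℝ) - Real.log t) :=
        Finset.sum_le_sum fun t ht => inv_succ_le_log_sub_log (ha.trans (Finset.mem_Ico.1 ht).1)
    _ = Real.log b - Real.log a := Finset.sum_Ico_sub (fun t => Real.log ((t : ℕ) : ℝ)) hab

theorem inv_sqrt_mul_le {t : ℕ} (ht : 1 ≤ t) :
    1 / (√(t : ℝ) * (t + 1)) ≤ 2 * (1 / √(t : ℝ) - 1 / √((t + 1 : ℕ) : ℝ)) := by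
  have h : (0 : ℝ) < t := by exact_mod_cast ht
  have hx : 0 < √(t : ℝ) := Real.sqrt_pos.2 h
  have hy : 0 < √((t + 1 : ℕ) : ℝ) := Real.sqrt_pos.2 (by positivity)
  have hx2 : √(t : ℝ) ^ 2 = t := Real.sq_sqrt h.le
  have hy2 : √((t + 1 : ℕ) : ℝ) ^ 2 = t + 1 := by rw [Real.sq_sqrt (by positivity)]; simp
  rw [← hy2]
  generalize √((t + 1 : ℕ) : ℝ) = y at *
  have h1 : 2 * (1 / √(t : ℝ) - 1 / y) - 1 / (√(t : ℝ) * y ^ 2) =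
      (y - √(t : ℝ)) ^ 2 / (√(t : ℝ) * y ^ 2) := by
    field_simp
    linarith
  have h2 : 0 ≤ (y - √(t : ℝ)) ^ 2 / (√(t : ℝ) * y ^ 2) := by positivity
  linarith

theorem sum_inv_sqrt_mul_le {b : ℕ} (hb : 1 ≤ b) :
    ∑ t ∈ Finset.Ico 1 b, 1 / (√(t : ℝ) * (t + 1)) ≤ 2 * (1 - 1 / √(b : ℝ)) := by
  calc ∑ t ∈ Finset.Ico 1 b, 1 / (√(t : ℝ) * (t + 1))
      ≤ ∑ t ∈ Finset.Ico 1 b, -2 * (1 / √((t + 1 : ℕ) : ℝ) - 1 / √(t : ℝ)) :=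
        Finset.sum_le_sum fun t ht =>
          (inv_sqrt_mul_le (Finset.mem_Ico.1 ht).1).trans (le_of_eq (by ring))
    _ = 2 * (1 - 1 / √(b : ℝ)) := by
        rw [← Finset.mul_sum, Finset.sum_Ico_sub (fun t => 1 / √((t : ℕ) : ℝ)) hb]
        simp only [Nat.cast_one, Real.sqrt_one]
        ring

/-- The bound used for `t` times the cost of a search for `t` marked items, in a long list. -/
noncomputable def potential (N t : ℕ) : ℝ :=
  if 4 * t < N then t * (9 / 2 * critical N t) else t * (26 / 5)

theorem mul_critical_sq {N t : ℕ} (ht : 1 ≤ t) (htN : t < N) :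
    (t * critical N t) ^ 2 = (N : ℝ) ^ 2 / 4 * (t / (N - t)) := by
  have h1 : (0 : ℝ) < t := by exact_mod_cast ht
  have h2 : (0 : ℝ) < (N : ℝ) - t := sub_pos.2 (by exact_mod_cast htN)
  rw [mul_pow, critical_sq htN.le]
  field_simp

theorem potential_div {N t : ℕ} (ht : 1 ≤ t) :
    potential N t / t = if 4 * t < N then 9 / 2 * critical N t else 26 / 5 := by
  have h1 : (t : ℝ) ≠ 0 := by positivity
  rw [potential]
  split_ifs <;> field_simp

theorem potential_mono (N : ℕ) : Monotone (potential N) := by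
  have hcrit : ∀ t : ℕ, 0 ≤ critical N t := fun t => by unfold critical; positivity
  intro s t hst
  rcases Nat.eq_zero_or_pos s with rfl | hs
  · have := hcrit t
    rw [potential, potential]
    simp only [Nat.cast_zero, zero_mul, ite_self]
    split_ifs <;> positivity
  have hs' : (0 : ℝ) < s := by exact_mod_cast hs
  have hst' : (s : ℝ) ≤ t := by exact_mod_cast hst
  have hcs := hcrit s
  have hct := hcrit t
  rw [potential, potential]
  split_ifs with h1 h2 h2
  · have h3 : (0 : ℝ) < (N : ℝ) - t := sub_pos.2 (by exact_mod_cast (show t < N by lia))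
    have h4 : (s * critical N s) ^ 2 ≤ (t * critical N t) ^ 2 := by
      rw [mul_critical_sq hs (by lia), mul_critical_sq (by lia) (by lia)]
      gcongr
    have h5 : s * critical N s ≤ t * critical N t :=
      (pow_le_pow_iff_left₀ (by positivity) (by positivity) two_ne_zero).1 h4
    linarith
  · have h3 : (4 : ℝ) * s ≤ N := by exact_mod_cast h1.le
    have h6 : (0 : ℝ) < (N : ℝ) - s := by linarith
    have h4 : (s * critical N s) ^ 2 ≤ (13 / 45 * N : ℝ) ^ 2 := by
      rw [mul_critical_sq hs (by lia)]
      have h5 : (s : ℝ) / (N - s) ≤ 1 / 3 := by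
        rw [div_le_iff₀ h6]
        linarith
      calc (N : ℝ) ^ 2 / 4 * (s / (N - s)) ≤ (N : ℝ) ^ 2 / 4 * (1 / 3) := by gcongr
        _ ≤ (13 / 45 * N : ℝ) ^ 2 := by nlinarith [sq_nonneg (N : ℝ)]
    have h5 : s * critical N s ≤ 13 / 45 * N :=
      (pow_le_pow_iff_left₀ (by positivity) (by positivity) two_ne_zero).1 h4
    have h7 : (N : ℝ) ≤ 4 * t := by exact_mod_cast not_lt.1 h2
    linarith
  · lia
  · gcongr

/-- Replacing `N - t` by `N` in `lt_ceil_logb_critical` makes the condition monotone in `N`. -/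
theorem lt_ceil_logb_critical_of_le {N t i M : ℕ} (ht : 1 ≤ t) (htN : t < N) (hM : M ≤ N)
    (h : 36 ^ i * (4 * t) < 25 ^ i * M) :
    (i : ℤ) < ⌈Real.logb (6 / 5) (critical N t)⌉ := by
  refine lt_ceil_logb_critical ht htN ?_
  calc 36 ^ i * (4 * ((N - t) * t)) ≤ 36 ^ i * (4 * (N * t)) := by gcongr; lia
    _ = N * (36 ^ i * (4 * t)) := by ring
    _ < N * (25 ^ i * M) := by gcongr; lia
    _ ≤ N * (25 ^ i * N) := by gcongr
    _ = 25 ^ i * N ^ 2 := by ring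

theorem log_four_lt : Real.log 4 < 1.3864 := by
  have h := Real.log_two_lt_d9
  rw [show (4 : ℝ) = 2 ^ 2 by norm_num, Real.log_pow]
  push_cast
  linarith

/-- Below `N / 4`, the terms are at most a multiple of `1 / (√t (t + 1))`, which is summed by
`sum_inv_sqrt_mul_le`; the loss in its last term pays for the harmonic sum from `N / 4` on. -/
theorem sum_potential_le_sqrt {N : ℕ} (hN : 128 ≤ N) :
    ∑ t ∈ Finset.range N, potential N t / t / (t + 1) ≤ 26 / 5 * √N := by
  obtain ⟨p, hp1, hp2⟩ : ∃ p : ℕ, N ≤ 4 * p ∧ 4 * p < N + 4 := ⟨(N + 3) / 4, by lia, by lia⟩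
  have hNR : (0 : ℝ) < N := by positivity
  have hpR : (0 : ℝ) < p := by exact_mod_cast (show 0 < p by lia)
  have h1 : ∑ t ∈ Finset.Ico 1 p, potential N t / t / (t + 1) ≤
      9 / 2 * √(N / 3) * (2 * (1 - 1 / √(p : ℝ))) := by
    calc ∑ t ∈ Finset.Ico 1 p, potential N t / t / (t + 1)
        ≤ ∑ t ∈ Finset.Ico 1 p, 9 / 2 * √(N / 3) * (1 / (√(t : ℝ) * (t + 1))) := by
          refine Finset.sum_le_sum fun t ht => ?_
          obtain ⟨ht1, ht2⟩ := Finset.mem_Ico.1 ht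
          have htR : (0 : ℝ) < t := by exact_mod_cast ht1
          have h3 : (4 : ℝ) * t ≤ N := by exact_mod_cast (show 4 * t ≤ N by lia)
          have hs : critical N t ≤ √(N / 3) / √t := by
            rw [← Real.sqrt_div (by positivity)]
            refine Real.le_sqrt_of_sq_le ?_
            rw [critical_sq (by lia), div_div,
              div_le_div_iff₀ (mul_pos four_pos (mul_pos (by linarith) htR)) (by positivity)]
            have h4 : 3 * (N : ℝ) ≤ 4 * (N - t) := by linarith
            calc (N : ℝ) ^ 2 * (3 * t) = N * t * (3 * N) := by ring
              _ ≤ N * t * (4 * (N - t)) := by gcongr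
              _ = N * (4 * ((N - t) * t)) := by ring
          rw [potential_div ht1, if_pos (by lia)]
          calc 9 / 2 * critical N t / (t + 1) ≤ 9 / 2 * (√(N / 3) / √t) / (t + 1) := by gcongr
            _ = _ := by
              have hx : 0 < √(t : ℝ) := Real.sqrt_pos.2 htR
              field_simp
      _ ≤ _ := by
          rw [← Finset.mul_sum]
          gcongr
          exact sum_inv_sqrt_mul_le (by lia)
  have h2 : ∑ t ∈ Finset.Ico p N, potential N t / t / (t + 1) ≤ 26 / 5 * Real.log 4 := by
    calc ∑ t ∈ Finset.Ico p N, potential N t / t / (t + 1)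
        = 26 / 5 * ∑ t ∈ Finset.Ico p N, 1 / ((t : ℝ) + 1) := by
          rw [Finset.mul_sum]
          refine Finset.sum_congr rfl fun t ht => ?_
          obtain ⟨ht1, ht2⟩ := Finset.mem_Ico.1 ht
          rw [potential_div (by lia), if_neg (by lia), mul_one_div]
      _ ≤ 26 / 5 * Real.log (N / p) := by
          gcongr
          exact sum_inv_succ_le_log (by lia) (by lia)
      _ ≤ 26 / 5 * Real.log 4 := by
          gcongr
          rw [div_le_iff₀ hpR]
          exact_mod_cast hp1
  have h3 : 1 ≤ √(N / 3) * (1 / √(p : ℝ)) := by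
    rw [mul_one_div, ← Real.sqrt_div (by positivity), Real.one_le_sqrt, div_div,
      one_le_div (by positivity)]
    exact_mod_cast (show 3 * p ≤ N by lia)
  have h4 : 9 * √((N : ℝ) / 3) ≤ 26 / 5 * √N := by
    refine (pow_le_pow_iff_left₀ (by positivity) (by positivity) two_ne_zero).1 ?_
    rw [mul_pow, mul_pow, Real.sq_sqrt (by positivity), Real.sq_sqrt (by positivity)]
    linarith
  have h5 := log_four_lt
  rw [Finset.range_eq_Ico, Finset.sum_eq_sum_Ico_succ_bot (by lia), Nat.cast_zero, div_zero,
    zero_div, zero_add, ← Finset.sum_Ico_consecutive _ (show 0 + 1 ≤ p by lia) (show p ≤ N by lia)]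
  simp only [Nat.zero_add] at *
  linarith

/-- The terms of the two sides differ by `(⌈log_{6/5} a⌉ - 3) / (t + 1)` below `N / 4`, where `a` is
the critical scale, and by `-3.1656 / (t + 1)` from there on. The surplus for `t = 1, 2, 3`, where
`a` is large, exceeds the deficit from `7 N / 50` on, which is a harmonic sum over a bounded
ratio. In between, `a` is at least `(6/5)²`. -/
theorem sum_potential_le_sum_F {N : ℕ} (hN : 128 ≤ N) :
    ∑ t ∈ Finset.range N, potential N t / t / (t + 1) ≤ ∑ t ∈ Finset.Ico 1 N, F N t / (t + 1) := by
  obtain ⟨p, hp1, hp2⟩ : ∃ p : ℕ, N ≤ 4 * p ∧ 4 * p < N + 4 := ⟨(N + 3) / 4, by lia, by lia⟩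
  obtain ⟨q, hq1, hq2⟩ : ∃ q : ℕ, 7 * N ≤ 50 * q ∧ 50 * q < 7 * N + 50 :=
    ⟨(7 * N + 49) / 50, by lia, by lia⟩
  have hNR : (0 : ℝ) < N := by positivity
  have hpR : (0 : ℝ) < p := by exact_mod_cast (show 0 < p by lia)
  have hqR : (0 : ℝ) < q := by exact_mod_cast (show 0 < q by lia)
  -- The difference of the terms, in the range of the search bound `9 / 2 * critical N t`.
  have hlt : ∀ (i : ℕ) (t : ℕ), 1 ≤ t → 4 * t < N →
      (i : ℤ) < ⌈Real.logb (6 / 5) (critical N t)⌉ →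
      ((i : ℝ) - 2) * (1 / ((t : ℝ) + 1)) ≤ F N t / (t + 1) - potential N t / t / (t + 1) := by
    intro i t ht htN hi
    have h1 : (i : ℝ) + 1 ≤ ⌈Real.logb (6 / 5) (critical N t)⌉ := by exact_mod_cast hi
    rw [potential_div ht, if_pos htN, F_eq_of_lt htN, ← sub_div, mul_one_div]
    exact div_le_div_of_nonneg_right (by linarith) (by positivity)
  have h1 : 6 ≤ ∑ t ∈ Finset.Ico 1 4, (F N t / (t + 1) - potential N t / t / (t + 1)) := by
    rw [Finset.sum_Ico_succ_top (by norm_num), Finset.sum_Ico_succ_top (by norm_num),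
      Finset.sum_Ico_succ_top (by norm_num), Finset.Ico_self, Finset.sum_empty, zero_add]
    have h2 := hlt 9 1 (by lia) (by lia)
      (lt_ceil_logb_critical_of_le (by lia) (by lia) hN (by norm_num))
    have h3 := hlt 7 2 (by lia) (by lia)
      (lt_ceil_logb_critical_of_le (by lia) (by lia) hN (by norm_num))
    have h4 := hlt 6 3 (by lia) (by lia)
      (lt_ceil_logb_critical_of_le (by lia) (by lia) hN (by norm_num))
    refine le_trans ?_ (add_le_add (add_le_add h2 h3) h4)
    norm_num
  have h2 : 0 ≤ ∑ t ∈ Finset.Ico 4 q, (F N t / (t + 1) - potential N t / t / (t + 1)) := by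
    refine Finset.sum_nonneg fun t ht => ?_
    obtain ⟨ht1, ht2⟩ := Finset.mem_Ico.1 ht
    refine le_trans (le_of_eq ?_) (hlt 2 t (by lia) (by lia)
      (lt_ceil_logb_critical (by lia) (by lia) ?_))
    · norm_num
    · obtain ⟨s, rfl⟩ : ∃ s, N = t + s := ⟨N - t, by lia⟩
      rw [Nat.add_sub_cancel_left]
      have h3 : 43 * t < 7 * s := by lia
      nlinarith
  have h3 : -2 * ∑ t ∈ Finset.Ico q p, 1 / ((t : ℝ) + 1) ≤
      ∑ t ∈ Finset.Ico q p, (F N t / (t + 1) - potential N t / t / (t + 1)) := by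
    rw [Finset.mul_sum]
    refine Finset.sum_le_sum fun t ht => ?_
    obtain ⟨ht1, ht2⟩ := Finset.mem_Ico.1 ht
    refine le_trans (le_of_eq ?_) (hlt 0 t (by lia) (by lia)
      (lt_ceil_logb_critical (by lia) (by lia) ?_))
    · norm_num
    · obtain ⟨s, rfl⟩ : ∃ s, N = t + s := ⟨N - t, by lia⟩
      rw [Nat.add_sub_cancel_left]
      have h3 : 3 * t < s := by lia
      nlinarith
  have h4 : -3.1656 * ∑ t ∈ Finset.Ico p N, 1 / ((t : ℝ) + 1) =
      ∑ t ∈ Finset.Ico p N, (F N t / (t + 1) - potential N t / t / (t + 1)) := by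
    rw [Finset.mul_sum]
    refine Finset.sum_congr rfl fun t ht => ?_
    obtain ⟨ht1, ht2⟩ := Finset.mem_Ico.1 ht
    rw [potential_div (by lia), if_neg (by lia), F_eq_of_le (by lia), mul_one_div, ← sub_div]
    norm_num
  have h5 : ∑ t ∈ Finset.Ico q p, 1 / ((t : ℝ) + 1) + ∑ t ∈ Finset.Ico p N, 1 / ((t : ℝ) + 1) ≤
      Real.log 8 := by
    rw [Finset.sum_Ico_consecutive _ (by lia) (by lia)]
    refine (sum_inv_succ_le_log (by lia) (by lia)).trans ?_
    gcongr
    rw [div_le_iff₀ hqR]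
    exact_mod_cast (show N ≤ 8 * q by lia)
  have h6 : ∑ t ∈ Finset.Ico p N, 1 / ((t : ℝ) + 1) ≤ Real.log 4 := by
    refine (sum_inv_succ_le_log (by lia) (by lia)).trans ?_
    gcongr
    rw [div_le_iff₀ hpR]
    exact_mod_cast hp1
  have h7 := log_four_lt
  have h8 : Real.log 8 < 2.0796 := by
    have h := Real.log_two_lt_d9
    rw [show (8 : ℝ) = 2 ^ 3 by norm_num, Real.log_pow]
    push_cast
    linarith
  have h9 : 0 ≤ ∑ t ∈ Finset.Ico 1 N, (F N t / (t + 1) - potential N t / t / (t + 1)) := by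
    rw [← Finset.sum_Ico_consecutive _ (show 1 ≤ 4 by lia) (show 4 ≤ N by lia),
      ← Finset.sum_Ico_consecutive _ (show 4 ≤ q by lia) (show q ≤ N by lia),
      ← Finset.sum_Ico_consecutive _ (show q ≤ p by lia) (show p ≤ N by lia)]
    linarith
  rw [Finset.sum_sub_distrib] at h9
  rw [Finset.range_eq_Ico, Finset.sum_eq_sum_Ico_succ_bot (by lia), Nat.cast_zero, div_zero,
    zero_div, zero_add]
  simp only [Nat.zero_add] at *
  linarith

/-- Bounds `H t / t` for the costs of the searches, as needed by
`expectedQueries_le_of_searchCost`. -/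
theorem exists_of_two_le {N : ℕ} (hN : 2 ≤ N) :
    ∃ H : ℕ → ℝ, Monotone H ∧ H 0 = 0 ∧
      (∀ t, 1 ≤ t → t < N → SearchCostLE N t 0 (H t / t)) ∧
      ∑ t ∈ Finset.range N, H t / t / (t + 1) ≤ 26 / 5 * √N ∧
      (5 ≤ N → ∑ t ∈ Finset.range N, H t / t / (t + 1) ≤
        ∑ t ∈ Finset.Ico 1 N, F N t / (t + 1)) := by
  rcases lt_or_ge N 128 with h | h
  · exact exists_of_few_items hN h
  · refine ⟨potential N, potential_mono N, by simp [potential], fun t ht htN => ?_,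
      sum_potential_le_sqrt h, fun _ => sum_potential_le_sum_F h⟩
    rw [potential_div ht]
    split_ifs with h4
    · exact searchCostLE_of_lt_quarter (by lia) ht h4
    · exact searchCostLE_of_quarter_le (by lia) htN (by lia)

variable {L : Type*} [Fintype L] [Nonempty L] {R : L → ℝ} {cq k : ℕ}

theorem expectedQueries_le_sqrt (hk : 1 ≤ k) (hkcq : k ≤ cq) (hN : 2 ≤ Fintype.card L) :
    expectedQueries R cq k ≤ ENNReal.ofReal (cq * (26 / 5 * √(Fintype.card L))) := by
  obtain ⟨H, hH, hH0, hC, h1, -⟩ := exists_of_two_le hN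
  refine (expectedQueries_le_of_searchCost hk hkcq hH hH0 hC).trans ?_
  gcongr

theorem expectedQueries_le_seriesBound (hk : 1 ≤ k) (hkcq : k ≤ cq) (hN : 5 ≤ Fintype.card L) :
    expectedQueries R cq k ≤ ENNReal.ofReal (seriesBound (Fintype.card L) cq) := by
  obtain ⟨H, hH, hH0, hC, -, h1⟩ := exists_of_two_le (show 2 ≤ Fintype.card L by lia)
  refine (expectedQueries_le_of_searchCost hk hkcq hH hH0 hC).trans ?_
  rw [seriesBound]
  gcongr
  exact h1 hN

theorem expectedQueries_eq_zero (hk : 1 ≤ k) (hkcq : k ≤ cq) (hN : Fintype.card L = 1) :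
    expectedQueries R cq k = 0 := by
  have h := expectedQueries_le_of_searchCost (R := R) hk hkcq (H := fun _ => 0)
    (fun _ _ _ => le_rfl) rfl (fun t h1 h2 => by lia)
  simpa [hN] using h

end ManyItemsSums

/-! ### The series as a timeout, with direct arguments for two to four items -/

section TwoToFourItems

theorem hitProb_zero {N t : ℕ} (ht : t ≤ N) : hitProb N t 0 = t / N := by
  rw [hitProb, Nat.cast_zero, mul_zero, zero_add, one_mul, sin_groverAngle ht,
    Real.sq_sqrt (by positivity)]

theorem hitProb_one {N t : ℕ} (hN : 0 < N) (ht : t ≤ N) :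
    hitProb N t 1 = t * (3 * N - 4 * t) ^ 2 / N ^ 3 := by
  have hN' : (0 : ℝ) < N := by exact_mod_cast hN
  have h : √((t : ℝ) / N) ^ 2 = t / N := Real.sq_sqrt (by positivity)
  rw [hitProb, Nat.cast_one, show (2 : ℝ) * 1 + 1 = 3 by norm_num, Real.sin_three_mul,
    sin_groverAngle ht]
  calc (3 * √((t : ℝ) / N) - 4 * √((t : ℝ) / N) ^ 3) ^ 2
      = √((t : ℝ) / N) ^ 2 * (3 - 4 * √((t : ℝ) / N) ^ 2) ^ 2 := by ring
    _ = (t : ℝ) * (3 * N - 4 * t) ^ 2 / N ^ 3 := by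
      rw [h]
      field_simp

/-- Upper bounds, in percent, for the probability that a run with at most four items exceeds its
budget: the entry number `t` of the list number `n` is for an item with `t` better ones when `n - 1`
oracle calls are left. -/
def failureTable : ℕ → List (List ℕ)
  | 2 => [[100, 100], [0, 100], [0, 75], [0, 44], [0, 30]]
  | 3 => [[100, 100, 100], [0, 100, 100], [0, 84, 84], [0, 32, 77], [0, 14, 59], [0, 6, 49],
      [0, 3, 37]]
  | _ => [[100, 100, 100, 100], [0, 100, 100, 100], [0, 88, 88, 88], [0, 33, 71, 83],
      [0, 13, 55, 68], [0, 5, 38, 59], [0, 2, 26, 47], [0, 1, 17, 39]]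

/-- The entry of `failureTable`, where the last list is also used for all larger budgets. -/
def failurePercent (N β n t : ℕ) : ℕ := ((failureTable N).getD (min n (β + 1)) []).getD t 0

/-- The conditions on `failureTable`, for the budget of `β` oracle calls, that make it an upper
bound for the failure probabilities. -/
def IsFailureBound (N β : ℕ) : Prop :=
  (∀ t < N, failurePercent N β 0 t = 100) ∧
  (∀ n < β + 2, ∀ t < N, failurePercent N β n t ≤ 100) ∧
  (∀ n < β + 2, ∀ t < N, ∀ s < t, failurePercent N β n s ≤ failurePercent N β n t) ∧
  (∀ n < β + 1, ∀ t < N, failurePercent N β (n + 1) t ≤ failurePercent N β n t) ∧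
  (∀ n < β + 1, ∀ t < N, 1 ≤ t →
    (N ^ 2 * (∑ i ∈ Finset.range t, failurePercent N β n i : ℕ) +
      N ^ 2 * (N - t) * failurePercent N β n t +
      (3 * N - 4 * t) ^ 2 * (∑ i ∈ Finset.range t, failurePercent N β (n - 1) i : ℕ) +
      (N ^ 3 - t * (3 * N - 4 * t) ^ 2) * failurePercent N β (n - 1) t : ℤ) ≤
      2 * N ^ 3 * failurePercent N β (n + 1) t) ∧
  3 * ∑ i ∈ Finset.range N, failurePercent N β (β + 1) i ≤ 100 * N

instance (N β : ℕ) : Decidable (IsFailureBound N β) := by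
  unfold IsFailureBound
  infer_instance

theorem isFailureBound_two : IsFailureBound 2 3 := by decide +kernel

theorem isFailureBound_three : IsFailureBound 3 5 := by decide +kernel

theorem isFailureBound_four : IsFailureBound 4 6 := by decide +kernel

variable {L : Type*} [Fintype L] [Nonempty L] {R : L → ℝ} {cq k : ℕ}

theorem IsFailureBound.timeoutSuffices {β : ℕ} (h : IsFailureBound (Fintype.card L) β)
    (hN2 : 2 ≤ Fintype.card L) (hN4 : Fintype.card L ≤ 4) (hk : 1 ≤ k) (hkcq : k ≤ cq) {ε : ℝ}
    (hε : 0 < ε) {T : ℝ≥0} (hT : ((cq * β : ℕ) : ℝ≥0) ≤ T) : TimeoutSuffices R cq k ε T := by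
  obtain ⟨h0, h1, ht, hn, hrec, hsum⟩ := h
  set N := Fintype.card L with hN
  have hmin : ∀ n t, failurePercent N β n t = failurePercent N β (min n (β + 1)) t := fun n t => by
    rw [failurePercent, failurePercent, min_assoc, min_self]
  set g : ℕ → ℕ → ℝ := fun n t => if t < N then (failurePercent N β n t : ℝ) / 100 else 1 with hg
  have hglt : ∀ n t, t < N → g n t = (failurePercent N β n t : ℝ) / 100 := fun n t htN => if_pos htN
  have hgle : ∀ n t, g n t ≤ 1 := fun n t => by
    simp only [hg]
    split_ifs with htN
    · rw [div_le_one (by norm_num), hmin]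
      exact_mod_cast h1 _ (by lia) t htN
    · exact le_rfl
  have hgsum : ∀ n t, t ≤ N → ∑ i ∈ Finset.range t, g n i =
      ((∑ i ∈ Finset.range t, failurePercent N β n i : ℕ) : ℝ) / 100 := fun n t htN => by
    rw [Nat.cast_sum, Finset.sum_div]
    exact Finset.sum_congr rfl fun i hi => hglt n i ((Finset.mem_range.1 hi).trans_le htN)
  have hNR : (0 : ℝ) < N := by positivity
  refine timeoutSuffices_of_failureBound hk hkcq hε hT ?_ (g := g) ?_ ?_ ?_ ?_ ?_ ?_
  · intro u
    rw [← hN, numChoices_eq_min hN2]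
    have h2 : 1 < ceilPow u := by
      rw [← ceil_pow, Nat.lt_ceil, Nat.cast_one]
      exact one_lt_pow₀ (by norm_num) (by lia)
    have h3 : 1 ≤ Nat.sqrt (N - 1) := Nat.le_sqrt.2 (by lia)
    have h4 : Nat.sqrt (N - 1) < 2 := Nat.sqrt_lt.2 (by lia)
    lia
  · intro t
    simp only [hg]
    split_ifs with htN
    · rw [h0 t htN]
      norm_num
    · rfl
  · intro n t
    simp only [hg]
    split_ifs <;> positivity
  · intro n s t hst
    rcases hst.eq_or_lt with rfl | hst
    · exact le_rfl
    by_cases htN : t < N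
    · rw [hglt n t htN, hglt n s (hst.trans htN), hmin n, hmin n]
      gcongr
      exact ht _ (by lia) t htN s hst
    · refine (hgle n s).trans (le_of_eq ?_)
      simp only [hg, if_neg htN]
  · intro m n hmn hnβ t
    by_cases htN : t < N
    · rw [hglt n t htN, hglt m t htN]
      gcongr
      induction n, hmn using Nat.le_induction with
      | base => exact le_rfl
      | succ n hmn ih => exact (hn n (by lia) t htN).trans (ih (by lia))
    · simp only [hg, if_neg htN, le_refl]
  · intro n t hnβ ht1 htN
    rw [← hN] at htN ⊢
    have h2 := hrec n (by lia) t htN ht1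
    rw [hitProb_zero htN.le, hitProb_one (by lia) htN.le, hgsum _ _ htN.le, hgsum _ _ htN.le,
      hglt _ _ htN, hglt _ _ htN, hglt _ _ htN]
    have htR : (0 : ℝ) < t := by exact_mod_cast ht1
    generalize ∑ i ∈ Finset.range t, failurePercent N β n i = a at *
    generalize ∑ i ∈ Finset.range t, failurePercent N β (n - 1) i = b at *
    have h3 : ((N : ℝ) ^ 2 * a + N ^ 2 * (N - t) * failurePercent N β n t +
        (3 * N - 4 * t) ^ 2 * b +
        (N ^ 3 - t * (3 * N - 4 * t) ^ 2) * failurePercent N β (n - 1) t) ≤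
        2 * N ^ 3 * failurePercent N β (n + 1) t := by exact_mod_cast h2
    rw [le_div_iff₀ (by norm_num), ← mul_le_mul_iff_right₀ (show 0 < 2 * (N : ℝ) ^ 3 by positivity)]
    refine le_trans (le_of_eq ?_) h3
    field_simp
    ring
  · rw [← hN, hgsum _ _ le_rfl, div_le_div_iff₀ (by norm_num) (by norm_num)]
    have h2 : ((3 * ∑ i ∈ Finset.range N, failurePercent N β (β + 1) i : ℕ) : ℝ) ≤
        (100 * N : ℕ) := by
      exact_mod_cast hsum
    push_cast at h2 ⊢
    linarith

theorem le_three_mul_seriesBound {N cq β : ℕ} {x : ℝ} (hN : N ≤ 4)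
    (hx : x = ∑ t ∈ Finset.Ico 1 N, 2.0344 / ((t : ℝ) + 1)) (hβ : β ≤ 3 * x) :
    ((cq * β : ℕ) : ℝ) ≤ 3 * seriesBound N cq := by
  have h : ∑ t ∈ Finset.Ico 1 N, F N t / (t + 1) = x := by
    rw [hx]
    refine Finset.sum_congr rfl fun t ht => ?_
    have := (Finset.mem_Ico.1 ht).1
    rw [F_eq_of_le (by lia)]
  rw [seriesBound, h]
  push_cast
  have := mul_le_mul_of_nonneg_left hβ (Nat.cast_nonneg (α := ℝ) cq)
  linarith

/-- For two to four items, the expected number of queries may exceed the series, and the failure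
probability of a run is bounded directly; the budgets of 3, 5 and 6 oracle calls are the integer
parts of `3 * seriesBound N 1`. -/
theorem timeoutSuffices_of_seriesBound_le (hk : 1 ≤ k) (hkcq : k ≤ cq) {ε : ℝ} (hε : 0 < ε)
    {T : ℝ≥0} (hT : 3 * seriesBound (Fintype.card L) cq ≤ T) : TimeoutSuffices R cq k ε T := by
  have hN : 0 < Fintype.card L := Fintype.card_pos
  have key : ∀ β : ℕ, ((cq * β : ℕ) : ℝ) ≤ 3 * seriesBound (Fintype.card L) cq →
      ((cq * β : ℕ) : ℝ≥0) ≤ T := fun β hβ => by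
    rw [← NNReal.coe_le_coe, NNReal.coe_natCast]
    exact hβ.trans hT
  obtain h | h | h | h | h : Fintype.card L = 1 ∨ Fintype.card L = 2 ∨ Fintype.card L = 3 ∨
    Fintype.card L = 4 ∨ 5 ≤ Fintype.card L := by lia
  · refine timeoutSuffices_of_expectedQueries_le hk hε ?_
    rw [expectedQueries_eq_zero hk hkcq h, mul_zero]
    exact zero_le
  · refine IsFailureBound.timeoutSuffices (β := 3) (by rw [h]; exact isFailureBound_two)
      (by lia) (by lia) hk hkcq hε (key 3 ?_)
    refine le_three_mul_seriesBound (by lia) rfl ?_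
    norm_num [h, Finset.sum_Ico_succ_top]
  · refine IsFailureBound.timeoutSuffices (β := 5) (by rw [h]; exact isFailureBound_three)
      (by lia) (by lia) hk hkcq hε (key 5 ?_)
    refine le_three_mul_seriesBound (by lia) rfl ?_
    norm_num [h, Finset.sum_Ico_succ_top]
  · refine IsFailureBound.timeoutSuffices (β := 6) (by rw [h]; exact isFailureBound_four)
      (by lia) (by lia) hk hkcq hε (key 6 ?_)
    refine le_three_mul_seriesBound (by lia) rfl ?_
    norm_num [h, Finset.sum_Ico_succ_top]
  · refine timeoutSuffices_of_expectedQueries_le hk hε ?_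
    calc 3 * expectedQueries R cq k ≤ 3 * ENNReal.ofReal (seriesBound (Fintype.card L) cq) := by
          gcongr
          exact expectedQueries_le_seriesBound hk hkcq h
      _ = ENNReal.ofReal (3 * seriesBound (Fintype.card L) cq) := by
          rw [ENNReal.ofReal_mul (by norm_num), ENNReal.ofReal_ofNat]
      _ ≤ T := ENNReal.ofReal_le_of_le_toReal hT

end TwoToFourItems

/-! ### The explicit timeouts -/

section ExplicitTimeouts

/-- The integrand `log (1 + v) / v` is at most `1` for `v ≤ 1`, and at most `log (1 + b) / v`
later. -/
theorem neg_dilog_neg_le (b : ℕ) : -dilog (-b) ≤ 1 + Real.log (b + 1) * Real.log b := by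
  have hsub : -dilog (-b) = ∫ v in (0 : ℝ)..b, Real.log (1 + v) / v := by
    have h := intervalIntegral.integral_comp_neg (a := 0) (b := b)
      (fun u : ℝ => Real.log (1 - u) / u)
    rw [neg_zero] at h
    calc -dilog (-b) = -∫ u in (-b : ℝ)..0, Real.log (1 - u) / u := by
          rw [dilog, neg_neg, intervalIntegral.integral_symm]
      _ = ∫ v in (0 : ℝ)..b, -(Real.log (1 - -v) / -v) := by
          rw [← h, intervalIntegral.integral_neg]
      _ = ∫ v in (0 : ℝ)..b, Real.log (1 + v) / v := by
          simp only [div_neg, neg_neg, sub_neg_eq_add]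
  rw [hsub]
  rcases Nat.eq_zero_or_pos b with rfl | hb
  · simp
  have hb1 : (1 : ℝ) ≤ b := by exact_mod_cast hb
  have hmeas : Measurable fun v : ℝ => Real.log (1 + v) / v := by fun_prop
  have hnn : ∀ v : ℝ, 0 < v → 0 ≤ Real.log (1 + v) / v := fun v hv =>
    div_nonneg (Real.log_nonneg (by linarith)) hv.le
  have hle : ∀ v : ℝ, 0 < v → Real.log (1 + v) / v ≤ 1 := fun v hv => by
    rw [div_le_one hv]
    have := Real.log_le_sub_one_of_pos (show 0 < 1 + v by linarith)
    linarith
  have hint : ∀ x y : ℝ, 0 ≤ x → x ≤ y →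
      IntervalIntegrable (fun v : ℝ => Real.log (1 + v) / v) volume x y := fun x y hx hxy => by
    refine (intervalIntegrable_const (c := (1 : ℝ))).mono_fun hmeas.aestronglyMeasurable ?_
    rw [Set.uIoc_of_le hxy]
    filter_upwards [ae_restrict_mem measurableSet_Ioc] with v hv
    have hv0 : 0 < v := hx.trans_lt hv.1
    rw [Real.norm_of_nonneg (hnn v hv0), norm_one]
    exact hle v hv0
  rw [← intervalIntegral.integral_add_adjacent_intervals (hint 0 1 le_rfl zero_le_one)
    (hint 1 b zero_le_one hb1)]
  refine add_le_add ?_ ?_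
  · calc ∫ v in (0 : ℝ)..1, Real.log (1 + v) / v ≤ ∫ v in (0 : ℝ)..1, (1 : ℝ) := by
          refine intervalIntegral.integral_mono_on_of_le_Ioo zero_le_one
            (hint 0 1 le_rfl zero_le_one) intervalIntegrable_const fun v hv => hle v hv.1
      _ = 1 := by simp
  · have hinv : IntervalIntegrable (fun v : ℝ => v⁻¹) volume 1 b :=
      intervalIntegral.intervalIntegrable_inv (fun v hv => by
        rw [Set.uIcc_of_le hb1] at hv
        exact (zero_lt_one.trans_le hv.1).ne') continuousOn_id
    calc ∫ v in (1 : ℝ)..b, Real.log (1 + v) / v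
        ≤ ∫ v in (1 : ℝ)..b, Real.log (b + 1) * v⁻¹ := by
          refine intervalIntegral.integral_mono_on hb1 (hint 1 b zero_le_one hb1)
            (hinv.const_mul _) fun v hv => ?_
          have hv0 : 0 < v := zero_lt_one.trans_le hv.1
          rw [div_eq_mul_inv]
          have hlog : Real.log (1 + v) ≤ Real.log (b + 1) :=
            Real.log_le_log (by linarith) (by linarith [hv.2])
          gcongr
      _ = Real.log (b + 1) * Real.log b := by
          rw [intervalIntegral.integral_const_mul, integral_inv_of_pos zero_lt_one (by linarith),
            div_one]

/-- The terms of the second explicit timeout other than its leading one are nonnegative. The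
dilogarithm is compensated by the product of `log (N / 4)` and `log (N / 4 + 1)`, and what is left
is a quadratic polynomial in `log (N / 4)` without real zeros. -/
theorem nonneg_tight_remainder {N : ℕ} (hN : 2 ≤ N) :
    0 ≤ 3 * Real.log (N / 4) / (2 * Real.log (6 / 5)) *
        (Real.log (N / 3) + Real.log (N / 4 + 1)) - 6 * Real.log (N / 4) + 16.0466 +
      3 * dilog (-⌈(N : ℝ) / 4⌉ + 1) / (2 * Real.log (6 / 5)) := by
  have hl1 : 1 / 6 ≤ Real.log (6 / 5) := by
    have := Real.one_sub_inv_le_log_of_pos (show (0 : ℝ) < 6 / 5 by norm_num)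
    norm_num at this ⊢
    exact this
  have hl2 : Real.log (6 / 5) ≤ 1 / 5 := by
    have := Real.log_le_sub_one_of_pos (show (0 : ℝ) < 6 / 5 by norm_num)
    norm_num at this ⊢
    exact this
  obtain ⟨c, hc⟩ : ∃ c, c = 3 / (2 * Real.log (6 / 5)) := ⟨_, rfl⟩
  have hc1 : 15 / 2 ≤ c := by
    rw [hc, le_div_iff₀ (by linarith)]
    linarith
  have hc2 : c ≤ 9 := by
    rw [hc, div_le_iff₀ (by linarith)]
    linarith
  rw [mul_div_right_comm, mul_div_right_comm, ← hc]
  have hNR : (2 : ℝ) ≤ N := by exact_mod_cast hN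
  rcases Nat.lt_or_ge N 4 with h4 | h4
  · have hceil : ⌈(N : ℝ) / 4⌉ = 1 := by
      rw [Int.ceil_eq_iff]
      have : (N : ℝ) ≤ 3 := by exact_mod_cast (show N ≤ 3 by lia)
      constructor <;> norm_num <;> linarith
    rw [hceil]
    have hd : dilog (-((1 : ℤ) : ℝ) + 1) = 0 := by norm_num [dilog]
    rw [hd, mul_zero, add_zero]
    obtain rfl | rfl : N = 2 ∨ N = 3 := by lia
    · have h1 : Real.log (2 / 3) + Real.log (2 / 4 + 1) = 0 := by
        rw [← Real.log_mul (by norm_num) (by norm_num)]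
        norm_num
      have h2 : Real.log (2 / 4) ≤ 0 := Real.log_nonpos (by norm_num) (by norm_num)
      push_cast
      rw [h1, mul_zero]
      linarith
    · have h1 : -(1 / 3) ≤ Real.log (3 / 4) := by
        have := Real.one_sub_inv_le_log_of_pos (show (0 : ℝ) < 3 / 4 by norm_num)
        norm_num at this ⊢
        exact this
      have h2 : Real.log (3 / 4) ≤ 0 := Real.log_nonpos (by norm_num) (by norm_num)
      have h3 : Real.log (3 / 4 + 1) ≤ 3 / 4 := by
        have := Real.log_le_sub_one_of_pos (show (0 : ℝ) < 3 / 4 + 1 by norm_num)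
        linarith
      have h4 : 0 ≤ Real.log (3 / 4 + 1) := Real.log_nonneg (by norm_num)
      push_cast
      rw [div_self (by norm_num : (3 : ℝ) ≠ 0), Real.log_one, zero_add]
      have h5 : c * -Real.log (3 / 4) ≤ 9 * (1 / 3) :=
        mul_le_mul hc2 (by linarith) (by linarith) (by norm_num)
      have h6 : c * -Real.log (3 / 4) * Real.log (3 / 4 + 1) ≤ 9 * (1 / 3) * (3 / 4) :=
        mul_le_mul h5 h3 h4 (by norm_num)
      linarith
  · have hNR4 : (4 : ℝ) ≤ N := by exact_mod_cast h4
    obtain ⟨b, hb⟩ : ∃ b : ℕ, ⌈(N : ℝ) / 4⌉ = (b : ℤ) + 1 := by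
      have : 0 < ⌈(N : ℝ) / 4⌉ := Int.ceil_pos.2 (by linarith)
      exact ⟨(⌈(N : ℝ) / 4⌉ - 1).toNat, by lia⟩
    have hbN : (b : ℝ) ≤ N / 4 := by
      have := Int.ceil_lt_add_one ((N : ℝ) / 4)
      rw [hb] at this
      push_cast at this
      linarith
    have harg : -(⌈(N : ℝ) / 4⌉ : ℝ) + 1 = -b := by
      rw [hb]
      push_cast
      ring
    rw [harg]
    set l := Real.log (N / 4) with hl
    have hl0 : 0 ≤ l := Real.log_nonneg (by linarith)
    have h1 : -dilog (-b) ≤ 1 + Real.log (N / 4 + 1) * l := by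
      refine (neg_dilog_neg_le b).trans ?_
      rcases Nat.eq_zero_or_pos b with rfl | hb0
      · have : 0 ≤ Real.log ((N : ℝ) / 4 + 1) := Real.log_nonneg (by linarith)
        simp only [Nat.cast_zero, Real.log_zero, mul_zero, add_zero]
        nlinarith
      · have hb0' : (0 : ℝ) < b := by exact_mod_cast hb0
        have hb1 : 0 ≤ Real.log b := Real.log_natCast_nonneg b
        have : 0 ≤ Real.log ((N : ℝ) / 4 + 1) := Real.log_nonneg (by linarith)
        rw [hl]
        gcongr
    have h2 : l + 1 / 4 ≤ Real.log (N / 3) := by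
      rw [show (N : ℝ) / 3 = N / 4 * (4 / 3) by ring, Real.log_mul (by positivity) (by norm_num)]
      have := Real.one_sub_inv_le_log_of_pos (show (0 : ℝ) < 4 / 3 by norm_num)
      norm_num at this
      linarith
    have h3 : c * (l * (l + 1 / 4) - 1) ≤
        c * (l * (Real.log (N / 3) + Real.log (N / 4 + 1)) + dilog (-b)) := by
      have := mul_le_mul_of_nonneg_left h2 hl0
      refine mul_le_mul_of_nonneg_left ?_ (by linarith)
      linarith
    -- The lower bound is affine in `c`, so that it suffices to treat the ends of its range.
    have h4 : 0 ≤ c * (l * (l + 1 / 4) - 1) - 6 * l + 16.0466 := by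
      nlinarith [sq_nonneg (l - 1 / 4), mul_nonneg (sub_nonneg.2 hc1) (sq_nonneg l),
        mul_nonneg (sub_nonneg.2 hc1) hl0]
    linarith

theorem coefficient_tight_ge : 78 / 5 ≤ 9 * √3 * (1 + Real.pi) / 4 := by
  have h1 : (17 / 10 : ℝ) ≤ √3 := Real.le_sqrt_of_sq_le (by norm_num)
  have h2 := Real.pi_gt_d2
  nlinarith

variable {L : Type*} [Fintype L] [Nonempty L] {R : L → ℝ} {cq k : ℕ}

theorem three_mul_expectedQueries_le (hk : 1 ≤ k) (hkcq : k ≤ cq) {x : ℝ}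
    (hx : 2 ≤ Fintype.card L → 78 / 5 * √(Fintype.card L) ≤ x) :
    3 * expectedQueries R cq k ≤ ENNReal.ofReal (cq * x) := by
  have hN : 0 < Fintype.card L := Fintype.card_pos
  rcases Nat.lt_or_ge (Fintype.card L) 2 with h | h
  · rw [expectedQueries_eq_zero hk hkcq (by lia), mul_zero]
    exact zero_le
  · calc 3 * expectedQueries R cq k
        ≤ 3 * ENNReal.ofReal (cq * (26 / 5 * √(Fintype.card L))) := by
          gcongr
          exact expectedQueries_le_sqrt hk hkcq h
      _ = ENNReal.ofReal (cq * (78 / 5 * √(Fintype.card L))) := by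
          rw [← ENNReal.ofReal_ofNat, ← ENNReal.ofReal_mul (by norm_num)]
          congr 1
          ring
      _ ≤ _ := by
          gcongr
          exact hx h

end ExplicitTimeouts

end QMax

theorem mainTheorem8 {L : Type*} [Fintype L] [Nonempty L] (R : L → ℝ)
    (cq k : ℕ) (hk : 1 ≤ k) (hkcq : k ≤ cq) (ε : ℝ) (hε : 0 < ε) :
    (∀ T : ℝ≥0, 3 * QMax.expectedQueries R cq k ≤ T → QMax.TimeoutSuffices R cq k ε T) ∧
    (∀ T : ℝ≥0, 3 * QMax.seriesBound (Fintype.card L) cq ≤ T →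
      QMax.TimeoutSuffices R cq k ε T) ∧
    3 * QMax.expectedQueries R cq k ≤
      ENNReal.ofReal (QMax.looseTimeout (Fintype.card L) cq) ∧
    3 * QMax.expectedQueries R cq k ≤
      ENNReal.ofReal (QMax.tightTimeout (Fintype.card L) cq) := by
  refine ⟨fun T hT => QMax.timeoutSuffices_of_expectedQueries_le hk hε hT,
    fun T hT => QMax.timeoutSuffices_of_seriesBound_le hk hkcq hε hT,
    QMax.three_mul_expectedQueries_le hk hkcq fun _ => ?_,
    QMax.three_mul_expectedQueries_le hk hkcq fun hN => ?_⟩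
  · have := Real.sqrt_nonneg (Fintype.card L : ℝ)
    linarith
  · have h1 := QMax.nonneg_tight_remainder hN
    have h2 := mul_le_mul_of_nonneg_right QMax.coefficient_tight_ge
      (Real.sqrt_nonneg (Fintype.card L : ℝ))
    linarith
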